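/- Let $m\ge 3$ and let $\mathbb C_m$ be the complex Clifford algebra generated by $e_1,\dots,e_m$ with $e_j^2=-1$ and $e_je_k+e_ke_j=0$ for $j\ne k$. A vector $z\in\mathbb C^m$ is identified with $\underline z=\sum_j z_je_j\in\mathbb C_m$, and $\langle u,v\rangle=\sum_j u_jv_j$ is the bilinear product. Let $\mathcal M_k(\mathbb C^m)$ be the space of $\mathbb C_m$-valued $k$-homogeneous polynomials $M$ on $\mathbb C^m$ with $\sum_j e_j\partial_{z_j}M=0$. Let $A_m=2\pi^{m/2}/\Gamma(m/2)$ be the area of $\mathbb S^{m-1}$, and let $$LB(0,1)=\{x+iy \mid \{u\in\mathbb R^m : |u-x|=|y|,\ \langle u-x,y\rangle=0\}\subset B(0,1)\}$$ be the Lie ball, where $x,y\in\mathbb R^m$ and $B(0,1)$ is the open unit ball of $\mathbb R^m$. For orthogonal $t_0,s_0\in\mathbb S^{m-1}$ put $\tau=t_0+is_0$ and $\tau^\dagger=-t_0+is_0$. The polarized Hua–Radon transform of $f$ is $$\mathcal R^H_\tau[f](z)=\int_{\mathbb S^{m-1}}\int_0^\pi L_\tau(z,e^{-i\theta}\omega)\,f(e^{i\theta}\omega)\,d\theta\,dS(\omega),\qquad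 z\in LB(0,1),$$ $$L_\tau(z,w)=\frac1{\pi A_m}\Big(\sum_{s,k\ge 0}\nu_{k,s}\,a^{k+s}b^s-\frac{\underline\tau^\dagger\underline\tau}{4}\sum_{s\ge 0}\nu_{0,s}\,a^sb^s\Big),\qquad a=\langle z,\tau\rangle\langle w,\tau^\dagger\rangle,\quad b=\langle z,\tau^\dagger\rangle\langle w,\tau\rangle,$$ $$\nu_{k,s}=(-1)^k\frac{\Gamma(k+2s+\frac m2)}{\Gamma(k+2s+1)\,\Gamma(\frac m2)}.$$ The dual Radon transform of a function $F(z,\tau)$ is $$\tilde R[F](z)=\frac1{A_mA_{m-1}}\int_{\mathbb S^{m-1}}\int_{\mathbb S^{m-2}}F(z,t_0+is_0)\,dS(s_0)\,dS(t_0),$$ where $\mathbb S^{m-2}$ is the unit sphere in the hyperplane orthogonal to $t_0$. Let $$\theta_{n,k,\ell}=(-1)^{k+\ell}\frac{\Gamma(m-1)\,\Gamma(\frac m2+k-n-1)\,\Gamma(\frac m2+\ell-n-1)\,(m-2)}{4(\ell-n)!\,\Gamma(\frac m2+k+\ell-n)^2\,\Gamma(m+k+\ell-2n-2)}\Big(\frac{k!\,\ell!}{n!}\Big)^2\frac{(k+\ell-2n)!}{(k-n)!}$$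 for $n\le\min\{k,\ell\}$, $\theta_{n,k,\ell}=0$ for $n>\min\{k,\ell\}$, and $\vartheta_{2n,\ell}=2\theta_{n,\ell,\ell}$. **Proposition.** Let $t,n\in\mathbb N=\{0,1,2,\dots\}$ with $t-2n-1\ge 0$, let $M_{t-2n-1}\in\mathcal M_{t-2n-1}(\mathbb C^m)$, and let $f(z)=\underline z^{2n+1}M_{t-2n-1}(z)$. Then for every $z\in LB(0,1)$ the series and integrals defining $\mathcal R^H_\tau[f](z)$ (for every $\tau$ as above) and $\tilde R[\mathcal R^H_\tau[f]](z)$ converge, and $$\tilde R\big[\mathcal R^H_\tau[\underline z^{2n+1}M_{t-2n-1}(z)]\big]=\rho_{t,2n+1}\,\underline z^{2n+1}M_{t-2n-1}(z),$$ where $$\rho_{t,2n+1}=\begin{cases}\displaystyle\sum_{s=0}^{\ell}\nu_{2\ell-2s,s}\,\theta_{n,2\ell-s,s}-\tfrac14\nu_{0,\ell}\,\vartheta_{2n,\ell}&\text{if }t=2\ell\text{ is even},\\[2mm]\displaystyle\sum_{s=0}^{\ell}\nu_{2\ell+1-2s,s}\,\theta_{n,2\ell+1-s,s}&\text{if }t=2\ell+1\text{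 is odd}.\end{cases}$$ -/

import Mathlib

open MeasureTheory
open scoped TensorProduct

noncomputable section

namespace HuaRadon

/-- Real Euclidean space `ℝ^m`. -/
abbrev RVec (m : ℕ) : Type := EuclideanSpace ℝ (Fin m)

/-- The complex vector space `ℂ^m`. -/
abbrev CVec (m : ℕ) : Type := Fin m → ℂ

/-! ### The complex Clifford algebra -/

/-- The quadratic form `v ↦ -∑ v_j ^ 2` on `ℂ^m`. -/
def cliffordForm (m : ℕ) : QuadraticForm ℂ (CVec m) :=
  QuadraticMap.weightedSumSquares ℂ (fun _ : Fin m => (-1 : ℂ))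

/-- The complex Clifford algebra `ℂ_m`, generated by `e_1, …, e_m` with `e_j ^ 2 = -1` and
`e_j e_k + e_k e_j = 0` for `j ≠ k`. -/
abbrev Cl (m : ℕ) : Type := CliffordAlgebra (cliffordForm m)

/-- The 1-vector `∑ v_j e_j` of `ℂ_m` given by `v ∈ ℂ^m`. -/
def vec {m : ℕ} (v : CVec m) : Cl m := CliffordAlgebra.ι (cliffordForm m) v

/-- The generator `e_j`. -/
def gen {m : ℕ} (j : Fin m) : Cl m := vec (Pi.single j 1)

/-- The basis `(e_A)` of `ℂ_m` indexed by the subsets `A` of `{1, …, m}`. -/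
def cliffordBasis (m : ℕ) : Module.Basis (Finset (Fin m)) ℂ (Cl m) :=
  (Pi.basisFun ℂ (Fin m)).ExteriorAlgebra.map
    (CliffordAlgebra.equivExterior (cliffordForm m)).symm

/-- Integrability of a `ℂ_m`-valued function: all its coordinates are integrable. -/
def CliffordIntegrable {m : ℕ} {X : Type*} [MeasurableSpace X] (μ : Measure X)
    (g : X → Cl m) : Prop :=
  ∀ A : Finset (Fin m), Integrable (fun x => (cliffordBasis m).repr (g x) A) μ

/-- The integral of a `ℂ_m`-valued function, taken coordinatewise. -/
def cliffordIntegral {m : ℕ} {X : Type*} [MeasurableSpace X] (μ : Measure X)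
    (g : X → Cl m) : Cl m :=
  ∑ A : Finset (Fin m), (∫ x, (cliffordBasis m).repr (g x) A ∂μ) • cliffordBasis m A

/-! ### Vectors -/

/-- A real vector regarded as a complex one. -/
def toCVec {m : ℕ} (u : RVec m) : CVec m := fun j => ((u j : ℝ) : ℂ)

/-- The real part of a complex vector. -/
def reVec {m : ℕ} (z : CVec m) : RVec m := WithLp.toLp 2 (fun j => (z j).re)

/-- The imaginary part of a complex vector. -/
def imVec {m : ℕ} (z : CVec m) : RVec m := WithLp.toLp 2 (fun j => (z j).im)

/-- The bilinear (not sesquilinear) product `⟨u, v⟩ = ∑ u_j v_j` on `ℂ^m`. -/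
def bil {m : ℕ} (u v : CVec m) : ℂ := ∑ j, u j * v j

/-- The Hermitian conjugate `τ†` of a 1-vector. Since `e_j† = -e_j`, its coordinates are
`-conj τ_j`; in particular `(t + i s)† = -t + i s` for real `t`, `s`. -/
def dagger {m : ℕ} (τ : CVec m) : CVec m := fun j => -(starRingEnd ℂ) (τ j)

/-- The vector `t + i s`. -/
def tauVec {m : ℕ} (t s : RVec m) : CVec m := toCVec t + Complex.I • toCVec s

/-- The Lie ball `LB(0,1)`: all `x + i y` such that the codimension two sphere
`{u | |u - x| = |y|, ⟨u - x, y⟩ = 0}` is contained in the open unit ball. -/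
def lieBall (m : ℕ) : Set (CVec m) :=
  {z | {u : RVec m | ‖u - reVec z‖ = ‖imVec z‖ ∧ inner ℝ (u - reVec z) (imVec z) = 0} ⊆
    Metric.ball 0 1}

/-! ### Monogenic polynomials -/

/-- Polynomials in `z_1, …, z_m` with coefficients in `ℂ_m`. -/
abbrev CliffordPoly (m : ℕ) : Type := MvPolynomial (Fin m) ℂ ⊗[ℂ] Cl m

/-- The value of a Clifford valued polynomial at `z ∈ ℂ^m`; it sends `P ⊗ α` to `P(z) α`. -/
def evalPoly {m : ℕ} (z : CVec m) : CliffordPoly m →ₗ[ℂ] Cl m :=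
  TensorProduct.lift
    ((LinearMap.lsmul ℂ (Cl m)).comp (MvPolynomial.aeval (R := ℂ) z).toLinearMap)

/-- The complexified Dirac operator `∑ e_j ∂_{z_j}`, acting from the left. -/
def diracOp (m : ℕ) : CliffordPoly m →ₗ[ℂ] CliffordPoly m :=
  ∑ j : Fin m, TensorProduct.map
    (MvPolynomial.pderiv (R := ℂ) j).toLinearMap (LinearMap.mulLeft ℂ (gen j))

/-- The space `P_k ⊗ ℂ_m` of `k`-homogeneous Clifford valued polynomials. -/
def homogeneousPoly (m k : ℕ) : Submodule ℂ (CliffordPoly m) :=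
  LinearMap.range (TensorProduct.map
    (MvPolynomial.homogeneousSubmodule (Fin m) ℂ k).subtype
    (LinearMap.id : Cl m →ₗ[ℂ] Cl m))

/-- The space `M_k(ℂ^m)` of left monogenic polynomials of degree `k`. -/
def monogenicPoly (m k : ℕ) : Submodule ℂ (CliffordPoly m) :=
  homogeneousPoly m k ⊓ LinearMap.ker (diracOp m)

/-! ### Spheres -/

/-- The surface measure on the unit sphere of a finite dimensional Euclidean space, induced by
its Lebesgue measure (the unit cube of any orthonormal basis has measure one). -/
def sphereMeasure (F : Type*) [NormedAddCommGroup F] [InnerProductSpace ℝ F]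
    [FiniteDimensional ℝ F] [MeasurableSpace F] [BorelSpace F] :
    Measure (Metric.sphere (0 : F) 1) :=
  (stdOrthonormalBasis ℝ F).toBasis.addHaar.toSphere

/-- The area `A_m = 2 π^{m/2} / Γ(m/2)` of the unit sphere of `ℝ^m`. -/
def sphereArea (m : ℕ) : ℝ := 2 * Real.pi ^ ((m : ℝ) / 2) / Real.Gamma ((m : ℝ) / 2)

/-- The hyperplane of `ℝ^m` orthogonal to `t`. -/
abbrev orthHyperplane {m : ℕ} (t : RVec m) : Submodule ℝ (RVec m) :=
  (Submodule.span ℝ {t})ᗮ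

/-! ### The dual Radon transform -/

/-- The inner integral of the dual Radon transform, over the `(m-2)`-sphere orthogonal to `t`. -/
def dualRadonInner {m : ℕ} (F : CVec m → Cl m) (t : RVec m) : Cl m :=
  cliffordIntegral (sphereMeasure (orthHyperplane t))
    (fun s => F (tauVec t ((s : orthHyperplane t) : RVec m)))

/-- The dual Radon transform of `τ ↦ F τ`, i.e.
`1 / (A_m A_{m-1}) ∫_{S^{m-1}} ∫_{S^{m-2}} F(t + i s) dS(s) dS(t)`. -/
def dualRadon {m : ℕ} (F : CVec m → Cl m) : Cl m :=
  ((1 / (sphereArea m * sphereArea (m - 1)) : ℝ) : ℂ) •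
    cliffordIntegral (sphereMeasure (RVec m)) (fun t => dualRadonInner F (t : RVec m))

/-- Both integrals in the dual Radon transform of `F` converge. -/
def DualRadonConverges {m : ℕ} (F : CVec m → Cl m) : Prop :=
  (∀ t : RVec m, ‖t‖ = 1 →
    CliffordIntegrable (sphereMeasure (orthHyperplane t))
      (fun s => F (tauVec t ((s : orthHyperplane t) : RVec m)))) ∧
  CliffordIntegrable (sphereMeasure (RVec m)) (fun t => dualRadonInner F (t : RVec m))

/-! ### The polarized Hua-Radon transform -/

/-- `ν_{k,s} = (-1)^k Γ(k + 2s + m/2) / (Γ(k + 2s + 1) Γ(m/2))`. -/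
def nu (m k s : ℕ) : ℝ :=
  (-1) ^ k * Real.Gamma ((k : ℝ) + 2 * s + (m : ℝ) / 2) /
    (Real.Gamma ((k : ℝ) + 2 * s + 1) * Real.Gamma ((m : ℝ) / 2))

/-- `a = ⟨z, τ⟩ ⟨w, τ†⟩`. -/
def kernelA {m : ℕ} (τ z w : CVec m) : ℂ := bil z τ * bil w (dagger τ)

/-- `b = ⟨z, τ†⟩ ⟨w, τ⟩`. -/
def kernelB {m : ℕ} (τ z w : CVec m) : ℂ := bil z (dagger τ) * bil w τ

/-- The term `ν_{k,s} a^{k+s} b^s` of the first series of the kernel, with `p = (s, k)`. -/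
def kernelTerm {m : ℕ} (τ z w : CVec m) (p : ℕ × ℕ) : ℂ :=
  (nu m p.2 p.1 : ℂ) * kernelA τ z w ^ (p.2 + p.1) * kernelB τ z w ^ p.1

/-- The kernel `L_τ(z, w)`, that is `1 / (π A_m)` times
`∑_{s,k ≥ 0} ν_{k,s} a^{k+s} b^s - (τ† τ / 4) ∑_{s ≥ 0} ν_{0,s} a^s b^s`. -/
def polarizedKernel {m : ℕ} (τ z w : CVec m) : Cl m :=
  ((1 / (Real.pi * sphereArea m) : ℝ) : ℂ) •
    (algebraMap ℂ (Cl m) (∑' p : ℕ × ℕ, kernelTerm τ z w p) -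
      ((1 / 4 : ℂ) * ∑' s : ℕ, kernelTerm τ z w (s, 0)) • (vec (dagger τ) * vec τ))

/-- The measure `dθ` on `[0, π]`. -/
def angleMeasure : Measure ℝ := volume.restrict (Set.Icc 0 Real.pi)

/-- The point `e^{iθ} ω` of `ℂ^m`. -/
def liePoint {m : ℕ} (θ : ℝ) (ω : RVec m) : CVec m :=
  Complex.exp (Complex.I * θ) • toCVec ω

/-- The integrand `L_τ(z, e^{-iθ} ω) f(e^{iθ} ω)`. -/
def polarizedIntegrand {m : ℕ} (τ : CVec m) (f : CVec m → Cl m) (z : CVec m)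
    (ω : RVec m) (θ : ℝ) : Cl m :=
  polarizedKernel τ z (liePoint (-θ) ω) * f (liePoint θ ω)

/-- The polarized Hua-Radon transform
`z ↦ ∫_{S^{m-1}} ∫_0^π L_τ(z, e^{-iθ} ω) f(e^{iθ} ω) dθ dS(ω)` of `f`. -/
def polarizedHuaRadon {m : ℕ} (τ : CVec m) (f : CVec m → Cl m) (z : CVec m) : Cl m :=
  cliffordIntegral (sphereMeasure (RVec m)) (fun ω =>
    cliffordIntegral angleMeasure (polarizedIntegrand τ f z (ω : RVec m)))

/-- The series and the integrals that define the polarized Hua-Radon transform of `f` at `z`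
converge. -/
def PolarizedHuaRadonConverges {m : ℕ} (τ : CVec m) (f : CVec m → Cl m) (z : CVec m) : Prop :=
  (∀ (ω : RVec m) (θ : ℝ), ‖ω‖ = 1 → Summable (kernelTerm τ z (liePoint (-θ) ω))) ∧
  (∀ ω : RVec m, ‖ω‖ = 1 → CliffordIntegrable angleMeasure (polarizedIntegrand τ f z ω)) ∧
  CliffordIntegrable (sphereMeasure (RVec m)) (fun ω =>
    cliffordIntegral angleMeasure (polarizedIntegrand τ f z (ω : RVec m)))

/-! ### The coefficients -/

/-- The coefficient `θ_{n,k,l}`, where `θ_{n,k,l} = 0` for `n > min(k, l)`. -/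
def theta (m n k l : ℕ) : ℝ :=
  if n ≤ min k l then
    (-1) ^ (k + l) *
      (Real.Gamma ((m : ℝ) - 1) * Real.Gamma ((m : ℝ) / 2 + k - n - 1) *
          Real.Gamma ((m : ℝ) / 2 + l - n - 1) * ((m : ℝ) - 2)) /
        (4 * (Nat.factorial (l - n) : ℝ) * Real.Gamma ((m : ℝ) / 2 + k + l - n) ^ 2 *
          Real.Gamma ((m : ℝ) + k + l - 2 * n - 2)) *
      ((Nat.factorial k : ℝ) * (Nat.factorial l : ℝ) / (Nat.factorial n : ℝ)) ^ 2 *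
      ((Nat.factorial (k + l - 2 * n) : ℝ) / (Nat.factorial (k - n) : ℝ))
  else 0

/-- The coefficient `ϑ_{j,k}`: `ϑ_{2n,k} = 2 θ_{n,k,k}` and `ϑ_{2n+1,k} = -ϑ_{2n,k}`. -/
def vartheta (m j k : ℕ) : ℝ :=
  if Even j then 2 * theta m (j / 2) k k else -(2 * theta m (j / 2) k k)

/-- The coefficient `ρ_{t,2n+1}`. -/
def rhoOdd (m t n : ℕ) : ℝ :=
  let l := t / 2
  if Even t then
    (∑ s ∈ Finset.range (l + 1), nu m (2 * l - 2 * s) s * theta m n (2 * l - s) s) -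
      1 / 4 * nu m 0 l * vartheta m (2 * n) l
  else
    ∑ s ∈ Finset.range (l + 1), nu m (2 * l + 1 - 2 * s) s * theta m n (2 * l + 1 - s) s

end HuaRadon

end

/-! The problem becomes scalar because a monogenic polynomial multiplied by the vector variable is
harmonic: with `∂` the Dirac operator, `∂² = -Δ` and `Δ(zM) = 2∂M + zΔM`. Since `z² = -⟨z,z⟩`, each
Clifford coordinate of `f` is `(-⟨z,z⟩)^n H` with `H` harmonic and homogeneous of degree `d = t -
2n`, so it suffices to treat one such `H`.

For fixed `z` in the Lie ball the products `⟨z,τ⟩` are bounded by some `r < 1`, while `ν` grows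
polynomially, so the kernel series converges uniformly for `w` on the sphere. The integral over `θ`
removes the terms whose degree in `w` differs from `t` by a nonzero even number, and the antipodal
map of the sphere removes the odd differences. What is left is a finite sum over `k + 2s = t`.

The core is `pairFun_kernelPoly`. Average `⟨z,τ⟩^k ⟨z,τ†⟩^l ⟨ω,τ†⟩^k ⟨ω,τ⟩^l H(ω)` over `ω` and over
orthonormal pairs, where `k + l = d + 2n`; the result is `θ_{n,k,l} ⟨z,z⟩^n H(z)`. Three factors
make up `θ`. As `τ` and `τ†` are null with product `-2`, Green's identity against `H` lowers both
exponents of `ω` by `n` (`sphAvgFull_null_reduce`). Rotation invariance of the pair average yields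
linear recurrences (`pairMoment_rec`) that trade the remaining factors for powers of `⟨z,ω⟩` and
`⟨z,z⟩` (`diagMoment_eq`). Finally `⟨z,ω⟩^d H(ω)` averages to a multiple of `H(z)`
(`sphAvgFull_lin_pow`).

Rotation invariance is used in infinitesimal form. The average over the sphere orthogonal to `t` of
a polynomial in `(t,s)` agrees on the unit sphere with a polynomial in `t`, compatibly with the
fields `X_i ∂_j - X_j ∂_i` (`exists_representsInner`), and these fields average to zero over the
sphere.

In the term with `τ†τ`, the change `s ↦ -s` exchanges `τ` with `-τ†`. The averaged coefficients of
`e_a e_b` are therefore symmetric, only their trace survives, and `τ†τ` acts as the scalar 2; this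
is the source of `ϑ = 2θ`. -/

noncomputable section

namespace HuaRadon

/-! ### Polar coordinates and integration by parts on spheres -/

section Sphere

open Set Metric Module

variable {F : Type*} [NormedAddCommGroup F] [InnerProductSpace ℝ F] [FiniteDimensional ℝ F]
  [MeasurableSpace F] [BorelSpace F]

theorem sphereMeasure_eq : sphereMeasure F = (volume : Measure F).toSphere := by
  rw [sphereMeasure, OrthonormalBasis.addHaar_eq_volume]

instance : IsFiniteMeasure (sphereMeasure F) := by
  rw [sphereMeasure_eq]; infer_instance

theorem integrable_sphere_of_continuous {g : sphere (0 : F) 1 → ℂ} (hg : Continuous g) :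
    Integrable g (sphereMeasure F) :=
  hg.integrable_of_hasCompactSupport (HasCompactSupport.of_compactSpace g)

/-- The homeomorphism of `F` minus the origin with sphere times half-line carries Lebesgue measure
to `toSphere` times `r ^ (dim F - 1) dr`, and the integrand is a product there. The value of `h` at
the origin is immaterial. -/
theorem integral_polar [Nontrivial F] {g : sphere (0 : F) 1 → ℂ} {φ : ℝ → ℂ} {h : F → ℂ}
    (hh : ∀ (ω : sphere (0 : F) 1) (r : ℝ), 0 < r → h (r • (ω : F)) = g ω * φ r)
    (hg : Integrable g (sphereMeasure F))
    (hφ : IntegrableOn (fun r : ℝ => (r ^ (finrank ℝ F - 1)) • φ r) (Ioi 0)) :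
    Integrable h ∧ ∫ x, h x = (∫ ω, g ω ∂(sphereMeasure F)) *
      ∫ r in Ioi (0 : ℝ), (r ^ (finrank ℝ F - 1)) • φ r := by
  rw [sphereMeasure_eq] at hg ⊢
  have hmp := (volume : Measure F).measurePreserving_homeomorphUnitSphereProd
  have hemb := (homeomorphUnitSphereProd F).measurableEmbedding
  set G : sphere (0 : F) 1 × Ioi (0 : ℝ) → ℂ := fun p => g p.1 * φ p.2 with hG
  have hcomp : ∀ x : ({0}ᶜ : Set F), G (homeomorphUnitSphereProd F x) = h x := by
    intro x
    obtain ⟨p, rfl⟩ := (homeomorphUnitSphereProd F).symm.surjective x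
    rw [Homeomorph.apply_symm_apply]
    simp only [homeomorphUnitSphereProd_symm_apply_coe, hG]
    exact (hh p.1 p.2 p.2.2).symm
  have hφ' : Integrable (fun r : Ioi (0 : ℝ) => φ r)
      (Measure.volumeIoiPow (finrank ℝ F - 1)) := by
    rw [integrableOn_iff_comap_subtypeVal (by measurability)] at hφ
    rw [Measure.volumeIoiPow, integrable_withDensity_iff_integrable_smul' (by fun_prop) (by simp)]
    refine hφ.congr (.of_forall ?_)
    rintro ⟨x, hx : 0 < x⟩
    simp (disch := positivity) [ENNReal.toReal_ofReal]
  have hGi : Integrable G ((volume : Measure F).toSphere.prod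
      (Measure.volumeIoiPow (finrank ℝ F - 1))) := hg.mul_prod hφ'
  have hint : ∫ r : Ioi (0 : ℝ), φ r ∂(Measure.volumeIoiPow (finrank ℝ F - 1)) =
      ∫ r in Ioi (0 : ℝ), (r ^ (finrank ℝ F - 1)) • φ r := by
    rw [← integral_subtype_comap measurableSet_Ioi fun r : ℝ => (r ^ (finrank ℝ F - 1)) • φ r,
      Measure.volumeIoiPow, integral_withDensity_eq_integral_toReal_smul (by fun_prop) (by simp)]
    refine integral_congr_ae (.of_forall ?_)
    rintro ⟨x, hx : 0 < x⟩
    simp (disch := positivity) [ENNReal.toReal_ofReal]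
  constructor
  · rw [← restrict_compl_singleton (μ := (volume : Measure F)) 0, ← IntegrableOn,
      integrableOn_iff_comap_subtypeVal (by measurability)]
    have := (hmp.integrable_comp_emb hemb (g := G)).2 hGi
    refine this.congr (.of_forall fun x => ?_)
    exact hcomp x
  · have h0 : ∫ x, h x = ∫ x : ({0}ᶜ : Set F), h x ∂(Measure.comap Subtype.val volume) := by
      rw [integral_subtype_comap (measurableSet_singleton _).compl fun x => h x,
        restrict_compl_singleton]
    rw [h0, ← hint, ← integral_prod_mul (μ := (volume : Measure F).toSphere) g (fun r : Ioi (0 : ℝ) => φ r),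
      ← hmp.integral_comp hemb]
    refine integral_congr_ae (.of_forall fun x => ?_)
    exact (hcomp x).symm

theorem integrableOn_pow_mul_exp_neg_sq (p : ℕ) :
    IntegrableOn (fun r : ℝ => r ^ p * Real.exp (-r ^ 2)) (Ioi 0) := by
  have := integrableOn_rpow_mul_exp_neg_mul_sq (b := 1) one_pos (s := p)
    (by have : (0 : ℝ) ≤ p := p.cast_nonneg
        linarith)
  simpa using this

theorem integral_pow_mul_exp_neg_sq (p : ℕ) :
    ∫ r in Ioi (0 : ℝ), r ^ p * Real.exp (-r ^ 2) = Real.Gamma (((p : ℝ) + 1) / 2) / 2 := by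
  have hp : (0 : ℝ) ≤ p := p.cast_nonneg
  have := integral_rpow_mul_exp_neg_mul_rpow (p := 2) (q := p) (b := 1) two_pos
    (by linarith) one_pos
  have h2 : ∀ r : ℝ, r ^ p * Real.exp (-r ^ 2) = r ^ (p : ℝ) * Real.exp (-1 * r ^ (2 : ℝ)) := by
    intro r; simp
  simp_rw [h2]
  rw [this]; simp; ring

/-- Integrate by parts against the Gaussian `exp (-‖x‖²)` on all of `F`: this gives `∫ g' e = 2 ∫
⟨v,x⟩ g e`, and polar coordinates split a Gamma integral off each side. The homogeneity of `g'` is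
written with an extra factor `r` so that degree `N = 0` is covered; `dim F ≥ 2` keeps the radial
weight integrable in that case. -/
theorem sphere_integral_by_parts (hD : 2 ≤ finrank ℝ F) (N : ℕ) (v : F) (g g' : F → ℂ)
    (hgc : Continuous g) (hgc' : Continuous g')
    (hg : ∀ (r : ℝ) (x : F), 0 < r → g (r • x) = (r : ℂ) ^ N * g x)
    (hg' : ∀ (r : ℝ) (x : F), 0 < r → (r : ℂ) * g' (r • x) = (r : ℂ) ^ N * g' x)
    (hd : ∀ x, HasLineDerivAt ℝ g (g' x) x v) :
    ((N : ℂ) + finrank ℝ F - 1) *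
      ∫ ω : sphere (0 : F) 1, ((inner ℝ v (ω : F) : ℝ) : ℂ) * g ω ∂(sphereMeasure F) =
    ∫ ω : sphere (0 : F) 1, g' ω ∂(sphereMeasure F) := by
  have : Nontrivial F := Module.nontrivial_of_finrank_pos (R := ℝ) (by omega)
  obtain ⟨D, hD'⟩ : ∃ D, finrank ℝ F = D + 2 := ⟨finrank ℝ F - 2, by omega⟩
  set e : F → ℂ := fun x => ((Real.exp (-‖x‖ ^ 2) : ℝ) : ℂ) with he
  have hes : ∀ (ω : sphere (0 : F) 1) (r : ℝ), 0 < r →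
      e (r • (ω : F)) = ((Real.exp (-r ^ 2) : ℝ) : ℂ) := by
    intro ω r hr
    have : ‖(ω : F)‖ = 1 := by simp
    simp [he, norm_smul, this, abs_of_pos hr]
  have hint : ∀ p : ℕ, IntegrableOn
      (fun r : ℝ => (((r ^ p * Real.exp (-r ^ 2) : ℝ)) : ℂ)) (Ioi 0) := fun p =>
    (integrableOn_pow_mul_exp_neg_sq p).ofReal
  have hval : ∀ p : ℕ, ∫ r in Ioi (0 : ℝ), (((r ^ p * Real.exp (-r ^ 2) : ℝ)) : ℂ) =
      ((Real.Gamma (((p : ℝ) + 1) / 2) / 2 : ℝ) : ℂ) := by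
    intro p
    rw [← integral_pow_mul_exp_neg_sq, integral_complex_ofReal]
  have hsph : Continuous fun ω : sphere (0 : F) 1 => (ω : F) := continuous_subtype_val
  -- the three polar integrals
  have h1 := integral_polar (g := fun ω : sphere (0 : F) 1 => g' ω)
    (φ := fun r => (r : ℂ) ^ N / r * ((Real.exp (-r ^ 2) : ℝ) : ℂ)) (h := fun x => g' x * e x)
    (by
      intro ω r hr
      have hr' : (r : ℂ) ≠ 0 := by exact_mod_cast hr.ne'
      have := hg' r ω hr
      rw [hes ω r hr, show g' (r • (ω : F)) = (r : ℂ) ^ N / r * g' ω by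
        field_simp; linear_combination this]
      ring)
    (integrable_sphere_of_continuous (by fun_prop))
    ((hint (N + D)).congr_fun (by
      intro r hr
      have hr' : (r : ℂ) ≠ 0 := by exact_mod_cast (ne_of_gt hr)
      simp only [hD', show D + 2 - 1 = D + 1 by omega, Complex.real_smul]
      push_cast; field_simp; ring) measurableSet_Ioi)
  have h2 := integral_polar
    (g := fun ω : sphere (0 : F) 1 => ((inner ℝ v (ω : F) : ℝ) : ℂ) * g ω)
    (φ := fun r => (r : ℂ) ^ (N + 1) * ((Real.exp (-r ^ 2) : ℝ) : ℂ))
    (h := fun x => ((inner ℝ v x : ℝ) : ℂ) * g x * e x)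
    (by
      intro ω r hr
      rw [hes ω r hr, hg r ω hr, inner_smul_right]
      push_cast; ring)
    (integrable_sphere_of_continuous (by fun_prop))
    ((hint (N + D + 2)).congr_fun (by
      intro r hr
      simp only [hD', show D + 2 - 1 = D + 1 by omega, Complex.real_smul]
      push_cast; ring) measurableSet_Ioi)
  have h3 := integral_polar (g := fun ω : sphere (0 : F) 1 => g ω)
    (φ := fun r => (r : ℂ) ^ N * ((Real.exp (-r ^ 2) : ℝ) : ℂ)) (h := fun x => g x * e x)
    (by
      intro ω r hr
      rw [hes ω r hr, hg r ω hr]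
      ring)
    (integrable_sphere_of_continuous (by fun_prop))
    ((hint (N + D + 1)).congr_fun (by
      intro r hr
      simp only [hD', show D + 2 - 1 = D + 1 by omega, Complex.real_smul]
      push_cast; ring) measurableSet_Ioi)
  have hed : ∀ x, HasLineDerivAt ℝ e (-2 * ((inner ℝ v x : ℝ) : ℂ) * e x) x v := by
    intro x
    have h0 : HasFDerivAt (fun y : F => ‖y‖ ^ 2) (2 • (innerSL ℝ x)) x :=
      (hasStrictFDerivAt_norm_sq x).hasFDerivAt
    have h4 := ((h0.neg.exp).hasLineDerivAt v)
    have h5 := HasDerivAt.ofReal_comp h4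
    unfold HasLineDerivAt
    have h6 : -2 * ((inner ℝ v x : ℝ) : ℂ) * e x =
        ((((Real.exp ((-fun y : F => ‖y‖ ^ 2) x) • -(2 • (innerSL ℝ) x)) v : ℝ)) : ℂ) := by
      rw [real_inner_comm]
      simp [he]
      ring
    rw [h6]
    exact h5
  have hparts := integral_bilinear_hasLineDerivAt_right_eq_neg_left_of_integrable
    (μ := (volume : Measure F)) (f := g) (f' := g') (g := e)
    (g' := fun x => -2 * ((inner ℝ v x : ℝ) : ℂ) * e x) (v := v) (B := ContinuousLinearMap.mul ℝ ℂ)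
    (by simpa using h1.1)
    (by
      refine (h2.1.const_mul (-2)).congr (.of_forall fun x => ?_)
      simp only [ContinuousLinearMap.mul_apply']; ring)
    (by simpa using h3.1) (fun x _ => hd x) (fun x _ => hed x)
  have e1 : ∫ x, g' x * e x = 2 * ∫ x, ((inner ℝ v x : ℝ) : ℂ) * g x * e x := by
    have hparts' : ∫ x, g' x * e x = -∫ x, g x * (-2 * ((inner ℝ v x : ℝ) : ℂ) * e x) := by
      rw [eq_neg_iff_add_eq_zero, add_comm, ← eq_neg_iff_add_eq_zero]; exact hparts
    rw [hparts', ← integral_const_mul, ← integral_neg]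
    congr 1; ext x; ring
  rw [h1.2, h2.2] at e1
  have v1 : ∫ r in Ioi (0 : ℝ), (r ^ (finrank ℝ F - 1)) •
      ((r : ℂ) ^ N / r * ((Real.exp (-r ^ 2) : ℝ) : ℂ)) =
      ((Real.Gamma ((((N + D : ℕ) : ℝ) + 1) / 2) / 2 : ℝ) : ℂ) := by
    rw [← hval]
    refine setIntegral_congr_fun measurableSet_Ioi fun r hr => ?_
    have hr' : (r : ℂ) ≠ 0 := by exact_mod_cast (ne_of_gt hr)
    simp only [hD', show D + 2 - 1 = D + 1 by omega, Complex.real_smul]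
    push_cast; field_simp; ring
  have v2 : ∫ r in Ioi (0 : ℝ), (r ^ (finrank ℝ F - 1)) •
      ((r : ℂ) ^ (N + 1) * ((Real.exp (-r ^ 2) : ℝ) : ℂ)) =
      ((Real.Gamma ((((N + D + 2 : ℕ) : ℝ) + 1) / 2) / 2 : ℝ) : ℂ) := by
    rw [← hval]
    refine setIntegral_congr_fun measurableSet_Ioi fun r hr => ?_
    simp only [hD', show D + 2 - 1 = D + 1 by omega, Complex.real_smul]
    push_cast; ring
  rw [v1, v2] at e1
  set I : ℝ := Real.Gamma ((((N + D : ℕ) : ℝ) + 1) / 2) with hI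
  have hpos : (0 : ℝ) < (((N + D : ℕ) : ℝ) + 1) / 2 := by positivity
  have hIpos : 0 < I := Real.Gamma_pos_of_pos hpos
  -- The two radial integrals carry Gamma values at arguments differing by one; their ratio is half
  -- of `N + dim F - 1`.
  have hrec : Real.Gamma ((((N + D + 2 : ℕ) : ℝ) + 1) / 2) = (((N + D : ℕ) : ℝ) + 1) / 2 * I := by
    rw [hI, ← Real.Gamma_add_one hpos.ne']
    congr 1; push_cast; ring
  rw [hrec] at e1
  have hIc : ((I : ℝ) : ℂ) ≠ 0 := by exact_mod_cast hIpos.ne'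
  have e2 : ((I : ℝ) : ℂ) * (((N : ℂ) + finrank ℝ F - 1) *
      ∫ ω : sphere (0 : F) 1, ((inner ℝ v (ω : F) : ℝ) : ℂ) * g ω ∂(sphereMeasure F)) =
      (I : ℂ) * ∫ ω : sphere (0 : F) 1, g' ω ∂(sphereMeasure F) := by
    rw [hD']
    push_cast at e1 ⊢
    linear_combination -2 * e1
  exact mul_left_cancel₀ hIc e2

theorem sphereMeasure_real_univ (hD : 1 ≤ finrank ℝ F) :
    (sphereMeasure F).real univ = sphereArea (finrank ℝ F) := by
  have : Nontrivial F := Module.nontrivial_of_finrank_pos (R := ℝ) (by omega)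
  rw [sphereMeasure_eq, Measure.toSphere_real_apply_univ, measureReal_def,
    InnerProductSpace.volume_ball, sphereArea]
  have hpos : (0 : ℝ) < (finrank ℝ F : ℝ) / 2 := by
    have : (0 : ℝ) < finrank ℝ F := by exact_mod_cast hD
    positivity
  rw [Real.Gamma_add_one hpos.ne']
  have hG := Real.Gamma_pos_of_pos hpos
  have hsq : √Real.pi ^ finrank ℝ F = Real.pi ^ ((finrank ℝ F : ℝ) / 2) := by
    rw [Real.sqrt_eq_rpow, ← Real.rpow_natCast, ← Real.rpow_mul Real.pi_pos.le]
    congr 1; ring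
  rw [hsq]
  simp only [ENNReal.ofReal_one, one_pow, one_mul]
  rw [ENNReal.toReal_ofReal (by positivity)]
  field_simp

/-- The function `g (x / ‖x‖) exp (-‖x‖²)` is odd on `F`, so its Lebesgue integral vanishes, while
its radial factor is a positive Gamma value. -/
theorem integral_sphere_odd_eq_zero {g : sphere (0 : F) 1 → ℂ}
    (hg : ∀ ω, g (-ω) = -g ω) : ∫ ω, g ω ∂(sphereMeasure F) = 0 := by
  classical
  by_cases hi : Integrable g (sphereMeasure F)
  swap
  · exact integral_undef hi
  rcases subsingleton_or_nontrivial F with hs | hs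
  · have : IsEmpty (sphere (0 : F) 1) :=
      ⟨fun ω => by have h := norm_eq_of_mem_sphere ω; simp [Subsingleton.elim (ω : F) 0] at h⟩
    exact integral_of_isEmpty
  set h : F → ℂ := fun x => if hx : ‖‖x‖⁻¹ • x‖ = 1 then
    g ⟨‖x‖⁻¹ • x, by simpa using hx⟩ * ((Real.exp (-‖x‖ ^ 2) : ℝ) : ℂ) else 0 with hh
  have hpol := integral_polar (g := g) (φ := fun r => ((Real.exp (-r ^ 2) : ℝ) : ℂ)) (h := h)
    (by
      intro ω r hr
      have hω : ‖(ω : F)‖ = 1 := by simp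
      have h1 : ‖r • (ω : F)‖ = r := by rw [norm_smul, hω, Real.norm_eq_abs, abs_of_pos hr, mul_one]
      have h2 : ‖r • (ω : F)‖⁻¹ • r • (ω : F) = ω := by
        rw [h1, smul_smul, inv_mul_cancel₀ hr.ne', one_smul]
      simp only [hh]
      have h4 : ‖‖r • (ω : F)‖⁻¹ • r • (ω : F)‖ = 1 := by rw [h2, hω]
      have h5 : (⟨_, by simpa using h4⟩ : sphere (0 : F) 1) = ω := Subtype.ext h2
      rw [dif_pos h4, h5, h1]) hi
    (IntegrableOn.congr_fun
      (f := fun r : ℝ => ((r ^ (finrank ℝ F - 1) * Real.exp (-r ^ 2) : ℝ) : ℂ))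
      (integrableOn_pow_mul_exp_neg_sq (finrank ℝ F - 1)).ofReal (by
      intro r hr
      simp [Complex.real_smul]) measurableSet_Ioi)
  have hodd : ∫ x, h x = 0 := by
    have h1 : ∀ x, h (-x) = -h x := by
      intro x
      simp only [hh, norm_neg, smul_neg]
      split_ifs with hx
      · rw [← neg_mul, ← hg]; rfl
      · simp
    have h2 := integral_neg_eq_self h (volume : Measure F)
    simp_rw [h1, integral_neg] at h2
    linear_combination (-1 / 2 : ℂ) * h2
  rw [hodd] at hpol
  have h0 := hpol.2.symm
  rcases mul_eq_zero.1 h0 with h3 | h3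
  · exact h3
  · exfalso
    have h4 : ∫ r in Ioi (0 : ℝ), (r ^ (finrank ℝ F - 1)) • ((Real.exp (-r ^ 2) : ℝ) : ℂ) =
      ((Real.Gamma ((((finrank ℝ F - 1 : ℕ) : ℝ) + 1) / 2) / 2 : ℝ) : ℂ) := by
      rw [← integral_pow_mul_exp_neg_sq, ← integral_complex_ofReal]
      simp [Complex.real_smul]
    rw [h4] at h3
    have : 0 < Real.Gamma ((((finrank ℝ F - 1 : ℕ) : ℝ) + 1) / 2) :=
      Real.Gamma_pos_of_pos (by positivity)
    have h5 := Complex.ofReal_eq_zero.1 h3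
    linarith

end Sphere

/-! ### Evaluation and differentiation of polynomials -/

open MvPolynomial in
theorem hasDerivAt_eval_mvPolynomial {σ : Type*} [Fintype σ] (p : MvPolynomial σ ℂ)
    (c : ℝ → σ → ℂ) (c' : σ → ℂ) (r : ℝ) (hc : ∀ j, HasDerivAt (fun x => c x j) (c' j) r) :
    HasDerivAt (fun x => eval (c x) p) (∑ j, c' j * eval (c r) (pderiv j p)) r := by
  classical
  induction p using MvPolynomial.induction_on with
  | C a => simpa using hasDerivAt_const r a
  | add p q hp hq =>
    have e : ∑ j, c' j * eval (c r) (pderiv j (p + q)) = ∑ j, c' j * eval (c r) (pderiv j p) +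
        ∑ j, c' j * eval (c r) (pderiv j q) := by
      rw [← Finset.sum_add_distrib]
      exact Finset.sum_congr rfl fun j _ => by rw [map_add, map_add, mul_add]
    rw [e]
    have e2 : (fun x => eval (c x) (p + q)) = fun x => eval (c x) p + eval (c x) q := by
      funext x; rw [map_add]
    rw [e2]
    exact hp.add hq
  | mul_X p i hp =>
    have e2 : (fun x => eval (c x) (p * X i)) = fun x => eval (c x) p * c x i := by
      funext x; rw [map_mul, eval_X]
    rw [e2]
    have e3 : ∑ j, c' j * eval (c r) (pderiv j (p * X i)) =
        (∑ j, c' j * eval (c r) (pderiv j p)) * c r i + eval (c r) p * c' i := by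
      rw [Finset.sum_mul, ← Fintype.sum_ite_eq i fun j => eval (c r) p * c' j,
        ← Finset.sum_add_distrib]
      refine Finset.sum_congr rfl fun j _ => ?_
      rw [pderiv_mul, pderiv_X, map_add, map_mul, map_mul, eval_X]
      by_cases h : i = j
      · subst h; simp; ring
      · simp [h]; ring
    rw [e3]
    exact hp.mul (hc i)

theorem continuous_eval_mvPolynomial {σ X : Type*} [TopologicalSpace X]
    (p : MvPolynomial σ ℂ) (c : X → σ → ℂ) (hc : ∀ j, Continuous fun x => c x j) :
    Continuous fun x => MvPolynomial.eval (c x) p := by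
  induction p using MvPolynomial.induction_on with
  | C a => simpa using continuous_const
  | add p q hp hq => simp only [map_add]; exact hp.add hq
  | mul_X p i hp => simp only [map_mul, MvPolynomial.eval_X]; exact hp.mul (hc i)

open MvPolynomial in
theorem eval_smul_of_isHomogeneous {σ : Type*} [Fintype σ] {p : MvPolynomial σ ℂ} {N : ℕ}
    (hp : p.IsHomogeneous N) (r : ℂ) (x : σ → ℂ) : eval (r • x) p = r ^ N * eval x p := by
  rw [eval_eq', eval_eq', Finset.mul_sum]
  refine Finset.sum_congr rfl fun d hd => ?_
  have hN : N = ∑ i, d i := by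
    rw [hp.degree_eq_sum_deg_support hd]
    exact Finset.sum_subset (Finset.subset_univ _) (by simp)
  simp only [Pi.smul_apply, smul_eq_mul, mul_pow, Finset.prod_mul_distrib, Finset.prod_pow_eq_pow_sum]
  rw [← hN]; ring

theorem pderiv_comm {σ R : Type*} [CommRing R] (i j : σ) (p : MvPolynomial σ R) :
    MvPolynomial.pderiv i (MvPolynomial.pderiv j p) =
      MvPolynomial.pderiv j (MvPolynomial.pderiv i p) := by
  classical
  have h : ⁅(MvPolynomial.pderiv i : Derivation R (MvPolynomial σ R) (MvPolynomial σ R)),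
      (MvPolynomial.pderiv j : Derivation R (MvPolynomial σ R) (MvPolynomial σ R))⁆ = 0 := by
    apply MvPolynomial.derivation_ext
    intro k
    rw [Derivation.commutator_apply]
    simp [MvPolynomial.pderiv_X, Pi.single_apply, apply_ite]
  have := congrArg (fun D => D p) h
  simpa [Derivation.commutator_apply, sub_eq_zero] using this

theorem continuous_toCVec {m : ℕ} : Continuous (toCVec : RVec m → CVec m) := by
  unfold toCVec; fun_prop

theorem continuous_eval_sphere {m : ℕ} {F : Type*} [NormedAddCommGroup F]
    [InnerProductSpace ℝ F] (φ : F →ₗᵢ[ℝ] RVec m) (p : MvPolynomial (Fin m) ℂ) :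
    Continuous fun ω : Metric.sphere (0 : F) 1 => MvPolynomial.eval (toCVec (φ ω)) p := by
  refine continuous_eval_mvPolynomial p _ fun j => ?_
  exact (continuous_apply j).comp
    (continuous_toCVec.comp (φ.continuous.comp continuous_subtype_val))

/-! ### Averages of polynomials over spheres of subspaces -/

section SphAvg

open Metric Module

variable {m : ℕ} {F : Type*} [NormedAddCommGroup F] [InnerProductSpace ℝ F] [FiniteDimensional ℝ F]
  [MeasurableSpace F] [BorelSpace F]

theorem integrable_eval_sphere (φ : F →ₗᵢ[ℝ] RVec m) (p : MvPolynomial (Fin m) ℂ) :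
    Integrable (fun ω : sphere (0 : F) 1 => MvPolynomial.eval (toCVec (φ ω)) p)
      (sphereMeasure F) :=
  integrable_sphere_of_continuous (continuous_eval_sphere φ p)

/-- The average of a polynomial over the unit sphere of a subspace of `ℝ^m`. -/
def sphAvg (φ : F →ₗᵢ[ℝ] RVec m) : MvPolynomial (Fin m) ℂ →ₗ[ℂ] ℂ where
  toFun p := ((sphereArea (finrank ℝ F) : ℝ) : ℂ)⁻¹ *
    ∫ ω : sphere (0 : F) 1, MvPolynomial.eval (toCVec (φ ω)) p ∂(sphereMeasure F)
  map_add' p q := by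
    simp only [map_add]
    rw [integral_add (integrable_eval_sphere φ p) (integrable_eval_sphere φ q), mul_add]
  map_smul' c p := by
    simp only [MvPolynomial.smul_eval, RingHom.id_apply, smul_eq_mul]
    rw [integral_const_mul]; ring

theorem sphAvg_apply (φ : F →ₗᵢ[ℝ] RVec m) (p : MvPolynomial (Fin m) ℂ) :
    sphAvg φ p = ((sphereArea (finrank ℝ F) : ℝ) : ℂ)⁻¹ *
      ∫ ω : sphere (0 : F) 1, MvPolynomial.eval (toCVec (φ ω)) p ∂(sphereMeasure F) := rfl

theorem sphereArea_pos {n : ℕ} (hn : 1 ≤ n) : 0 < sphereArea n := by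
  have : (0 : ℝ) < n := by exact_mod_cast hn
  unfold sphereArea
  have := Real.Gamma_pos_of_pos (show (0 : ℝ) < (n : ℝ) / 2 by positivity)
  have := Real.pi_pos
  positivity

theorem sphAvg_congr (φ : F →ₗᵢ[ℝ] RVec m) {p q : MvPolynomial (Fin m) ℂ}
    (h : ∀ ω : F, ‖ω‖ = 1 → MvPolynomial.eval (toCVec (φ ω)) p =
      MvPolynomial.eval (toCVec (φ ω)) q) : sphAvg φ p = sphAvg φ q := by
  rw [sphAvg_apply, sphAvg_apply]
  congr 1
  exact integral_congr_ae (.of_forall fun ω => h ω (by simp))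

theorem sphAvg_C (hF : 1 ≤ finrank ℝ F) (φ : F →ₗᵢ[ℝ] RVec m) (c : ℂ) :
    sphAvg φ (MvPolynomial.C c) = c := by
  rw [sphAvg_apply]
  simp only [MvPolynomial.eval_C, integral_const, sphereMeasure_real_univ hF, Complex.real_smul]
  have h := (sphereArea_pos hF).ne'
  have h' : ((sphereArea (finrank ℝ F) : ℝ) : ℂ) ≠ 0 := by exact_mod_cast h
  field_simp

/-- The linear form `∑ v_j X_j`. -/
def lin {m : ℕ} {R : Type*} [CommRing R] (v : Fin m → R) : MvPolynomial (Fin m) R :=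
  ∑ j, MvPolynomial.C (v j) * MvPolynomial.X j

/-- The directional derivative `∑ v_j ∂_j`. -/
def dlin {m : ℕ} {R : Type*} [CommRing R] (v : Fin m → R) :
    Derivation R (MvPolynomial (Fin m) R) (MvPolynomial (Fin m) R) :=
  ∑ j, v j • MvPolynomial.pderiv j

theorem dlin_apply {R : Type*} [CommRing R] (v : Fin m → R) (p : MvPolynomial (Fin m) R) :
    dlin v p = ∑ j, v j • MvPolynomial.pderiv j p := by
  rw [dlin, ← Derivation.coeFnAddMonoidHom_apply, map_sum, Finset.sum_apply]
  rfl

theorem eval_lin {R : Type*} [CommRing R] (v x : Fin m → R) :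
    MvPolynomial.eval x (lin v) = ∑ j, v j * x j := by
  simp [lin]

theorem isHomogeneous_lin {R : Type*} [CommRing R] (v : Fin m → R) :
    (lin v).IsHomogeneous 1 :=
  MvPolynomial.IsHomogeneous.sum _ _ _ fun _ _ => MvPolynomial.isHomogeneous_C_mul_X _ _

theorem sum_toCVec_mul (u w : RVec m) :
    ∑ j, toCVec u j * toCVec w j = ((inner ℝ u w : ℝ) : ℂ) := by
  simp [toCVec, PiLp.inner_apply, mul_comm]

/-- An arbitrary isometric embedding `φ` is allowed so that the same identity serves both `ℝ^m` and
the hyperplanes orthogonal to `t`. -/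
theorem sphAvg_lin_mul (hF : 2 ≤ finrank ℝ F) (φ : F →ₗᵢ[ℝ] RVec m) {N : ℕ}
    {p : MvPolynomial (Fin m) ℂ} (hp : p.IsHomogeneous N) (v : F) :
    ((N : ℂ) + finrank ℝ F - 1) * sphAvg φ (lin (toCVec (φ v)) * p) =
      sphAvg φ (dlin (toCVec (φ v)) p) := by
  have hsm : ∀ (r : ℝ) (x : F), toCVec (φ (r • x)) = (r : ℂ) • toCVec (φ x) := by
    intro r x; ext j; simp [toCVec]
  have hcont : ∀ q : MvPolynomial (Fin m) ℂ,
      Continuous fun x : F => MvPolynomial.eval (toCVec (φ x)) q := fun q =>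
    continuous_eval_mvPolynomial q _ fun j =>
      (continuous_apply j).comp (continuous_toCVec.comp φ.continuous)
  have key := sphere_integral_by_parts hF N v (fun x => MvPolynomial.eval (toCVec (φ x)) p)
    (fun x => MvPolynomial.eval (toCVec (φ x)) (dlin (toCVec (φ v)) p)) (hcont _) (hcont _)
    (by
      intro r x _
      rw [hsm, eval_smul_of_isHomogeneous hp])
    (by
      intro r x _
      -- A constant has zero derivative; in positive degree the derivative is homogeneous of degree
      -- one less.
      rcases N with _ | N
      · obtain ⟨c, rfl⟩ : ∃ c, p = MvPolynomial.C c := by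
          rw [← MvPolynomial.totalDegree_zero_iff_isHomogeneous,
            MvPolynomial.totalDegree_eq_zero_iff_eq_C] at hp
          exact ⟨_, hp⟩
        simp
      · have : (dlin (toCVec (φ v)) p).IsHomogeneous N := by
          rw [dlin_apply]
          refine MvPolynomial.IsHomogeneous.sum _ _ _ fun j _ => ?_
          rw [MvPolynomial.smul_eq_C_mul]
          exact (hp.pderiv).C_mul _
        rw [hsm, eval_smul_of_isHomogeneous this]; ring)
    (by
      intro x
      have := hasDerivAt_eval_mvPolynomial p (fun r : ℝ => toCVec (φ (x + r • v)))
        (toCVec (φ v)) 0 (by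
          intro j
          have h1 : ∀ r : ℝ, toCVec (φ (x + r • v)) j = toCVec (φ x) j + r * toCVec (φ v) j := by
            intro r; simp [toCVec]
          simp_rw [h1]
          have := ((hasDerivAt_id (0 : ℝ)).ofReal_comp.mul_const (toCVec (φ v) j)).const_add
            (toCVec (φ x) j)
          simpa using this)
      unfold HasLineDerivAt
      simpa [dlin_apply] using this)
  have h1 : ∀ ω : F, MvPolynomial.eval (toCVec (φ ω)) (lin (toCVec (φ v)) * p) =
      ((inner ℝ v ω : ℝ) : ℂ) * MvPolynomial.eval (toCVec (φ ω)) p := by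
    intro ω
    rw [map_mul, eval_lin, sum_toCVec_mul, φ.inner_map_map]
  rw [sphAvg_apply, sphAvg_apply]
  simp_rw [h1]
  rw [← key]; ring

theorem sphAvg_eq_zero_of_odd (φ : F →ₗᵢ[ℝ] RVec m) {N : ℕ} (hN : Odd N)
    {p : MvPolynomial (Fin m) ℂ} (hp : p.IsHomogeneous N) : sphAvg φ p = 0 := by
  rw [sphAvg_apply, integral_sphere_odd_eq_zero, mul_zero]
  intro ω
  have : toCVec (φ ((-ω : sphere (0 : F) 1) : F)) = (-1 : ℂ) • toCVec (φ ω) := by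
    ext j; simp [toCVec]
  rw [this, eval_smul_of_isHomogeneous hp, hN.neg_one_pow]; ring

end SphAvg

/-! ### Green's identities and rotation fields on the sphere of `ℝ^m` -/

section Rotation

variable {R σ : Type*} [CommRing R]

/-- The Laplace operator. -/
def lap {m : ℕ} (p : MvPolynomial (Fin m) ℂ) : MvPolynomial (Fin m) ℂ :=
  ∑ i, MvPolynomial.pderiv i (MvPolynomial.pderiv i p)

/-- The average over the unit sphere of `ℝ^m`. -/
abbrev sphAvgFull (m : ℕ) : MvPolynomial (Fin m) ℂ →ₗ[ℂ] ℂ :=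
  sphAvg (LinearIsometry.id : RVec m →ₗᵢ[ℝ] RVec m)

variable {m : ℕ}

theorem sphAvgFull_X_mul (hm : 3 ≤ m) {N : ℕ} {p : MvPolynomial (Fin m) ℂ}
    (hp : p.IsHomogeneous N) (i : Fin m) :
    ((N : ℂ) + m - 1) * sphAvgFull m (MvPolynomial.X i * p) =
      sphAvgFull m (MvPolynomial.pderiv i p) := by
  classical
  have h := sphAvg_lin_mul (F := RVec m) (by simp; omega) LinearIsometry.id hp
    (EuclideanSpace.single i 1)
  have e : toCVec (EuclideanSpace.single i (1 : ℝ)) = Pi.single i (1 : ℂ) := by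
    ext j; simp only [toCVec, PiLp.single_apply, Pi.single_apply]; split_ifs <;> simp
  have e1 : lin (Pi.single i (1 : ℂ)) = MvPolynomial.X i := by
    simp [lin, Pi.single_apply, apply_ite]
  have e2 : dlin (Pi.single i (1 : ℂ)) p = MvPolynomial.pderiv i p := by
    simp [dlin_apply, Pi.single_apply]
  simpa [e, e1, e2] using h

theorem isHomogeneous_lap {N : ℕ} {p : MvPolynomial (Fin m) ℂ} (hp : p.IsHomogeneous N) :
    (lap p).IsHomogeneous (N - 2) :=
  MvPolynomial.IsHomogeneous.sum _ _ _ fun i _ => by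
    have := (hp.pderiv (i := i)).pderiv (i := i)
    rwa [Nat.sub_sub] at this

theorem eq_C_of_isHomogeneous_zero {p : MvPolynomial σ R} (hp : p.IsHomogeneous 0) :
    ∃ c, p = MvPolynomial.C c := by
  rw [← MvPolynomial.totalDegree_zero_iff_isHomogeneous,
    MvPolynomial.totalDegree_eq_zero_iff_eq_C] at hp
  exact ⟨_, hp⟩

theorem sphAvgFull_euler (hm : 3 ≤ m) {N : ℕ} (q : Fin m → MvPolynomial (Fin m) ℂ)
    (hq : ∀ i, (q i).IsHomogeneous N) :
    ((N : ℂ) + m - 1) * sphAvgFull m (∑ i, MvPolynomial.X i * q i) =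
      sphAvgFull m (∑ i, MvPolynomial.pderiv i (q i)) := by
  rw [map_sum, map_sum, Finset.mul_sum]
  exact Finset.sum_congr rfl fun i _ => sphAvgFull_X_mul hm (hq i) i

/-- The divergence identity `sphAvgFull_euler` is applied to the gradient of `p`, together with
Euler's relation `∑ X_i ∂_i p = N p`. -/
theorem sphAvgFull_lap (hm : 3 ≤ m) {N : ℕ} {p : MvPolynomial (Fin m) ℂ}
    (hp : p.IsHomogeneous N) :
    sphAvgFull m (lap p) = (N : ℂ) * (m + N - 2) * sphAvgFull m p := by
  rcases N with _ | N
  · obtain ⟨c, rfl⟩ := eq_C_of_isHomogeneous_zero hp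
    simp [lap]
  · have h := sphAvgFull_euler hm (fun i => MvPolynomial.pderiv i p) (N := N)
      (fun i => hp.pderiv)
    rw [hp.sum_X_mul_pderiv] at h
    rw [lap, ← h, map_nsmul]
    push_cast
    simp only [nsmul_eq_mul]
    push_cast
    ring

/-- Green's identity: `Δ(qH) = Δq H + 2 ∇q·∇H`, and the average of `∇q·∇H = div (q ∇H)` is `d (m + N
+ d - 2)` times that of `qH`. Subtracting it twice from `(N + d)(m + N + d - 2)` leaves the factor
`N - d`. -/
theorem sphAvgFull_mul_harmonic (hm : 3 ≤ m) {N d : ℕ} {q H : MvPolynomial (Fin m) ℂ}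
    (hq : q.IsHomogeneous N) (hH : H.IsHomogeneous d) (hL : lap H = 0) :
    ((m : ℂ) + N + d - 2) * ((N : ℂ) - d) * sphAvgFull m (q * H) =
      sphAvgFull m (lap q * H) := by
  have h1 := sphAvgFull_lap hm (hq.mul hH)
  have h2 : lap (q * H) = lap q * H +
      2 • ∑ i, MvPolynomial.pderiv i q * MvPolynomial.pderiv i H := by
    have : lap (q * H) = lap q * H + q * lap H +
        2 • ∑ i, MvPolynomial.pderiv i q * MvPolynomial.pderiv i H := by
      simp only [lap, Finset.sum_mul, Finset.mul_sum, Finset.smul_sum, ← Finset.sum_add_distrib]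
      refine Finset.sum_congr rfl fun i _ => ?_
      simp only [MvPolynomial.pderiv_mul, map_add]
      ring
    rw [this, hL, mul_zero, add_zero]
  have h3 : (d : ℂ) * (m + N + d - 2) * sphAvgFull m (q * H) =
      sphAvgFull m (∑ i, MvPolynomial.pderiv i q * MvPolynomial.pderiv i H) := by
    rcases d with _ | d
    · obtain ⟨c, rfl⟩ := eq_C_of_isHomogeneous_zero hH
      simp
    · have h := sphAvgFull_euler hm (fun i => q * MvPolynomial.pderiv i H) (N := N + d)
        (fun i => hq.mul hH.pderiv)
      have e1 : ∑ i, MvPolynomial.X i * (q * MvPolynomial.pderiv i H) = (d + 1) • (q * H) := by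
        rw [← mul_smul_comm, ← hH.sum_X_mul_pderiv, Finset.mul_sum]
        exact Finset.sum_congr rfl fun i _ => by ring
      have e2 : ∑ i, MvPolynomial.pderiv i (q * MvPolynomial.pderiv i H) =
          ∑ i, MvPolynomial.pderiv i q * MvPolynomial.pderiv i H + q * lap H := by
        simp only [lap, Finset.mul_sum, ← Finset.sum_add_distrib]
        refine Finset.sum_congr rfl fun i _ => ?_
        rw [MvPolynomial.pderiv_mul]
      rw [e1, e2, hL, mul_zero, add_zero, map_nsmul] at h
      rw [← h]
      push_cast
      simp only [nsmul_eq_mul]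
      push_cast
      ring
  rw [h2, map_add, map_nsmul, ← h3] at h1
  push_cast at h1
  simp only [nsmul_eq_mul] at h1
  push_cast at h1
  linear_combination -h1

/-- Orthogonality of `H` to lower degrees. Applying the previous identity lowers the degree of `q`
by two until `Δq = 0`; the factor `N - d` never vanishes on the way. -/
theorem sphAvgFull_mul_harmonic_eq_zero (hm : 3 ≤ m) {N d : ℕ} {q H : MvPolynomial (Fin m) ℂ}
    (hq : q.IsHomogeneous N) (hH : H.IsHomogeneous d) (hL : lap H = 0) (hN : N < d) :
    sphAvgFull m (q * H) = 0 := by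
  induction N using Nat.strong_induction_on generalizing q with
  | _ N ih =>
    have h := sphAvgFull_mul_harmonic hm hq hH hL
    have hz : sphAvgFull m (lap q * H) = 0 := by
      rcases N with _ | _ | N
      · obtain ⟨c, rfl⟩ := eq_C_of_isHomogeneous_zero hq
        simp [lap]
      · have : lap q = 0 := by
          refine Finset.sum_eq_zero fun i _ => ?_
          obtain ⟨c, hc⟩ := eq_C_of_isHomogeneous_zero (hq.pderiv (i := i))
          rw [hc]; simp
        simp [this]
      · exact ih N (by omega) (isHomogeneous_lap hq) (by omega)
    rw [hz] at h
    have h1 : ((m : ℂ) + N + d - 2) ≠ 0 := by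
      have : ((m : ℂ) + N + d - 2) = ((m - 2 + N + d : ℕ) : ℂ) := by
        push_cast [Nat.cast_sub (show 2 ≤ m by omega)]; ring
      rw [this]; exact_mod_cast (by omega)
    have h2 : ((N : ℂ) - d) ≠ 0 := by
      rw [sub_ne_zero]; exact_mod_cast hN.ne
    exact (mul_eq_zero.1 h).resolve_left (mul_ne_zero h1 h2)

/-- The rotation field `X_i ∂_j - X_j ∂_i`. -/
def rotField (i j : Fin m) : Derivation ℂ (MvPolynomial (Fin m) ℂ) (MvPolynomial (Fin m) ℂ) :=
  (MvPolynomial.X i : MvPolynomial (Fin m) ℂ) • MvPolynomial.pderiv j -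
    (MvPolynomial.X j : MvPolynomial (Fin m) ℂ) • MvPolynomial.pderiv i

theorem rotField_apply (i j : Fin m) (p : MvPolynomial (Fin m) ℂ) :
    rotField i j p = MvPolynomial.X i * MvPolynomial.pderiv j p -
      MvPolynomial.X j * MvPolynomial.pderiv i p := rfl

theorem isHomogeneous_rotField (i j : Fin m) {N : ℕ} {p : MvPolynomial (Fin m) ℂ}
    (hp : p.IsHomogeneous N) : (rotField i j p).IsHomogeneous N := by
  rcases N with _ | N
  · obtain ⟨c, rfl⟩ := eq_C_of_isHomogeneous_zero hp
    simpa using MvPolynomial.isHomogeneous_zero _ _ 0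
  · rw [rotField_apply]
    have h := fun a b : Fin m => (MvPolynomial.isHomogeneous_X ℂ a).mul (hp.pderiv (i := b))
    have e : 1 + (N + 1 - 1) = N + 1 := by omega
    rw [e] at h
    exact (h i j).sub (h j i)

/-- By `sphAvgFull_X_mul`, both halves of the field average to the same multiple of the average of
`∂_i ∂_j p`. -/
theorem sphAvgFull_rotField (hm : 3 ≤ m) (i j : Fin m) (p : MvPolynomial (Fin m) ℂ) :
    sphAvgFull m (rotField i j p) = 0 := by
  induction p using MvPolynomial.induction_on' with
  | add p q hp hq => rw [map_add, map_add, hp, hq, add_zero]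
  | monomial n c =>
    have hp := MvPolynomial.isHomogeneous_monomial (n := n.degree) c rfl
    generalize MvPolynomial.monomial n c = p at hp
    rcases hN : n.degree with _ | N
    · rw [hN] at hp
      obtain ⟨c, rfl⟩ := eq_C_of_isHomogeneous_zero hp
      simp
    · rw [hN] at hp
      have h1 := sphAvgFull_X_mul hm (hp.pderiv (i := j)) i
      have h2 := sphAvgFull_X_mul hm (hp.pderiv (i := i)) j
      rw [pderiv_comm j i, ← h1] at h2
      rw [rotField_apply, map_sub, sub_eq_zero]
      have h0 : (((N + 1 - 1 : ℕ) : ℂ) + m - 1) ≠ 0 := by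
        have : (((N + 1 - 1 : ℕ) : ℂ) + m - 1) = ((N + (m - 1) : ℕ) : ℂ) := by
          push_cast [Nat.cast_sub (show 1 ≤ m by omega)]; ring
        rw [this]; exact_mod_cast (by omega)
      exact (mul_left_cancel₀ h0 h2).symm

end Rotation

/-! ### The average over the sphere orthogonal to `t` as a polynomial in `t` -/

section PerpAvg

open Module

variable {m : ℕ}

theorem finrank_orthHyperplane {t : RVec m} (ht : ‖t‖ = 1) :
    finrank ℝ (orthHyperplane t) = m - 1 := by
  have h := (Submodule.span ℝ {t}).finrank_add_finrank_orthogonal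
  have h0 : t ≠ 0 := by rintro rfl; simp at ht
  rw [finrank_span_singleton h0, finrank_euclideanSpace_fin] at h
  change finrank ℝ ↥(Submodule.span ℝ {t})ᗮ = m - 1
  omega

/-- The average over the unit sphere of the hyperplane orthogonal to `t`. -/
abbrev perpAvg (t : RVec m) : MvPolynomial (Fin m) ℂ →ₗ[ℂ] ℂ :=
  sphAvg (orthHyperplane t).subtypeₗᵢ

theorem pderiv_rotField (a i j : Fin m) (p : MvPolynomial (Fin m) ℂ) :
    MvPolynomial.pderiv a (rotField i j p) = rotField i j (MvPolynomial.pderiv a p) +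
      ((if i = a then MvPolynomial.pderiv j p else 0) -
        (if j = a then MvPolynomial.pderiv i p else 0)) := by
  simp only [rotField_apply, map_sub, MvPolynomial.pderiv_mul, MvPolynomial.pderiv_X]
  rw [pderiv_comm a j, pderiv_comm a i]
  by_cases h1 : i = a <;> by_cases h2 : j = a <;> simp [h1, h2] <;> ring

theorem lap_rotField (i j : Fin m) (p : MvPolynomial (Fin m) ℂ) :
    lap (rotField i j p) = rotField i j (lap p) := by
  have h : ∀ a, MvPolynomial.pderiv a (MvPolynomial.pderiv a (rotField i j p)) =
      rotField i j (MvPolynomial.pderiv a (MvPolynomial.pderiv a p)) +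
      2 • ((if i = a then MvPolynomial.pderiv j (MvPolynomial.pderiv a p) else 0) -
        (if j = a then MvPolynomial.pderiv i (MvPolynomial.pderiv a p) else 0)) := by
    intro a
    rw [pderiv_rotField, map_add, pderiv_rotField, map_sub, apply_ite (MvPolynomial.pderiv a),
      apply_ite (MvPolynomial.pderiv a), map_zero, pderiv_comm a j, pderiv_comm a i]
    ring
  simp only [lap, map_sum]
  rw [Finset.sum_congr rfl fun a _ => h a, Finset.sum_add_distrib, ← Finset.smul_sum,
    Finset.sum_sub_distrib]
  simp only [Finset.sum_ite_eq, Finset.mem_univ, if_true]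
  rw [pderiv_comm j i]
  simp

/-- On the hyperplane, `X_a` is the product with the projection `e_a - t_a t`; this is integration
by parts in dimension `m - 1` along that vector. -/
theorem perpAvg_X_mul (hm : 3 ≤ m) {t : RVec m} (ht : ‖t‖ = 1) {N : ℕ}
    {p : MvPolynomial (Fin m) ℂ} (hp : p.IsHomogeneous N) (a : Fin m) :
    ((N : ℂ) + m - 2) * perpAvg t (MvPolynomial.X a * p) =
      perpAvg t (MvPolynomial.pderiv a p) -
        toCVec t a * ∑ b, toCVec t b * perpAvg t (MvPolynomial.pderiv b p) := by
  classical
  have hmem : EuclideanSpace.single a (1 : ℝ) - t a • t ∈ orthHyperplane t := by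
    rw [Submodule.mem_orthogonal_singleton_iff_inner_right, inner_sub_right, inner_smul_right,
      real_inner_self_eq_norm_sq, ht, EuclideanSpace.inner_single_right]
    simp
  set v : orthHyperplane t := ⟨_, hmem⟩ with hv
  have hfr := finrank_orthHyperplane ht
  have h := sphAvg_lin_mul (F := orthHyperplane t) (by omega) (orthHyperplane t).subtypeₗᵢ hp v
  have e : ∀ b, toCVec ((orthHyperplane t).subtypeₗᵢ v) b =
      (if b = a then 1 else 0) - toCVec t a * toCVec t b := by
    intro b
    change (((EuclideanSpace.single a (1 : ℝ) - t a • t : RVec m) b : ℝ) : ℂ) = _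
    by_cases h : b = a <;> simp [toCVec, h]
  have e1 : perpAvg t (lin (toCVec ((orthHyperplane t).subtypeₗᵢ v)) * p) =
      perpAvg t (MvPolynomial.X a * p) := by
    refine sphAvg_congr _ fun ω _ => ?_
    rw [map_mul, map_mul, eval_lin, sum_toCVec_mul, LinearIsometry.inner_map_map,
      MvPolynomial.eval_X]
    congr 1
    have hω : inner ℝ t (ω : RVec m) = 0 :=
      (Submodule.mem_orthogonal_singleton_iff_inner_right).1 ω.2
    rw [Submodule.coe_inner, hv, inner_sub_left, inner_smul_left, hω,
      EuclideanSpace.inner_single_left]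
    simp [toCVec]
  have e2 : dlin (toCVec ((orthHyperplane t).subtypeₗᵢ v)) p =
      MvPolynomial.pderiv a p -
        toCVec t a • ∑ b, toCVec t b • MvPolynomial.pderiv b p := by
    rw [dlin_apply, Finset.smul_sum]
    simp only [e, sub_smul, Finset.sum_sub_distrib, ite_smul, one_smul, zero_smul,
      Finset.sum_ite_eq', Finset.mem_univ, if_true, smul_smul]
  rw [e2, map_sub, map_smul, map_sum] at h
  simp only [map_smul, smul_eq_mul] at h
  rw [← h, ← e1, hfr]
  push_cast [Nat.cast_sub (show 1 ≤ m by omega)]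
  ring

/-- The right side is the average of the Laplacian of the hyperplane, `Δ` minus the second
derivative along `t`. It expresses the average of `p` through averages of degree `N - 2`, with
coefficients polynomial in `t`. -/
theorem perpAvg_lap (hm : 3 ≤ m) {t : RVec m} (ht : ‖t‖ = 1) {N : ℕ}
    {p : MvPolynomial (Fin m) ℂ} (hp : p.IsHomogeneous N) :
    (N : ℂ) * (m + N - 3) * perpAvg t p = ∑ a, perpAvg t (MvPolynomial.pderiv a
      (MvPolynomial.pderiv a p)) - ∑ a, ∑ b, toCVec t a * toCVec t b *
        perpAvg t (MvPolynomial.pderiv a (MvPolynomial.pderiv b p)) := by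
  rcases N with _ | N
  · obtain ⟨c, rfl⟩ := eq_C_of_isHomogeneous_zero hp
    simp
  · have h : ∀ a, ((N : ℂ) + m - 2) * perpAvg t (MvPolynomial.X a * MvPolynomial.pderiv a p) =
      perpAvg t (MvPolynomial.pderiv a (MvPolynomial.pderiv a p)) - ∑ b, toCVec t a * toCVec t b *
        perpAvg t (MvPolynomial.pderiv a (MvPolynomial.pderiv b p)) := by
      intro a
      have h1 := perpAvg_X_mul hm ht (hp.pderiv (i := a)) a
      rw [Nat.add_sub_cancel] at h1
      rw [h1, Finset.mul_sum]
      congr 1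
      refine Finset.sum_congr rfl fun b _ => ?_
      rw [pderiv_comm b a, mul_assoc]
    rw [← Finset.sum_sub_distrib, ← Finset.sum_congr rfl fun a _ => h a, ← Finset.mul_sum,
      ← map_sum, hp.sum_X_mul_pderiv, map_nsmul]
    push_cast
    simp only [nsmul_eq_mul]
    push_cast
    ring

/-- Induction on the degree through `perpAvg_lap`. The second conclusion is the infinitesimal
equivariance: rotating `p` before averaging amounts to rotating the representing polynomial. It must
be carried along in the induction, since `q` is determined only on the unit sphere. -/
theorem exists_perpAvg_eq_eval (hm : 3 ≤ m) {N : ℕ} {p : MvPolynomial (Fin m) ℂ}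
    (hp : p.IsHomogeneous N) :
    ∃ q : MvPolynomial (Fin m) ℂ, ∀ t : RVec m, ‖t‖ = 1 →
      perpAvg t p = MvPolynomial.eval (toCVec t) q ∧
      ∀ i j, perpAvg t (rotField i j p) = MvPolynomial.eval (toCVec t) (rotField i j q) := by
  classical
  induction N using Nat.strong_induction_on generalizing p with
  | _ N ih =>
    rcases Nat.eq_zero_or_pos N with rfl | hN
    · obtain ⟨c, rfl⟩ := eq_C_of_isHomogeneous_zero hp
      refine ⟨MvPolynomial.C c, fun t ht => ⟨?_, fun i j => by simp⟩⟩
      rw [sphAvg_C (by rw [finrank_orthHyperplane ht]; omega), MvPolynomial.eval_C]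
    have hd : ∀ a b, (MvPolynomial.pderiv a (MvPolynomial.pderiv b p)).IsHomogeneous (N - 2) := by
      intro a b
      have := (hp.pderiv (i := b)).pderiv (i := a)
      rwa [Nat.sub_sub] at this
    choose q hq using fun a b => ih (N - 2) (by omega) (hd a b)
    have hc : ((N : ℂ) * (m + N - 3)) ≠ 0 := by
      have : ((N : ℂ) * (m + N - 3)) = ((N * (m - 3 + N) : ℕ) : ℂ) := by
        push_cast [Nat.cast_sub hm]; ring
      rw [this]; exact_mod_cast (Nat.mul_pos hN (by omega)).ne'
    set κ : ℂ := ((N : ℂ) * (m + N - 3)) with hκ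
    -- This is `perpAvg_lap` solved for the average, with `q a b` representing the average of `∂_a
    -- ∂_b p`.
    refine ⟨MvPolynomial.C κ⁻¹ * (∑ a, q a a -
      ∑ a, ∑ b, MvPolynomial.X a * MvPolynomial.X b * q a b), fun t ht => ⟨?_, fun i j => ?_⟩⟩
    · have h := perpAvg_lap hm ht hp
      simp only [map_mul, map_sub, map_sum, MvPolynomial.eval_C, MvPolynomial.eval_X]
      rw [eq_inv_mul_iff_mul_eq₀ hc, h]
      simp only [fun a b => (hq a b t ht).1]
    · have h := perpAvg_lap hm ht (isHomogeneous_rotField i j hp)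
      have e0 : ∀ q, rotField i j (MvPolynomial.C κ⁻¹ * q) = MvPolynomial.C κ⁻¹ * rotField i j q := by
        intro q; simp only [Derivation.leibniz, smul_eq_mul]; simp
      rw [e0, map_mul, MvPolynomial.eval_C, eq_inv_mul_iff_mul_eq₀ hc, h, ← map_sum]
      change perpAvg t (lap (rotField i j p)) - _ = _
      rw [lap_rotField, lap, map_sum, map_sum, map_sub, map_sub]
      congr 1
      · rw [map_sum, map_sum]
        exact Finset.sum_congr rfl fun a _ => (hq a a t ht).2 i j
      -- The terms created by commuting `∂_a ∂_b` past the rotation agree, after contraction with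
      -- `t_a t_b`, with those created by rotating the factor `X_a X_b`.
      · have c2 : ∀ a b, perpAvg t (MvPolynomial.pderiv a (MvPolynomial.pderiv b
            (rotField i j p))) = MvPolynomial.eval (toCVec t) (rotField i j (q a b)) +
            ((if i = a then MvPolynomial.eval (toCVec t) (q j b) else 0) -
             (if j = a then MvPolynomial.eval (toCVec t) (q i b) else 0)) +
            ((if i = b then MvPolynomial.eval (toCVec t) (q a j) else 0) -
             (if j = b then MvPolynomial.eval (toCVec t) (q a i) else 0)) := by
          intro a b
          rw [pderiv_rotField b, map_add, pderiv_rotField a, map_sub,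
            apply_ite (MvPolynomial.pderiv a), apply_ite (MvPolynomial.pderiv a), map_zero]
          simp only [map_add, map_sub, apply_ite (perpAvg t), map_zero, (hq _ _ t ht).1,
            (hq _ _ t ht).2]
        simp only [c2]
        have c3 : ∀ a b, MvPolynomial.eval (toCVec t) (rotField i j
            (MvPolynomial.X a * MvPolynomial.X b * q a b)) =
            toCVec t a * toCVec t b * MvPolynomial.eval (toCVec t) (rotField i j (q a b)) +
            ((if j = a then toCVec t i * toCVec t b * MvPolynomial.eval (toCVec t) (q a b) else 0) -
             (if i = a then toCVec t j * toCVec t b * MvPolynomial.eval (toCVec t) (q a b) else 0)) +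
            ((if j = b then toCVec t i * toCVec t a * MvPolynomial.eval (toCVec t) (q a b) else 0) -
             (if i = b then toCVec t j * toCVec t a * MvPolynomial.eval (toCVec t) (q a b) else 0)) := by
          intro a b
          simp only [Derivation.leibniz, smul_eq_mul, map_add, map_mul, MvPolynomial.eval_X]
          have hX : ∀ c, MvPolynomial.eval (toCVec t) (rotField i j (MvPolynomial.X c)) =
              (if j = c then toCVec t i else 0) - (if i = c then toCVec t j else 0) := by
            intro c
            simp only [rotField_apply, MvPolynomial.pderiv_X, map_sub, map_mul,
              MvPolynomial.eval_X, Pi.single_apply]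
            by_cases h1 : j = c <;> by_cases h2 : i = c <;> simp [h1, h2, eq_comm]
          rw [hX, hX]
          split_ifs <;> ring
        simp only [map_sum, c3]
        simp only [mul_add, mul_sub, mul_ite, mul_zero, Finset.sum_add_distrib,
          Finset.sum_sub_distrib, Finset.sum_ite_eq, Finset.mem_univ, if_true]
        have s1 : ∀ (f : Fin m → Fin m → ℂ) (c : Fin m),
            ∑ a, ∑ b, (if c = a then f a b else 0) = ∑ b, f c b := by
          intro f c
          rw [Finset.sum_comm]
          simp
        simp only [s1]
        rw [← sub_eq_zero]
        ring_nf

end PerpAvg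

/-! ### Averages over orthonormal pairs and their rotation invariance -/

section Stiefel

open MvPolynomial

variable {m : ℕ} {R : Type*} [CommRing R]

/-- The polynomials in two vector variables. -/
abbrev PairPoly (m : ℕ) (R : Type*) [CommRing R] : Type _ := MvPolynomial (Fin m ⊕ Fin m) R

/-- The simultaneous rotation field in two vector variables. -/
def rotPair (R : Type*) [CommRing R] (i j : Fin m) :
    Derivation R (PairPoly m R) (PairPoly m R) :=
  ((X (Sum.inl i) : PairPoly m R) • pderiv (Sum.inl j) -
    (X (Sum.inl j) : PairPoly m R) • pderiv (Sum.inl i)) +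
  ((X (Sum.inr i) : PairPoly m R) • pderiv (Sum.inr j) -
    (X (Sum.inr j) : PairPoly m R) • pderiv (Sum.inr i))

theorem rotPair_apply (i j : Fin m) (p : PairPoly m R) :
    rotPair R i j p = (X (Sum.inl i) * pderiv (Sum.inl j) p -
      X (Sum.inl j) * pderiv (Sum.inl i) p) +
      (X (Sum.inr i) * pderiv (Sum.inr j) p - X (Sum.inr j) * pderiv (Sum.inr i) p) := rfl

theorem rotPair_X_inl (i j a : Fin m) :
    rotPair R i j (X (Sum.inl a)) =
      (if j = a then X (Sum.inl i) else 0) - (if i = a then X (Sum.inl j) else 0) := by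
  simp only [rotPair_apply, pderiv_X, Pi.single_apply]
  by_cases h1 : j = a <;> by_cases h2 : i = a <;> simp [h1, h2, eq_comm]

theorem rotPair_X_inr (i j a : Fin m) :
    rotPair R i j (X (Sum.inr a)) =
      (if j = a then X (Sum.inr i) else 0) - (if i = a then X (Sum.inr j) else 0) := by
  simp only [rotPair_apply, pderiv_X, Pi.single_apply]
  by_cases h1 : j = a <;> by_cases h2 : i = a <;> simp [h1, h2, eq_comm]

/-- The value at `(t, s)` of a polynomial in two vector variables. -/
abbrev evalPair (t s : Fin m → R) : PairPoly m R →+* R := eval (Sum.elim t s)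

/-- Substitution of the first vector variable. -/
def fixFst (t : Fin m → ℂ) : PairPoly m ℂ →ₐ[ℂ] MvPolynomial (Fin m) ℂ :=
  aeval (Sum.elim (fun j => C (t j)) X)

theorem eval_fixFst (t s : Fin m → ℂ) (p : PairPoly m ℂ) :
    eval s (fixFst t p) = evalPair t s p := by
  rw [fixFst, aeval_def, ← coe_eval₂Hom, ← RingHom.comp_apply]
  congr 1
  apply MvPolynomial.ringHom_ext
  · intro r; simp
  · rintro (i | i) <;> simp

theorem fixFst_X_inl (t : Fin m → ℂ) (a : Fin m) : fixFst t (X (Sum.inl a)) = C (t a) := by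
  simp [fixFst]

theorem rotPair_rename_inr (i j : Fin m) (v : MvPolynomial (Fin m) ℂ) :
    rotPair ℂ i j (rename Sum.inr v) = rename Sum.inr (rotField i j v) := by
  have h : ∀ a, pderiv (Sum.inl a : Fin m ⊕ Fin m) (rename Sum.inr v) = 0 := fun a => by
    classical
    refine pderiv_eq_zero_of_notMem_vars fun h => ?_
    have := vars_rename Sum.inr v h
    simp at this
  rw [rotPair_apply, h, h, pderiv_rename Sum.inr_injective, pderiv_rename Sum.inr_injective,
    rotField_apply]
  simp

theorem fixFst_rename_inr (t : Fin m → ℂ) (v : MvPolynomial (Fin m) ℂ) :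
    fixFst t (rename Sum.inr v) = v := by
  rw [fixFst, aeval_rename]
  simp

/-- A polynomial on the sphere whose rotation derivatives represent those of the inner average. -/
def RepresentsInner (p : PairPoly m ℂ) (q : MvPolynomial (Fin m) ℂ) : Prop :=
  ∀ t : RVec m, ‖t‖ = 1 → perpAvg t (fixFst (toCVec t) p) = eval (toCVec t) q ∧
    ∀ i j, perpAvg t (fixFst (toCVec t) (rotPair ℂ i j p)) = eval (toCVec t) (rotField i j q)

theorem RepresentsInner.add {p p' : PairPoly m ℂ} {q q' : MvPolynomial (Fin m) ℂ}
    (h : RepresentsInner p q) (h' : RepresentsInner p' q') :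
    RepresentsInner (p + p') (q + q') := fun t ht =>
  ⟨by simp only [map_add, (h t ht).1, (h' t ht).1],
    fun i j => by simp only [map_add, (h t ht).2, (h' t ht).2]⟩

theorem RepresentsInner.C_mul {p : PairPoly m ℂ} {q : MvPolynomial (Fin m) ℂ}
    (h : RepresentsInner p q) (c : ℂ) : RepresentsInner (C c * p) (C c * q) := fun t ht =>
  ⟨by simp only [← smul_eq_C_mul, map_smul, (h t ht).1, smul_eval, smul_eq_mul],
    fun i j => by
      simp only [← smul_eq_C_mul]
      rw [Derivation.map_smul, Derivation.map_smul, map_smul, map_smul, (h t ht).2, smul_eval,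
        smul_eq_mul]⟩

/-- The factor `t_a` is constant for the inner average, and the two rotation fields act on it in the
same way, so the Leibniz rule matches on both sides. -/
theorem RepresentsInner.X_mul {p : PairPoly m ℂ} {q : MvPolynomial (Fin m) ℂ}
    (h : RepresentsInner p q) (a : Fin m) :
    RepresentsInner (X (Sum.inl a) * p) (X a * q) := by
  intro t ht
  have hX : ∀ (b : Fin m) (r : PairPoly m ℂ),
      perpAvg t (fixFst (toCVec t) (X (Sum.inl b) * r)) =
        toCVec t b * perpAvg t (fixFst (toCVec t) r) := by
    intro b r
    rw [map_mul, fixFst_X_inl, ← smul_eq_C_mul, map_smul, smul_eq_mul]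
  refine ⟨by rw [hX, (h t ht).1, map_mul, eval_X], fun i j => ?_⟩
  have e : rotPair ℂ i j (X (Sum.inl a) * p) = X (Sum.inl a) * rotPair ℂ i j p +
      ((if j = a then X (Sum.inl i) * p else 0) - (if i = a then X (Sum.inl j) * p else 0)) := by
    rw [Derivation.leibniz, rotPair_X_inl, smul_eq_mul, smul_eq_mul]
    split_ifs <;> ring
  have e' : rotField i j (X a * q) = X a * rotField i j q +
      ((if j = a then X i * q else 0) - (if i = a then X j * q else 0)) := by
    rw [Derivation.leibniz, smul_eq_mul, smul_eq_mul]
    have : rotField i j (X a) = (if j = a then X i else 0) - (if i = a then X j else 0) := by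
      simp only [rotField_apply, pderiv_X, Pi.single_apply, eq_comm (a := a)]
      by_cases h1 : j = a <;> by_cases h2 : i = a <;> simp [h1, h2]
    rw [this]
    split_ifs <;> ring
  rw [e, e', map_add, map_add, map_add, hX, (h t ht).2, map_mul, eval_X]
  congr 1
  rw [map_sub, map_sub, map_sub]
  congr 1
  · split_ifs
    · rw [hX, (h t ht).1, map_mul, eval_X]
    · simp
  · split_ifs
    · rw [hX, (h t ht).1, map_mul, eval_X]
    · simp

theorem exists_representsInner (hm : 3 ≤ m) (p : PairPoly m ℂ) :
    ∃ q, RepresentsInner p q := by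
  -- The extra factor `v` absorbs the variables of the second vector one at a time, so that the
  -- constant case of the induction is `exists_perpAvg_eq_eval`.
  suffices h : ∀ (N : ℕ) (v : MvPolynomial (Fin m) ℂ), v.IsHomogeneous N →
      ∃ q, RepresentsInner (p * rename Sum.inr v) q by
    simpa using h 0 1 (isHomogeneous_one _ _)
  induction p using MvPolynomial.induction_on with
  | C a =>
    intro N v hv
    obtain ⟨q, hq⟩ := exists_perpAvg_eq_eval hm hv
    refine ⟨C a * q, RepresentsInner.C_mul (fun t ht => ⟨?_, fun i j => ?_⟩) a⟩
    · rw [fixFst_rename_inr, (hq t ht).1]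
    · rw [rotPair_rename_inr, fixFst_rename_inr, (hq t ht).2]
  | add p p' hp hp' =>
    intro N v hv
    obtain ⟨q, hq⟩ := hp N v hv
    obtain ⟨q', hq'⟩ := hp' N v hv
    exact ⟨q + q', by rw [add_mul]; exact hq.add hq'⟩
  | mul_X p i hp =>
    intro N v hv
    rcases i with a | b
    · obtain ⟨q, hq⟩ := hp N v hv
      refine ⟨X a * q, ?_⟩
      rw [show p * X (Sum.inl a) * rename Sum.inr v =
        X (Sum.inl a) * (p * rename Sum.inr v) by ring]
      exact hq.X_mul a
    · obtain ⟨q, hq⟩ := hp (1 + N) (X b * v) ((isHomogeneous_X _ b).mul hv)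
      refine ⟨q, ?_⟩
      rw [map_mul, rename_X, ← mul_assoc] at hq
      exact hq

/-- The average over the pairs of orthonormal vectors of a polynomial. -/
def pairAvg (m : ℕ) (p : PairPoly m ℂ) : ℂ :=
  ((sphereArea m : ℝ) : ℂ)⁻¹ * ∫ t : Metric.sphere (0 : RVec m) 1,
    perpAvg (t : RVec m) (fixFst (toCVec (t : RVec m)) p) ∂(sphereMeasure (RVec m))

theorem RepresentsInner.pairAvg_eq {p : PairPoly m ℂ} {q : MvPolynomial (Fin m) ℂ}
    (h : RepresentsInner p q) : pairAvg m p = sphAvgFull m q := by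
  rw [pairAvg, sphAvg_apply, finrank_euclideanSpace_fin]
  congr 1
  refine integral_congr_ae (.of_forall fun t => ?_)
  exact (h t (by simp)).1

theorem pairAvg_add (hm : 3 ≤ m) (p p' : PairPoly m ℂ) :
    pairAvg m (p + p') = pairAvg m p + pairAvg m p' := by
  obtain ⟨q, hq⟩ := exists_representsInner hm p
  obtain ⟨q', hq'⟩ := exists_representsInner hm p'
  rw [hq.pairAvg_eq, hq'.pairAvg_eq, (hq.add hq').pairAvg_eq, map_add]

theorem pairAvg_smul (hm : 3 ≤ m) (c : ℂ) (p : PairPoly m ℂ) :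
    pairAvg m (c • p) = c * pairAvg m p := by
  obtain ⟨q, hq⟩ := exists_representsInner hm p
  rw [smul_eq_C_mul, hq.pairAvg_eq, (hq.C_mul c).pairAvg_eq, ← smul_eq_C_mul, map_smul,
    smul_eq_mul]

/-- This takes the place of invariance of the measure on orthonormal pairs: the inner average turns
the simultaneous rotation into a rotation field in `t` alone, which averages to zero. -/
theorem pairAvg_rotPair (hm : 3 ≤ m) (i j : Fin m) (p : PairPoly m ℂ) :
    pairAvg m (rotPair ℂ i j p) = 0 := by
  obtain ⟨q, hq⟩ := exists_representsInner hm p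
  have h : pairAvg m (rotPair ℂ i j p) = sphAvgFull m (rotField i j q) := by
    rw [pairAvg, sphAvg_apply, finrank_euclideanSpace_fin]
    congr 1
    refine integral_congr_ae (.of_forall fun t => ?_)
    exact (hq t (by simp)).2 i j
  rw [h, sphAvgFull_rotField hm]

/-- A pair of orthonormal vectors. -/
def Orthonormal2 (t s : RVec m) : Prop := ‖t‖ = 1 ∧ ‖s‖ = 1 ∧ inner ℝ t s = 0

theorem pairAvg_congr {p p' : PairPoly m ℂ} (h : ∀ t s : RVec m, Orthonormal2 t s →
    evalPair (toCVec t) (toCVec s) p = evalPair (toCVec t) (toCVec s) p') :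
    pairAvg m p = pairAvg m p' := by
  rw [pairAvg, pairAvg]
  congr 1
  refine integral_congr_ae (.of_forall fun t => ?_)
  refine sphAvg_congr _ fun s hs => ?_
  rw [eval_fixFst, eval_fixFst]
  exact h t s ⟨by simp, hs, (Submodule.mem_orthogonal_singleton_iff_inner_right).1 s.2⟩

theorem pairAvg_C (hm : 3 ≤ m) (c : ℂ) : pairAvg m (C c) = c := by
  have : RepresentsInner (C c : PairPoly m ℂ) (C c) := fun t ht => by
    refine ⟨?_, fun i j => by simp⟩
    rw [show (C c : PairPoly m ℂ) = algebraMap ℂ _ c from rfl, AlgHom.commutes,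
      show algebraMap ℂ (MvPolynomial (Fin m) ℂ) c = C c from rfl,
      sphAvg_C (by rw [finrank_orthHyperplane ht]; omega), eval_C]
  rw [this.pairAvg_eq, sphAvg_C (by rw [finrank_euclideanSpace_fin]; omega)]

end Stiefel

/-! ### Applying a linear functional to polynomial coefficients -/

section Coefficients

open MvPolynomial

variable {m : ℕ} {σ : Type*} {R : Type*} [CommRing R] [Algebra ℂ R]

/-- The functional `Λ` applied to the coefficients of a polynomial. -/
def mapCoeff (Λ : R →ₗ[ℂ] ℂ) : MvPolynomial σ R →ₗ[ℂ] MvPolynomial σ ℂ :=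
  (basisMonomials σ ℂ).repr.symm.toLinearMap ∘ₗ Finsupp.mapRange.linearMap Λ ∘ₗ
    ((basisMonomials σ R).repr.toLinearMap.restrictScalars ℂ)

theorem mapCoeff_monomial (Λ : R →ₗ[ℂ] ℂ) (n : σ →₀ ℕ) (a : R) :
    mapCoeff Λ (monomial n a) = monomial n (Λ a) := by
  have h : (basisMonomials σ R).repr (monomial n a) = Finsupp.single n a := by
    have : monomial n a = a • (basisMonomials σ R) n := by
      rw [coe_basisMonomials, smul_monomial, smul_eq_mul, mul_one]
    rw [this, map_smul, Module.Basis.repr_self, Finsupp.smul_single, smul_eq_mul, mul_one]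
  simp only [mapCoeff, LinearMap.comp_apply, LinearMap.restrictScalars_apply,
    LinearEquiv.coe_coe, h, Finsupp.mapRange.linearMap_apply, Finsupp.mapRange_single]
  rw [Module.Basis.repr_symm_single, coe_basisMonomials, smul_monomial, smul_eq_mul, mul_one]

theorem eval_mapCoeff (Λ : R →ₗ[ℂ] ℂ) (x : σ → ℂ) (W : MvPolynomial σ R) :
    eval x (mapCoeff Λ W) = Λ (eval (fun j => algebraMap ℂ R (x j)) W) := by
  induction W using MvPolynomial.induction_on' with
  | add p q hp hq => simp only [map_add, hp, hq]
  | monomial n a =>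
    rw [mapCoeff_monomial, eval_monomial, eval_monomial]
    have : a * n.prod (fun i k => algebraMap ℂ R (x i) ^ k) = (n.prod fun i k => x i ^ k) • a := by
      rw [Algebra.smul_def, mul_comm]
      simp [Finsupp.prod, map_prod]
    rw [this, map_smul, smul_eq_mul, mul_comm]

theorem mapCoeff_X_mul (Λ : R →ₗ[ℂ] ℂ) (i : σ) (W : MvPolynomial σ R) :
    mapCoeff Λ (X i * W) = X i * mapCoeff Λ W := by
  induction W using MvPolynomial.induction_on' with
  | add p q hp hq => simp only [mul_add, map_add, hp, hq]
  | monomial n a =>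
    rw [mapCoeff_monomial, X, X, monomial_mul, monomial_mul, mapCoeff_monomial, one_mul, one_mul]

theorem mapCoeff_pderiv (Λ : R →ₗ[ℂ] ℂ) (i : σ) (W : MvPolynomial σ R) :
    mapCoeff Λ (pderiv i W) = pderiv i (mapCoeff Λ W) := by
  induction W using MvPolynomial.induction_on' with
  | add p q hp hq => simp only [map_add, hp, hq]
  | monomial n a =>
    rw [mapCoeff_monomial, pderiv_monomial, pderiv_monomial, mapCoeff_monomial]
    congr 1
    rw [mul_comm, ← nsmul_eq_mul, map_nsmul, nsmul_eq_mul, mul_comm]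

theorem mapCoeff_rotPair (Λ : R →ₗ[ℂ] ℂ) (i j : Fin m) (W : PairPoly m R) :
    mapCoeff Λ (rotPair R i j W) = rotPair ℂ i j (mapCoeff Λ W) := by
  simp only [rotPair_apply, map_add, map_sub, mapCoeff_X_mul, mapCoeff_pderiv]

end Coefficients

theorem derivation_sum_apply {R ι A : Type*} [CommRing R] [CommRing A] [Algebra R A]
    (S : Finset ι) (D : ι → Derivation R A A) (p : A) : (∑ i ∈ S, D i) p = ∑ i ∈ S, D i p := by
  rw [← Derivation.coeFnAddMonoidHom_apply, map_sum, Finset.sum_apply]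
  rfl

/-! ### Recurrences for moments from rotation invariance -/

section Recursion

open MvPolynomial

variable {m : ℕ} {R : Type*} [CommRing R] [Algebra ℂ R]

/-- The average over the orthonormal pairs composed with a functional on the coefficients. -/
def pairFun (Λ : R →ₗ[ℂ] ℂ) (W : PairPoly m R) : ℂ := pairAvg m (mapCoeff Λ W)

/-- The value of a polynomial at a pair of real vectors. -/
abbrev evalReal (t s : RVec m) : PairPoly m R →+* R :=
  evalPair (fun j => algebraMap ℂ R (toCVec t j)) (fun j => algebraMap ℂ R (toCVec s j))

theorem evalPair_mapCoeff (Λ : R →ₗ[ℂ] ℂ) (t s : RVec m) (W : PairPoly m R) :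
    evalPair (toCVec t) (toCVec s) (mapCoeff Λ W) = Λ (evalReal t s W) := by
  rw [evalPair, eval_mapCoeff]
  congr 2
  congr 1
  ext (j | j) <;> rfl

theorem pairFun_congr {Λ : R →ₗ[ℂ] ℂ} {W W' : PairPoly m R}
    (h : ∀ t s : RVec m, Orthonormal2 t s → Λ (evalReal t s W) = Λ (evalReal t s W')) :
    pairFun Λ W = pairFun Λ W' :=
  pairAvg_congr fun t s hts => by rw [evalPair_mapCoeff, evalPair_mapCoeff, h t s hts]

theorem pairFun_eq_zero (hm : 3 ≤ m) {Λ : R →ₗ[ℂ] ℂ} {W : PairPoly m R}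
    (h : ∀ t s : RVec m, Orthonormal2 t s → Λ (evalReal t s W) = 0) :
    pairFun Λ W = 0 := by
  rw [pairFun_congr (W' := 0) fun t s hts => by rw [h t s hts, map_zero, map_zero],
    pairFun, map_zero]
  simpa using pairAvg_C hm 0

theorem pairFun_add (hm : 3 ≤ m) (Λ : R →ₗ[ℂ] ℂ) (W W' : PairPoly m R) :
    pairFun Λ (W + W') = pairFun Λ W + pairFun Λ W' := by
  rw [pairFun, map_add, pairAvg_add hm]; rfl

theorem pairFun_smul (hm : 3 ≤ m) (Λ : R →ₗ[ℂ] ℂ) (c : ℂ) (W : PairPoly m R) :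
    pairFun Λ (c • W) = c * pairFun Λ W := by
  rw [pairFun, map_smul, pairAvg_smul hm]; rfl

theorem pairFun_sum (hm : 3 ≤ m) (Λ : R →ₗ[ℂ] ℂ) {ι : Type*} (S : Finset ι)
    (W : ι → PairPoly m R) : pairFun Λ (∑ i ∈ S, W i) = ∑ i ∈ S, pairFun Λ (W i) := by
  classical
  induction S using Finset.induction_on with
  | empty => simpa using pairFun_eq_zero hm (by simp)
  | insert a S ha ih => rw [Finset.sum_insert ha, Finset.sum_insert ha, pairFun_add hm, ih]

theorem pairFun_C_mul_rotPair (hm : 3 ≤ m) (Λ : R →ₗ[ℂ] ℂ) (c : R) (i j : Fin m)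
    (W : PairPoly m R) : pairFun Λ (C c * rotPair R i j W) = 0 := by
  rw [← smul_eq_C_mul, ← Derivation.map_smul, pairFun, mapCoeff_rotPair, pairAvg_rotPair hm]

/-- A vector of polynomials that rotates like the variables. -/
def IsEquivariant (ρ : Fin m → PairPoly m R) : Prop :=
  ∀ i j a, rotPair R i j (ρ a) = (if j = a then ρ i else 0) - (if i = a then ρ j else 0)

/-- The bilinear product of a constant vector and a vector of polynomials. -/
def dotP (v : Fin m → R) (ρ : Fin m → PairPoly m R) : PairPoly m R := ∑ j, C (v j) * ρ j

/-- The derivation `∑ w_i ρ_j L_{ij}`. -/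
def contract (w : Fin m → R) (ρ : Fin m → PairPoly m R) :
    Derivation R (PairPoly m R) (PairPoly m R) :=
  ∑ i, ∑ j, (C (w i) * ρ j) • rotPair R i j

theorem contract_apply (w : Fin m → R) (ρ : Fin m → PairPoly m R) (p : PairPoly m R) :
    contract w ρ p = ∑ i, ∑ j, C (w i) * ρ j * rotPair R i j p := by
  rw [contract, derivation_sum_apply]
  refine Finset.sum_congr rfl fun i _ => ?_
  rw [derivation_sum_apply]
  rfl

theorem contract_dotP {ρ ρ' : Fin m → PairPoly m R} (hρ' : IsEquivariant ρ') (w v : Fin m → R) :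
    contract w ρ (dotP v ρ') = dotP v ρ * dotP w ρ' -
      C (∑ i, w i * v i) * ∑ j, ρ j * ρ' j := by
  have h : ∀ i j, rotPair R i j (dotP v ρ') = C (v j) * ρ' i - C (v i) * ρ' j := by
    intro i j
    rw [dotP, map_sum]
    have : ∀ a, rotPair R i j (C (v a) * ρ' a) =
        (if j = a then C (v a) * ρ' i else 0) - (if i = a then C (v a) * ρ' j else 0) := by
      intro a
      rw [← smul_eq_C_mul, Derivation.map_smul, hρ', smul_eq_C_mul]
      split_ifs <;> ring
    simp only [this, Finset.sum_sub_distrib, Finset.sum_ite_eq, Finset.mem_univ, if_true]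
  rw [contract_apply]
  simp only [h]
  simp only [dotP, map_sum, map_mul, Finset.sum_mul_sum]
  rw [Finset.sum_comm (f := fun i j => C (v i) * ρ i * (C (w j) * ρ' j)),
    ← Finset.sum_sub_distrib]
  refine Finset.sum_congr rfl fun i _ => ?_
  rw [← Finset.sum_sub_distrib]
  exact Finset.sum_congr rfl fun j _ => by ring

/-- The argument equals `∑ w_i L_{ij} (ρ_j p)`, a sum of rotation derivatives with constant
coefficients. Equivariance of `ρ` produces `ρ_i` once for every `j ≠ i`, hence the factor `m - 1`.
-/
theorem pairFun_contract (hm : 3 ≤ m) (Λ : R →ₗ[ℂ] ℂ) {ρ : Fin m → PairPoly m R}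
    (hρ : IsEquivariant ρ) (w : Fin m → R) (p : PairPoly m R) :
    pairFun Λ (((m : PairPoly m R) - 1) * dotP w ρ * p + contract w ρ p) = 0 := by
  have h : ((m : PairPoly m R) - 1) * dotP w ρ * p + contract w ρ p =
      ∑ i, ∑ j, C (w i) * rotPair R i j (ρ j * p) := by
    have e : ∀ i j, C (w i) * rotPair R i j (ρ j * p) = C (w i) * ρ j * rotPair R i j p +
        (C (w i) * ρ i * p - (if i = j then C (w i) * ρ i * p else 0)) := by
      intro i j
      rw [Derivation.leibniz, hρ, smul_eq_mul, smul_eq_mul]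
      by_cases hij : i = j
      · subst hij; simp; ring
      · simp [hij]; ring
    simp only [e, Finset.sum_add_distrib, Finset.sum_sub_distrib, Finset.sum_ite_eq,
      Finset.mem_univ, if_true, Finset.sum_const, Finset.card_univ, Fintype.card_fin,
      nsmul_eq_mul, ← contract_apply, ← Finset.mul_sum, ← Finset.sum_mul, dotP]
    ring
  rw [h, pairFun_sum hm]
  refine Finset.sum_eq_zero fun i _ => ?_
  rw [pairFun_sum hm]
  exact Finset.sum_eq_zero fun j _ => pairFun_C_mul_rotPair hm Λ _ i j _

/-- Two equivariant vectors that are null with product `-2` on the orthonormal pairs. -/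
structure IsNullPair (α β : Fin m → PairPoly m R) : Prop where
  equiv_left : IsEquivariant α
  equiv_right : IsEquivariant β
  null_left : ∀ t s : RVec m, Orthonormal2 t s → ∑ j, evalReal t s (α j) * evalReal t s (α j) = 0
  null_right : ∀ t s : RVec m, Orthonormal2 t s → ∑ j, evalReal t s (β j) * evalReal t s (β j) = 0
  prod : ∀ t s : RVec m, Orthonormal2 t s → ∑ j, evalReal t s (α j) * evalReal t s (β j) = -2

theorem IsNullPair.symm {α β : Fin m → PairPoly m R} (h : IsNullPair α β) : IsNullPair β α :=
  ⟨h.equiv_right, h.equiv_left, h.null_right, h.null_left, fun t s hts => by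
    rw [← h.prod t s hts]; exact Finset.sum_congr rfl fun j _ => mul_comm _ _⟩

/-- The average of `⟨z,α⟩^k ⟨z,β⟩^l ⟨w,β⟩^a ⟨w,α⟩^b c`. -/
def pairMoment (Λ : R →ₗ[ℂ] ℂ) (z w : Fin m → R) (α β : Fin m → PairPoly m R)
    (k l a b : ℕ) (c : R) : ℂ :=
  pairFun Λ (dotP z α ^ k * dotP z β ^ l * dotP w β ^ a * dotP w α ^ b * C c)

theorem pairMoment_symm (Λ : R →ₗ[ℂ] ℂ) (z w : Fin m → R) (α β : Fin m → PairPoly m R)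
    (k l a b : ℕ) (c : R) :
    pairMoment Λ z w α β k l a b c = pairMoment Λ z w β α l k b a c := by
  rw [pairMoment, pairMoment]; congr 1; ring

/-- Take `ρ = α` in `pairFun_contract`. Since `⟨α,α⟩ = 0` and `⟨α,β⟩ = -2`, the derivation
multiplies `⟨z,α⟩` and `⟨w,α⟩` by `⟨w,α⟩`, and sends `⟨z,β⟩` to `⟨z,α⟩⟨w,β⟩ + 2⟨w,z⟩` and `⟨w,β⟩` to
`⟨w,α⟩⟨w,β⟩ + 2⟨w,w⟩`. The truncated exponents `l - 1` and `a - 1` are harmless because of the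
factors `l` and `a`. -/
theorem pairMoment_rec (hm : 3 ≤ m) (Λ : R →ₗ[ℂ] ℂ) (z w : Fin m → R)
    {α β : Fin m → PairPoly m R} (h : IsNullPair α β) (k l a b : ℕ) (c : R) :
    ((m : ℂ) - 1 + k + a + b) * pairMoment Λ z w α β k l a (b + 1) c +
      l * pairMoment Λ z w α β (k + 1) (l - 1) (a + 1) b c +
      2 * l * pairMoment Λ z w α β k (l - 1) a b ((∑ i, w i * z i) * c) +
      2 * a * pairMoment Λ z w α β k l (a - 1) b ((∑ i, w i * w i) * c) = 0 := by
  rw [← pairFun_contract hm Λ h.equiv_left w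
    (dotP z α ^ k * dotP z β ^ l * dotP w β ^ a * dotP w α ^ b * C c)]
  simp only [pairMoment, ← pairFun_smul hm, ← pairFun_add hm]
  refine pairFun_congr fun t s hts => ?_
  congr 1
  have hpow : ∀ (f : PairPoly m R) (n : ℕ),
      contract w α (f ^ n) = n * f ^ (n - 1) * contract w α f := by
    intro f n
    rw [Derivation.leibniz_pow, nsmul_eq_mul, smul_eq_mul, mul_assoc]
  have hC : contract w α (C c) = 0 := by
    rw [show (C c : PairPoly m R) = algebraMap R _ c from rfl, Derivation.map_algebraMap]
  have hsm : ∀ (x : ℂ) (p : PairPoly m R), x • p = C (algebraMap ℂ R x) * p := by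
    intro x p; rw [← smul_eq_C_mul, algebraMap_smul]
  simp only [Derivation.leibniz, hpow, hC, contract_dotP h.equiv_left, contract_dotP h.equiv_right,
    smul_eq_mul, hsm]
  generalize (∑ i, w i * z i) = u
  generalize (∑ i, w i * w i) = v
  simp only [map_add, map_sub, map_mul, map_pow, map_zero, map_natCast, map_one, eval_C, map_sum,
    map_ofNat, h.null_left t s hts, h.prod t s hts]
  generalize evalReal t s (dotP z α) = A
  generalize evalReal t s (dotP z β) = B
  generalize evalReal t s (dotP w β) = E
  generalize evalReal t s (dotP w α) = G
  have p1 : ∀ (x : R) (n : ℕ), (n : R) * x ^ (n - 1) * x = n * x ^ n := by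
    intro x n
    rcases n with _ | n
    · simp
    · rw [Nat.add_sub_cancel, mul_assoc, ← pow_succ]
  have q1 := p1 A k
  have q2 := p1 G b
  have q3 := p1 E a
  linear_combination (-B ^ l * E ^ a * G ^ b * c * G) * q1 - A ^ k * B ^ l * E ^ a * c * G * q2 -
    A ^ k * B ^ l * G ^ b * c * G * q3

end Recursion

/-! ### Averages of null powers and of `⟨z,ω⟩^d` against a harmonic polynomial -/

section HarmonicMoments

open MvPolynomial

variable {m : ℕ}

theorem pderiv_lin (u : Fin m → ℂ) (i : Fin m) : pderiv i (lin u) = C (u i) := by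
  simp only [lin, map_sum, pderiv_C_mul, pderiv_X, Pi.single_apply, mul_ite, mul_one, mul_zero,
    Finset.sum_ite_eq', Finset.mem_univ, if_true]

theorem lap_lin_pow_mul_lin_pow {u v : Fin m → ℂ} (hu : ∑ i, u i * u i = 0)
    (hv : ∑ i, v i * v i = 0) (huv : ∑ i, u i * v i = -2) (k l : ℕ) :
    lap (lin u ^ k * lin v ^ l) =
      C (-4 * k * l : ℂ) * (lin u ^ (k - 1) * lin v ^ (l - 1)) := by
  have h1 : ∀ (f : Fin m → ℂ) (i : Fin m) (n : ℕ),
      pderiv i (lin f ^ n) = C (n * f i) * lin f ^ (n - 1) := by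
    intro f i n
    rw [Derivation.leibniz_pow, pderiv_lin, nsmul_eq_mul, smul_eq_mul, map_mul, map_natCast]
    ring
  have h2 : ∀ i, pderiv i (pderiv i (lin u ^ k * lin v ^ l)) =
      C (u i * u i) * (C ((k : ℂ) * (k - 1 : ℕ)) * (lin u ^ (k - 1 - 1) * lin v ^ l)) +
      C (u i * v i) * (C (2 * k * l : ℂ) * (lin u ^ (k - 1) * lin v ^ (l - 1))) +
      C (v i * v i) * (C ((l : ℂ) * (l - 1 : ℕ)) * (lin u ^ k * lin v ^ (l - 1 - 1))) := by
    intro i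
    simp only [pderiv_mul, h1, pderiv_C, map_add, zero_mul, zero_add]
    simp only [map_mul, map_natCast, map_ofNat]
    ring
  simp only [lap, h2, Finset.sum_add_distrib, ← Finset.sum_mul, ← map_sum, hu, hv, huv]
  simp only [map_zero, zero_mul, zero_add, add_zero, ← mul_assoc, ← map_mul]
  congr 3
  ring

/-- Green's identity against `H` in degree `d + 2(n + 1)`: nullity leaves only the mixed second
derivatives, so the Laplacian lowers both exponents by one with factor `-4kl`. -/
theorem sphAvgFull_null_step (hm : 3 ≤ m) {u v : Fin m → ℂ} (hu : ∑ i, u i * u i = 0)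
    (hv : ∑ i, v i * v i = 0) (huv : ∑ i, u i * v i = -2) {d k l n : ℕ}
    {H : MvPolynomial (Fin m) ℂ} (hH : H.IsHomogeneous d) (hL : lap H = 0)
    (hkl : k + l = d + 2 * (n + 1)) :
    sphAvgFull m (lin u ^ k * lin v ^ l * H) =
      -2 * k * l / ((n + 1) * (m + 2 * d + 2 * n)) *
        sphAvgFull m (lin u ^ (k - 1) * lin v ^ (l - 1) * H) := by
  have hq : (lin u ^ k * lin v ^ l).IsHomogeneous (k + l) := by
    simpa using ((isHomogeneous_lin u).pow k).mul ((isHomogeneous_lin v).pow l)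
  have h := sphAvgFull_mul_harmonic hm hq hH hL
  rw [lap_lin_pow_mul_lin_pow hu hv huv, mul_assoc (C _) _ H, ← smul_eq_C_mul, map_smul,
    smul_eq_mul] at h
  have h1 : ((n : ℂ) + 1) * (m + 2 * d + 2 * n) ≠ 0 := by
    have : ((n : ℂ) + 1) * (m + 2 * d + 2 * n) = ((n + 1) * (m + 2 * d + 2 * n) : ℕ) := by
      push_cast; ring
    rw [this]; exact_mod_cast (Nat.mul_pos (by omega) (by omega)).ne'
  rw [hkl] at h
  rw [div_mul_eq_mul_div, eq_div_iff h1]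
  push_cast at h
  linear_combination (1 / 2 : ℂ) * h

/-- Repeated lowering reaches a zero exponent, and with it a zero factor, before the `n` surplus
pairs are used up. This accounts for `θ = 0` when `n > min (k, l)`. -/
theorem sphAvgFull_null_eq_zero (hm : 3 ≤ m) {u v : Fin m → ℂ} (hu : ∑ i, u i * u i = 0)
    (hv : ∑ i, v i * v i = 0) (huv : ∑ i, u i * v i = -2) {d k l n : ℕ}
    {H : MvPolynomial (Fin m) ℂ} (hH : H.IsHomogeneous d) (hL : lap H = 0)
    (hkl : k + l = d + 2 * n) (hn : min k l < n) :
    sphAvgFull m (lin u ^ k * lin v ^ l * H) = 0 := by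
  induction n generalizing k l with
  | zero => omega
  | succ n ih =>
    rw [sphAvgFull_null_step hm hu hv huv hH hL hkl]
    rcases Nat.eq_zero_or_pos k with rfl | hk
    · simp
    rcases Nat.eq_zero_or_pos l with rfl | hl
    · simp
    rw [ih (by omega) (by omega), mul_zero]

theorem sphAvgFull_null_reduce (hm : 3 ≤ m) {u v : Fin m → ℂ} (hu : ∑ i, u i * u i = 0)
    (hv : ∑ i, v i * v i = 0) (huv : ∑ i, u i * v i = -2) (a b n : ℕ)
    {H : MvPolynomial (Fin m) ℂ} (hH : H.IsHomogeneous (a + b)) (hL : lap H = 0) :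
    sphAvgFull m (lin u ^ (a + n) * lin v ^ (b + n) * H) =
      (((-1) ^ n * (a + n).factorial * (b + n).factorial * Real.Gamma ((m : ℝ) / 2 + a + b) /
        (a.factorial * b.factorial * n.factorial * Real.Gamma ((m : ℝ) / 2 + a + b + n)) : ℝ) : ℂ) *
        sphAvgFull m (lin u ^ a * lin v ^ b * H) := by
  induction n with
  | zero =>
    have hpos : 0 < Real.Gamma ((m : ℝ) / 2 + a + b) :=
      Real.Gamma_pos_of_pos (by have : (3 : ℝ) ≤ m := by exact_mod_cast hm
                                positivity)
    have ha : ((a.factorial : ℕ) : ℝ) ≠ 0 := by exact_mod_cast a.factorial_ne_zero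
    have hb : ((b.factorial : ℕ) : ℝ) ≠ 0 := by exact_mod_cast b.factorial_ne_zero
    have : ((-1 : ℝ) ^ 0 * (a + 0).factorial * (b + 0).factorial *
        Real.Gamma ((m : ℝ) / 2 + a + b) / (a.factorial * b.factorial * Nat.factorial 0 *
          Real.Gamma ((m : ℝ) / 2 + a + b + (0 : ℕ)))) = 1 := by
      simp only [Nat.cast_zero, add_zero, Nat.factorial_zero, Nat.cast_one, pow_zero]
      field_simp
    rw [this]; simp
  | succ n ih =>
    rw [sphAvgFull_null_step (n := n) hm hu hv huv hH hL (by ring)]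
    rw [show a + (n + 1) - 1 = a + n by omega, show b + (n + 1) - 1 = b + n by omega, ih,
      ← mul_assoc]
    congr 1
    have hx : (0 : ℝ) < (m : ℝ) / 2 + a + b + n := by
      have : (3 : ℝ) ≤ m := by exact_mod_cast hm
      positivity
    have e : (m : ℝ) / 2 + a + b + (n + 1 : ℕ) = ((m : ℝ) / 2 + a + b + n) + 1 := by
      push_cast; ring
    rw [e, Real.Gamma_add_one hx.ne', ← add_assoc, ← add_assoc, Nat.factorial_succ (a + n),
      Nat.factorial_succ (b + n), Nat.factorial_succ n]
    have hG := (Real.Gamma_pos_of_pos hx).ne'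
    have ha : ((a.factorial : ℕ) : ℝ) ≠ 0 := by exact_mod_cast a.factorial_ne_zero
    have hb : ((b.factorial : ℕ) : ℝ) ≠ 0 := by exact_mod_cast b.factorial_ne_zero
    have hc : ((n.factorial : ℕ) : ℝ) ≠ 0 := by exact_mod_cast n.factorial_ne_zero
    have hn1 : ((n : ℝ) + 1) ≠ 0 := by positivity
    have hy : (m : ℝ) + 2 * (a + b) + 2 * n ≠ 0 := by
      have : (0 : ℝ) < (m : ℝ) + 2 * (a + b) + 2 * n := by linarith
      exact this.ne'
    have key : (-2 * ((a + n + 1 : ℕ) : ℝ) * ((b + n + 1 : ℕ) : ℝ) /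
        (((n : ℝ) + 1) * (m + 2 * ((a + b : ℕ) : ℝ) + 2 * n))) *
        ((-1) ^ n * (a + n).factorial * (b + n).factorial * Real.Gamma ((m : ℝ) / 2 + a + b) /
        (a.factorial * b.factorial * n.factorial * Real.Gamma ((m : ℝ) / 2 + a + b + n))) =
        (-1) ^ (n + 1) * ((a + n + 1) * (a + n).factorial : ℕ) *
          ((b + n + 1) * (b + n).factorial : ℕ) * Real.Gamma ((m : ℝ) / 2 + a + b) /
        (a.factorial * b.factorial * ((n + 1) * n.factorial : ℕ) *
          (((m : ℝ) / 2 + a + b + n) * Real.Gamma ((m : ℝ) / 2 + a + b + n))) := by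
      have e2 : (m : ℝ) / 2 + a + b + n = ((m : ℝ) + 2 * (a + b) + 2 * n) / 2 := by ring
      generalize Real.Gamma ((m : ℝ) / 2 + a + b + n) = G at *
      rw [e2]
      push_cast
      field_simp
      ring
    rw [← key]
    push_cast
    ring

theorem lap_dlin (z : Fin m → ℂ) (p : MvPolynomial (Fin m) ℂ) :
    lap (dlin z p) = dlin z (lap p) := by
  simp only [dlin_apply, lap, map_sum, Derivation.map_smul]
  refine Finset.sum_congr rfl fun i _ => Finset.sum_congr rfl fun j _ => ?_
  rw [pderiv_comm j i, pderiv_comm j i]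

theorem isHomogeneous_dlin (z : Fin m → ℂ) {N : ℕ} {p : MvPolynomial (Fin m) ℂ}
    (hp : p.IsHomogeneous N) : (dlin z p).IsHomogeneous (N - 1) := by
  rw [dlin_apply]
  refine IsHomogeneous.sum _ _ _ fun j _ => ?_
  rw [smul_eq_C_mul]
  exact hp.pderiv.C_mul _

theorem sphAvgFull_lin_mul (hm : 3 ≤ m) (z : Fin m → ℂ) {N : ℕ} {p : MvPolynomial (Fin m) ℂ}
    (hp : p.IsHomogeneous N) :
    ((N : ℂ) + m - 1) * sphAvgFull m (lin z * p) = sphAvgFull m (dlin z p) := by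
  rw [lin, Finset.sum_mul, map_sum, Finset.mul_sum, dlin_apply, map_sum]
  refine Finset.sum_congr rfl fun j _ => ?_
  rw [mul_assoc, ← smul_eq_C_mul, map_smul, map_smul, ← sphAvgFull_X_mul hm hp j, smul_eq_mul,
    smul_eq_mul]
  ring

/-- Reproducing property of `H`. Integrating one factor `⟨z,ω⟩` by parts differentiates `H` along
`z`; the derivative is harmonic of one degree less, and Euler's relation gives back `H (z)`. -/
theorem sphAvgFull_lin_pow (hm : 3 ≤ m) (z : Fin m → ℂ) {d : ℕ} {H : MvPolynomial (Fin m) ℂ}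
    (hH : H.IsHomogeneous d) (hL : lap H = 0) :
    sphAvgFull m (lin z ^ d * H) =
      ((d.factorial * Real.Gamma ((m : ℝ) / 2) /
        (2 ^ d * Real.Gamma ((m : ℝ) / 2 + d)) : ℝ) : ℂ) * eval z H := by
  have hm' : (3 : ℝ) ≤ m := by exact_mod_cast hm
  induction d generalizing H with
  | zero =>
    obtain ⟨c, rfl⟩ := eq_C_of_isHomogeneous_zero hH
    have hpos : 0 < Real.Gamma ((m : ℝ) / 2) := Real.Gamma_pos_of_pos (by positivity)
    have : (((0 : ℕ).factorial : ℝ) * Real.Gamma ((m : ℝ) / 2) /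
        (2 ^ 0 * Real.Gamma ((m : ℝ) / 2 + (0 : ℕ)))) = 1 := by
      simp only [Nat.cast_zero, add_zero, Nat.factorial_zero, Nat.cast_one, pow_zero]
      field_simp
    rw [this, pow_zero, one_mul, sphAvg_C (by rw [finrank_euclideanSpace_fin]; omega), eval_C]
    simp
  | succ d ih =>
    have hpow : (lin z ^ d).IsHomogeneous d := by simpa using (isHomogeneous_lin z).pow d
    have h := sphAvgFull_lin_mul hm z (hpow.mul hH)
    have e : dlin z (lin z ^ d * H) = lin z ^ d * dlin z H +
        C (d * ∑ i, z i * z i) * (lin z ^ (d - 1) * H) := by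
      have hz : dlin z (lin z) = C (∑ i, z i * z i) := by
        rw [dlin_apply]
        simp only [pderiv_lin, smul_eq_C_mul, map_sum, map_mul]
      rw [Derivation.leibniz, Derivation.leibniz_pow, hz, nsmul_eq_mul, smul_eq_mul, smul_eq_mul,
        smul_eq_mul, map_mul, map_natCast]
      ring
    -- The derivative falling on the powers of `⟨z,ω⟩` leaves degree `d - 1` against `H` of degree
    -- `d + 1`.
    have hz0 : sphAvgFull m (lin z ^ (d - 1) * H) = 0 := by
      have hpow' : (lin z ^ (d - 1)).IsHomogeneous (d - 1) := by
        simpa using (isHomogeneous_lin z).pow (d - 1)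
      exact sphAvgFull_mul_harmonic_eq_zero hm hpow' hH hL (by omega)
    have hev : eval z (dlin z H) = (d + 1) * eval z H := by
      have := congrArg (eval z) hH.sum_X_mul_pderiv
      simp only [map_sum, map_mul, eval_X, nsmul_eq_mul, map_natCast] at this
      rw [dlin_apply, map_sum]
      simp only [smul_eval]
      rw [this]; push_cast; ring
    rw [e, map_add, ← smul_eq_C_mul, map_smul, hz0, smul_zero, add_zero,
      ih (isHomogeneous_dlin z hH) (by rw [lap_dlin, hL, map_zero]), hev, ← mul_assoc,
      ← pow_succ'] at h
    have hx : (0 : ℝ) < (m : ℝ) / 2 + d := by positivity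
    have hne : (m : ℂ) + 2 * d ≠ 0 := by
      have : (m : ℂ) + 2 * d = ((m + 2 * d : ℕ) : ℂ) := by push_cast; ring
      rw [this]; exact_mod_cast (by omega)
    have h2 : ((d + (d + 1) : ℕ) : ℂ) + m - 1 = (m : ℂ) + 2 * d := by push_cast; ring
    rw [h2] at h
    refine mul_left_cancel₀ hne (h.trans ?_)
    have e3 : (m : ℝ) / 2 + (d + 1 : ℕ) = ((m : ℝ) / 2 + d) + 1 := by push_cast; ring
    rw [e3, Real.Gamma_add_one hx.ne', Nat.factorial_succ]
    have hG := (Real.Gamma_pos_of_pos hx).ne'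
    have key : ((d.factorial : ℝ) * Real.Gamma ((m : ℝ) / 2) /
        (2 ^ d * Real.Gamma ((m : ℝ) / 2 + d))) * (d + 1) = ((m : ℝ) + 2 * d) *
        (((d + 1) * d.factorial : ℕ) * Real.Gamma ((m : ℝ) / 2) /
        (2 ^ (d + 1) * (((m : ℝ) / 2 + d) * Real.Gamma ((m : ℝ) / 2 + d)))) := by
      have e2 : (m : ℝ) / 2 + d = ((m : ℝ) + 2 * d) / 2 := by ring
      have hy : (m : ℝ) + 2 * d ≠ 0 := by positivity
      generalize Real.Gamma ((m : ℝ) / 2 + d) = G at *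
      rw [e2]
      push_cast
      field_simp
      ring
    have key' := congrArg (fun x : ℝ => (x : ℂ)) key
    simp only [Complex.ofReal_mul, Complex.ofReal_add, Complex.ofReal_natCast,
      Complex.ofReal_one, Complex.ofReal_ofNat] at key'
    rw [← mul_assoc, ← mul_assoc, ← key']

end HarmonicMoments

/-! ### The moments for `τ = t + is`, `τ† = -t + is` -/

section MomentValue

open MvPolynomial

variable {m : ℕ}

/-- The vector `t + i s` of polynomials. -/
def tauP (m : ℕ) (R : Type*) [CommRing R] [Algebra ℂ R] (j : Fin m) : PairPoly m R :=
  X (Sum.inl j) + C (algebraMap ℂ R Complex.I) * X (Sum.inr j)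

/-- The vector `-t + i s` of polynomials. -/
def sigP (m : ℕ) (R : Type*) [CommRing R] [Algebra ℂ R] (j : Fin m) : PairPoly m R :=
  -X (Sum.inl j) + C (algebraMap ℂ R Complex.I) * X (Sum.inr j)

theorem dagger_tauVec (t s : RVec m) (j : Fin m) :
    dagger (tauVec t s) j = -toCVec t j + Complex.I * toCVec s j := by
  simp [dagger, tauVec, toCVec]
  ring

variable {R : Type*} [CommRing R] [Algebra ℂ R]

theorem evalReal_tauP (t s : RVec m) (j : Fin m) :
    evalReal t s (tauP m R j) = algebraMap ℂ R (tauVec t s j) := by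
  simp [tauP, tauVec]

theorem evalReal_sigP (t s : RVec m) (j : Fin m) :
    evalReal t s (sigP m R j) = algebraMap ℂ R (dagger (tauVec t s) j) := by
  rw [dagger_tauVec]
  simp [sigP]

theorem sum_toCVec_sq {t : RVec m} (ht : ‖t‖ = 1) : ∑ j, toCVec t j * toCVec t j = 1 := by
  rw [sum_toCVec_mul, real_inner_self_eq_norm_sq, ht]; simp

theorem bil_tauVec {t s : RVec m} (h : Orthonormal2 t s) :
    bil (tauVec t s) (tauVec t s) = 0 ∧
    bil (dagger (tauVec t s)) (dagger (tauVec t s)) = 0 ∧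
    bil (tauVec t s) (dagger (tauVec t s)) = -2 := by
  obtain ⟨ht, hs, hts⟩ := h
  have h1 := sum_toCVec_sq ht
  have h2 := sum_toCVec_sq hs
  have h3 := sum_toCVec_mul t s
  rw [hts, Complex.ofReal_zero] at h3
  have e1 : ∀ j, tauVec t s j = toCVec t j + Complex.I * toCVec s j := fun j => rfl
  simp only [bil, dagger_tauVec, e1]
  have hI := Complex.I_mul_I
  refine ⟨?_, ?_, ?_⟩
  · have : ∀ j, (toCVec t j + Complex.I * toCVec s j) * (toCVec t j + Complex.I * toCVec s j) =
        toCVec t j * toCVec t j + 2 * Complex.I * (toCVec t j * toCVec s j) -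
          toCVec s j * toCVec s j := fun j => by
      linear_combination (toCVec s j * toCVec s j) * hI
    simp only [this, Finset.sum_sub_distrib, Finset.sum_add_distrib, ← Finset.mul_sum, h1, h2, h3]
    ring
  · have : ∀ j, (-toCVec t j + Complex.I * toCVec s j) * (-toCVec t j + Complex.I * toCVec s j) =
        toCVec t j * toCVec t j - 2 * Complex.I * (toCVec t j * toCVec s j) -
          toCVec s j * toCVec s j := fun j => by
      linear_combination (toCVec s j * toCVec s j) * hI
    simp only [this, Finset.sum_sub_distrib, ← Finset.mul_sum, h1, h2, h3]
    ring
  · have : ∀ j, (toCVec t j + Complex.I * toCVec s j) * (-toCVec t j + Complex.I * toCVec s j) =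
        -(toCVec t j * toCVec t j) - toCVec s j * toCVec s j := fun j => by
      linear_combination (toCVec s j * toCVec s j) * hI
    simp only [this, Finset.sum_sub_distrib, Finset.sum_neg_distrib, h1, h2]
    norm_num

theorem isNullPair_tauP_sigP : IsNullPair (tauP m R) (sigP m R) where
  equiv_left i j a := by
    rw [tauP, ← smul_eq_C_mul, map_add, Derivation.map_smul, rotPair_X_inl, rotPair_X_inr,
      smul_eq_C_mul]
    simp only [tauP]
    split_ifs <;> ring
  equiv_right i j a := by
    rw [sigP, ← smul_eq_C_mul, map_add, map_neg, Derivation.map_smul, rotPair_X_inl,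
      rotPair_X_inr, smul_eq_C_mul]
    simp only [sigP]
    split_ifs <;> ring
  null_left t s h := by
    simp only [evalReal_tauP, ← map_mul, ← map_sum]
    exact (congrArg _ (bil_tauVec h).1).trans (map_zero _)
  null_right t s h := by
    simp only [evalReal_sigP, ← map_mul, ← map_sum]
    exact (congrArg _ (bil_tauVec h).2.1).trans (map_zero _)
  prod t s h := by
    simp only [evalReal_tauP, evalReal_sigP, ← map_mul, ← map_sum]
    exact (congrArg _ (bil_tauVec h).2.2).trans (by rw [map_neg, map_ofNat])

theorem evalReal_dotP_tauP (t s : RVec m) (v : Fin m → R) :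
    evalReal t s (dotP v (tauP m R)) = ∑ j, v j * algebraMap ℂ R (tauVec t s j) := by
  simp only [dotP, map_sum, map_mul, evalReal_tauP, eval_C]

theorem evalReal_dotP_sigP (t s : RVec m) (v : Fin m → R) :
    evalReal t s (dotP v (sigP m R)) = ∑ j, v j * algebraMap ℂ R (dagger (tauVec t s) j) := by
  simp only [dotP, map_sum, map_mul, evalReal_sigP, eval_C]

theorem sum_C_mul_C (z u : Fin m → ℂ) :
    ∑ j, (C (z j) : MvPolynomial (Fin m) ℂ) * algebraMap ℂ _ (u j) = C (bil z u) := by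
  simp only [bil, map_sum, map_mul]; rfl

theorem sum_X_mul_C (u : Fin m → ℂ) :
    ∑ j, (X j : MvPolynomial (Fin m) ℂ) * algebraMap ℂ _ (u j) = lin u := by
  simp only [lin, mul_comm (X _)]; rfl

/-- Integration against `H` over the unit sphere. -/
def sphereFun (H : MvPolynomial (Fin m) ℂ) : MvPolynomial (Fin m) ℂ →ₗ[ℂ] ℂ :=
  (sphAvgFull m).comp (LinearMap.mulRight ℂ H)

theorem sphereFun_apply (H q : MvPolynomial (Fin m) ℂ) :
    sphereFun H q = sphAvgFull m (q * H) := rfl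

/-- The moments with `z` constant and `w` the integration variable on the sphere. -/
abbrev sphMoment (H : MvPolynomial (Fin m) ℂ) (z : CVec m)
    (α β : Fin m → PairPoly m (MvPolynomial (Fin m) ℂ)) (k l a b j : ℕ) : ℂ :=
  pairMoment (sphereFun H) (fun i => C (z i)) X α β k l a b (lin z ^ j)

theorem sphAvgFull_norm_mul (p : MvPolynomial (Fin m) ℂ) :
    sphAvgFull m ((∑ i, X i * X i) * p) = sphAvgFull m p := by
  refine sphAvg_congr _ fun ω hω => ?_
  have : eval (toCVec (LinearIsometry.id (R := ℝ) ω)) (∑ i, X i * X i) = 1 := by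
    simp only [map_sum, map_mul, eval_X]
    exact sum_toCVec_sq hω
  rw [map_mul, this, one_mul]

/-- The last term of `pairMoment_rec` drops out: on the sphere `⟨w,w⟩ = 1`, which leaves degree `d -
2` in `w`, orthogonal to `H`. The hypotheses `hα`, `hβ` ensure that `α` and `β` take values free of
`w`. -/
theorem sphMoment_rec (hm : 3 ≤ m) {d : ℕ} {H : MvPolynomial (Fin m) ℂ} (hH : H.IsHomogeneous d)
    (hL : lap H = 0) (z : CVec m) {α β : Fin m → PairPoly m (MvPolynomial (Fin m) ℂ)}
    (h : IsNullPair α β)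
    (hα : ∀ t s, ∃ u : CVec m, ∀ j, evalReal t s (α j) = C (u j))
    (hβ : ∀ t s, ∃ u : CVec m, ∀ j, evalReal t s (β j) = C (u j))
    {k l a b j : ℕ} (hd : a + b + 1 + j = d) :
    ((m : ℂ) - 1 + k + a + b) * sphMoment H z α β k l a (b + 1) j +
      l * sphMoment H z α β (k + 1) (l - 1) (a + 1) b j +
      2 * l * sphMoment H z α β k (l - 1) a b (j + 1) = 0 := by
  have hr := pairMoment_rec hm (sphereFun H) (fun i => C (z i)) X h k l a b (lin z ^ j)
  have e1 : (∑ i, X i * C (z i)) * lin z ^ j = lin z ^ (j + 1) := by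
    rw [pow_succ']; congr 1; exact Finset.sum_congr rfl fun i _ => mul_comm _ _
  have e2 : pairMoment (sphereFun H) (fun i => C (z i)) X α β k l (a - 1) b
      ((∑ i, X i * X i) * lin z ^ j) = 0 ∨ a = 0 := by
    rcases Nat.eq_zero_or_pos a with ha | ha
    · exact Or.inr ha
    left
    refine pairFun_eq_zero hm fun t s hts => ?_
    obtain ⟨u, hu⟩ := hα t s
    obtain ⟨v, hv⟩ := hβ t s
    have d1 : evalReal t s (dotP (fun i => C (z i)) α) = C (bil z u) := by
      simp only [dotP, map_sum, map_mul, hu, eval_C, bil]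
    have d2 : evalReal t s (dotP (fun i => C (z i)) β) = C (bil z v) := by
      simp only [dotP, map_sum, map_mul, hv, eval_C, bil]
    have d3 : evalReal t s (dotP X α) = lin u := by
      simp only [dotP, map_sum, map_mul, hu, eval_C, lin, mul_comm (X _)]
    have d4 : evalReal t s (dotP X β) = lin v := by
      simp only [dotP, map_sum, map_mul, hv, eval_C, lin, mul_comm (X _)]
    have e0 : evalReal t s (dotP (fun i => C (z i)) α ^ k * dotP (fun i => C (z i)) β ^ l *
        dotP X β ^ (a - 1) * dotP X α ^ b * C ((∑ i, X i * X i) * lin z ^ j)) =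
        C (bil z u) ^ k * C (bil z v) ^ l * lin v ^ (a - 1) * lin u ^ b *
        ((∑ i, X i * X i) * lin z ^ j) := by
      rw [← d1, ← d2, ← d3, ← d4, RingHom.map_mul, RingHom.map_mul, RingHom.map_mul,
        RingHom.map_mul, RingHom.map_pow, RingHom.map_pow, RingHom.map_pow, RingHom.map_pow, eval_C]
    rw [e0, sphereFun_apply]
    have e : C (bil z u) ^ k * C (bil z v) ^ l * lin v ^ (a - 1) * lin u ^ b *
        ((∑ i, X i * X i) * lin z ^ j) * H = C (bil z u ^ k * bil z v ^ l) *
        ((∑ i, X i * X i) * ((lin v ^ (a - 1) * lin u ^ b * lin z ^ j) * H)) := by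
      rw [map_mul, map_pow, map_pow]; ring
    rw [e, ← smul_eq_C_mul, map_smul, sphAvgFull_norm_mul]
    have hq : (lin v ^ (a - 1) * lin u ^ b * lin z ^ j).IsHomogeneous (a - 1 + b + j) := by
      simpa using (((isHomogeneous_lin v).pow (a - 1)).mul ((isHomogeneous_lin u).pow b)).mul
        ((isHomogeneous_lin z).pow j)
    rw [sphAvgFull_mul_harmonic_eq_zero hm hq hH hL (by omega), smul_zero]
  rw [e1] at hr
  have e3 : 2 * (a : ℂ) * pairMoment (sphereFun H) (fun i => C (z i)) X α β k l (a - 1) b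
      ((∑ i, X i * X i) * lin z ^ j) = 0 := by
    rcases e2 with e2 | e2
    · rw [e2, mul_zero]
    · rw [e2]; simp
  rw [e3, add_zero] at hr
  exact hr

/-- The moment with matching exponents. -/
abbrev diagMoment (H : MvPolynomial (Fin m) ℂ) (z : CVec m) (n a b j : ℕ) : ℂ :=
  sphMoment H z (tauP m _) (sigP m _) (a + n) (b + n) a b j

/-- The recurrence and its mirror image under `τ ↔ τ†` are two linear equations in the moments at
`(a, b + 1)` and `(a + 1, b)`, both driven by the moment at `(a, b)` with one more factor `⟨z,w⟩`.
The determinant factors as `(m + 2a + 2b + 2n)(m + a + b - 2)`. -/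
theorem diagMoment_rec (hm : 3 ≤ m) {d : ℕ} {H : MvPolynomial (Fin m) ℂ}
    (hH : H.IsHomogeneous d) (hL : lap H = 0) (z : CVec m) (n : ℕ) {a b j : ℕ}
    (hd : a + b + 1 + j = d) :
    ((m : ℂ) + 2 * a + 2 * b + 2 * n) * (m + a + b - 2) * diagMoment H z n a (b + 1) j =
      -2 * (b + 1 + n) * (m + 2 * b - 2) * diagMoment H z n a b (j + 1) ∧
    ((m : ℂ) + 2 * a + 2 * b + 2 * n) * (m + a + b - 2) * diagMoment H z n (a + 1) b j =
      -2 * (a + 1 + n) * (m + 2 * a - 2) * diagMoment H z n a b (j + 1) := by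
  have hα : ∀ t s : RVec m, ∃ u : CVec m, ∀ j,
      evalReal t s (tauP m (MvPolynomial (Fin m) ℂ) j) = C (u j) := fun t s =>
    ⟨_, fun j => evalReal_tauP t s j⟩
  have hβ : ∀ t s : RVec m, ∃ u : CVec m, ∀ j,
      evalReal t s (sigP m (MvPolynomial (Fin m) ℂ) j) = C (u j) := fun t s =>
    ⟨_, fun j => evalReal_sigP t s j⟩
  have r1 := sphMoment_rec hm hH hL z isNullPair_tauP_sigP hα hβ (k := a + n) (l := b + 1 + n) hd
  have r2 := sphMoment_rec hm hH hL z isNullPair_tauP_sigP.symm hβ hα (k := b + n)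
    (l := a + 1 + n) (a := b) (b := a) (j := j) (by omega)
  simp only [sphMoment] at r2
  rw [pairMoment_symm _ _ _ (sigP m _), pairMoment_symm _ _ _ (sigP m _),
    pairMoment_symm _ _ _ (sigP m _)] at r2
  have i1 : b + 1 + n - 1 = b + n := by omega
  have i2 : a + 1 + n - 1 = a + n := by omega
  have i3 : a + n + 1 = a + 1 + n := by omega
  have i4 : b + n + 1 = b + 1 + n := by omega
  rw [i1, i3] at r1
  rw [i2, i4] at r2
  simp only [diagMoment, sphMoment] at r1 r2 ⊢
  push_cast at r1 r2
  constructor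
  · linear_combination ((m : ℂ) - 1 + (b + n) + b + a) * r1 - (b + 1 + n) * r2
  · linear_combination ((m : ℂ) - 1 + (a + n) + a + b) * r2 - (a + 1 + n) * r1

end MomentValue

/-- The constant relating `diagMoment` to the average of `⟨z, ω⟩ ^ d H(ω)`. -/
def diagConst (m n a b : ℕ) : ℝ :=
  (-1) ^ (a + b + n) * 2 ^ (a + b) * Real.Gamma ((m : ℝ) - 1) * Real.Gamma ((m : ℝ) / 2 + a - 1) *
    Real.Gamma ((m : ℝ) / 2 + b - 1) * ((m : ℝ) - 2) * (a + n).factorial * (b + n).factorial /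
    (4 * n.factorial * Real.Gamma ((m : ℝ) / 2 + a + b + n) * Real.Gamma ((m : ℝ) + a + b - 2) *
      Real.Gamma ((m : ℝ) / 2))

theorem diagConst_comm (m n a b : ℕ) : diagConst m n a b = diagConst m n b a := by
  unfold diagConst
  rw [add_comm a b, add_right_comm ((m : ℝ) / 2) (a : ℝ) b, add_right_comm (m : ℝ) (a : ℝ) b]
  ring

theorem diagConst_zero {m : ℕ} (hm : 3 ≤ m) : diagConst m 0 0 0 = 1 := by
  have hm' : (3 : ℝ) ≤ m := by exact_mod_cast hm
  have h1 : Real.Gamma ((m : ℝ) - 1) = ((m : ℝ) - 2) * Real.Gamma ((m : ℝ) - 2) := by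
    rw [← Real.Gamma_add_one (by linarith)]; congr 1; ring
  have h2 : Real.Gamma ((m : ℝ) / 2) = ((m : ℝ) / 2 - 1) * Real.Gamma ((m : ℝ) / 2 - 1) := by
    rw [← Real.Gamma_add_one (by linarith)]; congr 1; ring
  have p1 := (Real.Gamma_pos_of_pos (show (0 : ℝ) < (m : ℝ) - 2 by linarith)).ne'
  have p2 := (Real.Gamma_pos_of_pos (show (0 : ℝ) < (m : ℝ) / 2 - 1 by linarith)).ne'
  have p3 : (m : ℝ) - 2 ≠ 0 := by linarith
  unfold diagConst
  simp only [Nat.cast_zero, add_zero, pow_zero, Nat.factorial_zero, Nat.cast_one, mul_one, one_mul]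
  rw [h1, h2]
  generalize Real.Gamma ((m : ℝ) / 2 - 1) = G at *
  rw [show (m : ℝ) / 2 - 1 = ((m : ℝ) - 2) / 2 by ring]
  field_simp
  norm_num

/-- Together with `diagConst_zero` and `diagConst_succ_right`, this makes `diagConst` the solution
of the moment recurrences. -/
theorem diagConst_succ_fst {m : ℕ} (hm : 3 ≤ m) (n : ℕ) :
    ((m : ℝ) + 2 * n) * diagConst m (n + 1) 0 0 = -2 * (n + 1) * diagConst m n 0 0 := by
  have hm' : (3 : ℝ) ≤ m := by exact_mod_cast hm
  have hx : (0 : ℝ) < (m : ℝ) / 2 + n := by positivity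
  have hy : (m : ℝ) + 2 * n ≠ 0 := by positivity
  have p1 := (Real.Gamma_pos_of_pos hx).ne'
  have p2 := (Real.Gamma_pos_of_pos (show (0 : ℝ) < (m : ℝ) - 2 by linarith)).ne'
  have p3 := (Real.Gamma_pos_of_pos (show (0 : ℝ) < (m : ℝ) / 2 by linarith)).ne'
  have hf : ((n.factorial : ℕ) : ℝ) ≠ 0 := by exact_mod_cast n.factorial_ne_zero
  have hn1 : ((n : ℝ) + 1) ≠ 0 := by positivity
  unfold diagConst
  simp only [Nat.cast_zero, add_zero, zero_add, pow_zero]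
  rw [show (m : ℝ) / 2 + (n + 1 : ℕ) = (m : ℝ) / 2 + n + 1 by push_cast; ring,
    Real.Gamma_add_one hx.ne', Nat.factorial_succ]
  generalize Real.Gamma ((m : ℝ) / 2 + n) = G at *
  rw [show (m : ℝ) / 2 + n = ((m : ℝ) + 2 * n) / 2 by ring]
  push_cast
  field_simp
  ring

theorem diagConst_succ_right {m : ℕ} (hm : 3 ≤ m) (n a b : ℕ) :
    ((m : ℝ) + 2 * a + 2 * b + 2 * n) * (m + a + b - 2) * diagConst m n a (b + 1) =
      -2 * (b + 1 + n) * (m + 2 * b - 2) * diagConst m n a b := by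
  have hm' : (3 : ℝ) ≤ m := by exact_mod_cast hm
  have ha0 : (0 : ℝ) ≤ a := a.cast_nonneg
  have hb0 : (0 : ℝ) ≤ b := b.cast_nonneg
  have hx : (0 : ℝ) < (m : ℝ) / 2 + a + b + n := by positivity
  have hz : (0 : ℝ) < (m : ℝ) + a + b - 2 := by linarith
  have hw : (0 : ℝ) < (m : ℝ) / 2 + b - 1 := by linarith
  have hy : (m : ℝ) + 2 * a + 2 * b + 2 * n ≠ 0 := by positivity
  have p1 := (Real.Gamma_pos_of_pos hx).ne'
  have p2 := (Real.Gamma_pos_of_pos hz).ne'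
  have p3 := (Real.Gamma_pos_of_pos (show (0 : ℝ) < (m : ℝ) / 2 by linarith)).ne'
  have hf : ((n.factorial : ℕ) : ℝ) ≠ 0 := by exact_mod_cast n.factorial_ne_zero
  unfold diagConst
  rw [show (m : ℝ) / 2 + a + (b + 1 : ℕ) + n = (m : ℝ) / 2 + a + b + n + 1 by push_cast; ring,
    Real.Gamma_add_one hx.ne',
    show (m : ℝ) + a + (b + 1 : ℕ) - 2 = (m : ℝ) + a + b - 2 + 1 by push_cast; ring,
    Real.Gamma_add_one hz.ne',
    show (m : ℝ) / 2 + (b + 1 : ℕ) - 1 = (m : ℝ) / 2 + b - 1 + 1 by push_cast; ring,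
    Real.Gamma_add_one hw.ne', show b + 1 + n = (b + n) + 1 by ring, Nat.factorial_succ]
  generalize Real.Gamma ((m : ℝ) / 2 + a + b + n) = G at *
  generalize Real.Gamma ((m : ℝ) / 2 + b - 1) = G' at *
  generalize Real.Gamma ((m : ℝ) + a + b - 2) = G'' at *
  rw [show (m : ℝ) / 2 + a + b + n = ((m : ℝ) + 2 * a + 2 * b + 2 * n) / 2 by ring]
  have hz' := hz.ne'
  push_cast
  field_simp
  ring

/-- The three factors come, in order, from `sphAvgFull_null_reduce`, `diagMoment_eq` and
`sphAvgFull_lin_pow`. -/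
theorem theta_add {m : ℕ} (hm : 3 ≤ m) (n a b : ℕ) :
    theta m n (a + n) (b + n) =
      ((-1) ^ n * (a + n).factorial * (b + n).factorial * Real.Gamma ((m : ℝ) / 2 + a + b) /
        (a.factorial * b.factorial * n.factorial * Real.Gamma ((m : ℝ) / 2 + a + b + n))) *
      diagConst m n a b * ((a + b).factorial * Real.Gamma ((m : ℝ) / 2) /
        (2 ^ (a + b) * Real.Gamma ((m : ℝ) / 2 + (a + b : ℕ)))) := by
  have hm' : (3 : ℝ) ≤ m := by exact_mod_cast hm
  have ha0 : (0 : ℝ) ≤ a := a.cast_nonneg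
  have hb0 : (0 : ℝ) ≤ b := b.cast_nonneg
  have p1 := (Real.Gamma_pos_of_pos (show (0 : ℝ) < (m : ℝ) / 2 + a + b + n by positivity)).ne'
  have p2 := (Real.Gamma_pos_of_pos (show (0 : ℝ) < (m : ℝ) + a + b - 2 by linarith)).ne'
  have p3 := (Real.Gamma_pos_of_pos (show (0 : ℝ) < (m : ℝ) / 2 by linarith)).ne'
  have p4 := (Real.Gamma_pos_of_pos (show (0 : ℝ) < (m : ℝ) / 2 + a + b by positivity)).ne'
  have f1 : ((n.factorial : ℕ) : ℝ) ≠ 0 := by exact_mod_cast n.factorial_ne_zero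
  have f2 : ((a.factorial : ℕ) : ℝ) ≠ 0 := by exact_mod_cast a.factorial_ne_zero
  have f3 : ((b.factorial : ℕ) : ℝ) ≠ 0 := by exact_mod_cast b.factorial_ne_zero
  have hle : n ≤ min (a + n) (b + n) := by simp
  unfold theta diagConst
  rw [if_pos hle, show a + n + (b + n) - 2 * n = a + b by omega, Nat.add_sub_cancel,
    Nat.add_sub_cancel,
    show (m : ℝ) / 2 + (a + n : ℕ) - n - 1 = (m : ℝ) / 2 + a - 1 by push_cast; ring,
    show (m : ℝ) / 2 + (b + n : ℕ) - n - 1 = (m : ℝ) / 2 + b - 1 by push_cast; ring,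
    show (m : ℝ) / 2 + (a + n : ℕ) + (b + n : ℕ) - n = (m : ℝ) / 2 + a + b + n by push_cast; ring,
    show (m : ℝ) + (a + n : ℕ) + (b + n : ℕ) - 2 * n - 2 = (m : ℝ) + a + b - 2 by push_cast; ring,
    show (m : ℝ) / 2 + (a + b : ℕ) = (m : ℝ) / 2 + a + b by push_cast; ring]
  have hs : (-1 : ℝ) ^ (a + n + (b + n)) = (-1) ^ n * (-1) ^ (a + b + n) := by
    rw [← pow_add]; congr 1; ring
  rw [hs]
  field_simp

/-! ### Evaluation of the moments and the appearance of `θ` -/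

section MomentEq

open MvPolynomial

variable {m : ℕ}

theorem pairFun_C (hm : 3 ≤ m) {R : Type*} [CommRing R] [Algebra ℂ R] (Λ : R →ₗ[ℂ] ℂ) (c : R) :
    pairFun Λ (C c : PairPoly m R) = Λ c := by
  rw [pairFun, show (C c : PairPoly m R) = monomial 0 c from rfl, mapCoeff_monomial,
    show monomial 0 (Λ c) = (C (Λ c) : PairPoly m ℂ) from rfl, pairAvg_C hm]

theorem pairMoment_smul (hm : 3 ≤ m) {R : Type*} [CommRing R] [Algebra ℂ R] (Λ : R →ₗ[ℂ] ℂ)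
    (z w : Fin m → R) (α β : Fin m → PairPoly m R) (k l a b : ℕ) (x : ℂ) (c : R) :
    pairMoment Λ z w α β k l a b (x • c) = x * pairMoment Λ z w α β k l a b c := by
  rw [pairMoment, pairMoment, ← pairFun_smul hm]
  congr 1
  rw [← algebraMap_smul R x c, smul_eq_mul, map_mul, ← algebraMap_smul R x, smul_eq_C_mul]
  ring

/-- With no factor in `w` left, the powers of `⟨z,α⟩⟨z,β⟩` may be read as powers in the second
vector with `w = z`, which opens them to `pairMoment_rec`. -/
theorem pairMoment_diag {R : Type*} [CommRing R] [Algebra ℂ R] (Λ : R →ₗ[ℂ] ℂ)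
    (z w : Fin m → R) (α β : Fin m → PairPoly m R) (n : ℕ) (c : R) :
    pairMoment Λ z w α β n n 0 0 c = pairMoment Λ z z α β 0 0 n n c := by
  rw [pairMoment, pairMoment]
  congr 1
  ring

theorem diagMoment_zero_zero (hm : 3 ≤ m) (H : MvPolynomial (Fin m) ℂ) (z : CVec m) (n d : ℕ) :
    diagMoment H z n 0 0 d =
      (diagConst m n 0 0 : ℂ) * bil z z ^ n * sphAvgFull m (lin z ^ d * H) := by
  rw [diagMoment, sphMoment, zero_add, pairMoment_diag]
  induction n with
  | zero =>
    simp only [pairMoment, pow_zero, one_mul, mul_one, pairFun_C hm, diagConst_zero hm,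
      sphereFun_apply, Complex.ofReal_one]
  | succ n ih =>
    -- With `w = z` and `k = l = 0`, only the term in `⟨w,w⟩ = ⟨z,z⟩` remains besides the leading
    -- one, which gives a two-term recurrence in `n`.
    have hr := pairMoment_rec hm (sphereFun H) (fun i => C (z i)) (fun i => C (z i))
      isNullPair_tauP_sigP 0 0 (n + 1) n (lin z ^ d)
    have e : (∑ i, C (z i) * C (z i) : MvPolynomial (Fin m) ℂ) = C (bil z z) := by
      simp only [bil, map_sum, map_mul]
    rw [e, Nat.add_sub_cancel, ← smul_eq_C_mul, pairMoment_smul hm, pairMoment_smul hm, ih] at hr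
    have hne : (m : ℂ) + 2 * n ≠ 0 := by
      have : (m : ℂ) + 2 * n = ((m + 2 * n : ℕ) : ℂ) := by push_cast; ring
      rw [this]; exact_mod_cast (by omega)
    refine mul_left_cancel₀ hne ?_
    have hc := congrArg (fun x : ℝ => (x : ℂ)) (diagConst_succ_fst hm n)
    push_cast at hc hr
    generalize pairMoment (sphereFun H) _ _ _ _ _ _ _ _ _ = Y at hr ⊢
    linear_combination hr - bil z z ^ (n + 1) * sphAvgFull m (lin z ^ d * H) * hc

/-- Each recurrence step removes a factor `⟨w,τ⟩` or `⟨w,τ†⟩` and adds a factor `⟨z,w⟩`. The degree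
`d` in `w` is kept, and at `a = b = 0` only `⟨z,w⟩^d` is left. -/
theorem diagMoment_eq (hm : 3 ≤ m) {d : ℕ} {H : MvPolynomial (Fin m) ℂ}
    (hH : H.IsHomogeneous d) (hL : lap H = 0) (z : CVec m) (n : ℕ) {a b j : ℕ}
    (hd : a + b + j = d) :
    diagMoment H z n a b j =
      (diagConst m n a b : ℂ) * bil z z ^ n * sphAvgFull m (lin z ^ d * H) := by
  have hne : ∀ a b : ℕ, ((m : ℂ) + 2 * a + 2 * b + 2 * n) * (m + a + b - 2) ≠ 0 := by
    intro a b
    have : ((m : ℂ) + 2 * a + 2 * b + 2 * n) * (m + a + b - 2) =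
        (((m + 2 * a + 2 * b + 2 * n) * (m - 2 + a + b) : ℕ) : ℂ) := by
      push_cast [Nat.cast_sub (show 2 ≤ m by omega)]; ring
    rw [this]; exact_mod_cast (Nat.mul_pos (by omega) (by omega)).ne'
  induction b generalizing j with
  | succ b ihb =>
    refine mul_left_cancel₀ (hne a b) ?_
    rw [(diagMoment_rec hm hH hL z n (a := a) (b := b) (j := j) (by omega)).1,
      ihb (j := j + 1) (by omega)]
    have hc := congrArg (fun x : ℝ => (x : ℂ)) (diagConst_succ_right hm n a b)
    push_cast at hc
    linear_combination -bil z z ^ n * sphAvgFull m (lin z ^ d * H) * hc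
  | zero =>
    induction a generalizing j with
    | succ a iha =>
      refine mul_left_cancel₀ (hne a 0) ?_
      rw [(diagMoment_rec hm hH hL z n (a := a) (b := 0) (j := j) (by omega)).2,
        iha (j := j + 1) (by omega)]
      have hc := congrArg (fun x : ℝ => (x : ℂ)) (diagConst_succ_right hm n 0 a)
      rw [diagConst_comm m n 0 (a + 1), diagConst_comm m n 0 a] at hc
      push_cast at hc ⊢
      linear_combination -bil z z ^ n * sphAvgFull m (lin z ^ d * H) * hc
    | zero =>
      have : j = d := by omega
      rw [this]
      exact diagMoment_zero_zero hm H z n d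

/-- The polynomial `⟨z,τ⟩^k ⟨z,σ⟩^l ⟨w,σ⟩^k ⟨w,τ⟩^l` in the vectors `t`, `s`. -/
def kernelPoly (z : CVec m) (k l : ℕ) : PairPoly m (MvPolynomial (Fin m) ℂ) :=
  dotP (fun i => C (z i)) (tauP m _) ^ k * dotP (fun i => C (z i)) (sigP m _) ^ l *
    dotP X (sigP m _) ^ k * dotP X (tauP m _) ^ l

theorem evalReal_kernel (z : CVec m) (t s : RVec m) (k l a b : ℕ) :
    evalReal t s (dotP (fun i => C (z i)) (tauP m _) ^ k *
      dotP (fun i => C (z i)) (sigP m _) ^ l *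
      dotP X (sigP m (MvPolynomial (Fin m) ℂ)) ^ a * dotP X (tauP m _) ^ b) =
      C (bil z (tauVec t s) ^ k * bil z (dagger (tauVec t s)) ^ l) *
        (lin (dagger (tauVec t s)) ^ a * lin (tauVec t s) ^ b) := by
  rw [map_mul, map_mul, map_mul, map_pow, map_pow, map_pow, map_pow, evalReal_dotP_tauP,
    evalReal_dotP_sigP, evalReal_dotP_tauP, evalReal_dotP_sigP, sum_C_mul_C, sum_C_mul_C,
    sum_X_mul_C, sum_X_mul_C, map_mul, map_pow, map_pow]
  ring

theorem pairFun_kernelPoly (hm : 3 ≤ m) {d k l n : ℕ} {H : MvPolynomial (Fin m) ℂ}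
    (hH : H.IsHomogeneous d) (hL : lap H = 0) (z : CVec m) (hkl : k + l = d + 2 * n) :
    pairFun (sphereFun H) (kernelPoly z k l) = (theta m n k l : ℂ) * bil z z ^ n * eval z H := by
  by_cases hn : n ≤ min k l
  · obtain ⟨a, rfl⟩ : ∃ a, k = a + n := ⟨k - n, by omega⟩
    obtain ⟨b, rfl⟩ : ∃ b, l = b + n := ⟨l - n, by omega⟩
    have hd : d = a + b := by omega
    subst hd
    set r : ℂ := (((-1) ^ n * (a + n).factorial * (b + n).factorial *
      Real.Gamma ((m : ℝ) / 2 + a + b) / (a.factorial * b.factorial * n.factorial *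
        Real.Gamma ((m : ℝ) / 2 + a + b + n)) : ℝ) : ℂ) with hr
    -- The exponents in `w` are lowered for each fixed pair `(t,s)`; only afterwards is the average
    -- over pairs evaluated.
    have h1 : pairFun (sphereFun H) (kernelPoly z (a + n) (b + n)) =
        r * diagMoment H z n a b 0 := by
      rw [diagMoment, sphMoment, pairMoment, ← pairFun_smul hm]
      refine pairFun_congr fun t s hts => ?_
      obtain ⟨b1, b2, b3⟩ := bil_tauVec hts
      have b3' : bil (dagger (tauVec t s)) (tauVec t s) = -2 := by
        rw [← b3]; exact Finset.sum_congr rfl fun j _ => mul_comm _ _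
      have hC1 : (C (lin z ^ 0) : PairPoly m (MvPolynomial (Fin m) ℂ)) = 1 := by
        rw [pow_zero, C_1]
      have hsm : ∀ W : PairPoly m (MvPolynomial (Fin m) ℂ),
          evalReal t s (r • W) = r • evalReal t s W := by
        intro W
        rw [← algebraMap_smul (MvPolynomial (Fin m) ℂ) r, smul_eq_C_mul, map_mul, eval_C,
          Algebra.smul_def]
      rw [hsm, map_smul, hC1, mul_one, kernelPoly, evalReal_kernel, evalReal_kernel,
        sphereFun_apply, sphereFun_apply, mul_assoc, mul_assoc (C _), ← smul_eq_C_mul, map_smul,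
        ← smul_eq_C_mul, map_smul, sphAvgFull_null_reduce hm b2 b1 b3' a b n hH hL, ← hr]
      simp only [smul_eq_mul]
      ring
    rw [h1, diagMoment_eq hm hH hL z n (by omega), sphAvgFull_lin_pow hm z hH hL, theta_add hm, hr]
    push_cast
    ring
  · have hth : theta m n k l = 0 := by rw [theta, if_neg hn]
    rw [hth]
    simp only [Complex.ofReal_zero, zero_mul]
    refine pairFun_eq_zero hm fun t s hts => ?_
    obtain ⟨b1, b2, b3⟩ := bil_tauVec hts
    have b3' : bil (dagger (tauVec t s)) (tauVec t s) = -2 := by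
      rw [← b3]; exact Finset.sum_congr rfl fun j _ => mul_comm _ _
    rw [kernelPoly, evalReal_kernel, sphereFun_apply, mul_assoc, ← smul_eq_C_mul, map_smul,
      sphAvgFull_null_eq_zero hm b2 b1 b3' hH hL hkl (by omega), smul_zero]

end MomentEq

/-! ### Products of generators in the Clifford algebra -/

section CliffordRelations

variable {m : ℕ}

theorem vec_eq_sum (v : CVec m) : vec v = ∑ j, v j • (gen j : Cl m) := by
  simp only [vec, gen, ← map_smul, ← map_sum]
  congr 1
  ext i
  simp [Finset.sum_apply, Pi.single_apply]

theorem cliffordForm_apply (v : CVec m) : cliffordForm m v = -bil v v := by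
  simp [cliffordForm, bil, QuadraticMap.weightedSumSquares_apply]

theorem vec_mul_self (v : CVec m) : vec v * vec v = algebraMap ℂ (Cl m) (-bil v v) := by
  rw [vec, CliffordAlgebra.ι_sq_scalar, cliffordForm_apply]

theorem gen_mul_gen_add_swap (a b : Fin m) :
    (gen a * gen b + gen b * gen a : Cl m) = algebraMap ℂ (Cl m) (if a = b then -2 else 0) := by
  rw [gen, gen, vec, vec, CliffordAlgebra.ι_mul_ι_add_swap, QuadraticMap.polar,
    cliffordForm_apply, cliffordForm_apply, cliffordForm_apply]
  congr 1
  simp only [bil, Pi.add_apply, add_mul, mul_add, Finset.sum_add_distrib]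
  simp only [Pi.single_apply, mul_ite, mul_one, mul_zero, Finset.sum_ite_eq', Finset.mem_univ,
    if_true]
  by_cases h : a = b
  · subst h; simp; norm_num
  · simp [h, Ne.symm h]

theorem vec_mul_vec (u v : CVec m) :
    vec u * vec v = ∑ a, ∑ b, (u a * v b) • (gen a * gen b : Cl m) := by
  rw [vec_eq_sum, vec_eq_sum, Finset.sum_mul_sum]
  simp only [smul_mul_smul_comm]

/-- Symmetric coefficients see only the trace of `e_a e_b`. -/
theorem sum_symm_smul_gen_mul_gen (J : Fin m → Fin m → ℂ) (hJ : ∀ a b, J a b = J b a) :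
    ∑ a, ∑ b, J a b • (gen a * gen b : Cl m) = algebraMap ℂ (Cl m) (-∑ a, J a a) := by
  have h2 : (2 : ℂ) • ∑ a, ∑ b, J a b • (gen a * gen b : Cl m) =
      (2 : ℂ) • algebraMap ℂ (Cl m) (-∑ a, J a a) := by
    have hs : ∑ a, ∑ b, J a b • (gen a * gen b : Cl m) =
        ∑ a, ∑ b, J a b • (gen b * gen a : Cl m) := by
      rw [Finset.sum_comm]
      exact Finset.sum_congr rfl fun a _ => Finset.sum_congr rfl fun b _ => by rw [hJ b a]
    rw [two_smul]
    nth_rewrite 2 [hs]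
    simp only [← Finset.sum_add_distrib, ← smul_add, gen_mul_gen_add_swap]
    simp only [apply_ite (algebraMap ℂ (Cl m)), map_zero, smul_ite, smul_zero,
      Finset.sum_ite_eq, Finset.mem_univ, if_true]
    rw [← Finset.sum_smul, Algebra.smul_def, Algebra.smul_def, ← map_mul, ← map_mul]
    congr 1
    ring
  exact smul_right_injective _ (two_ne_zero' ℂ) h2

end CliffordRelations

/-! ### The term with `τ†τ` -/

section SymmetrizedTerm

open MvPolynomial

variable {m : ℕ} {R : Type*} [CommRing R] [Algebra ℂ R]

theorem pairAvg_eq_zero_of_odd {p : PairPoly m ℂ} (hp : ∀ t s : RVec m, Orthonormal2 t s →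
    evalPair (toCVec t) (toCVec (-s)) p = -evalPair (toCVec t) (toCVec s) p) :
    pairAvg m p = 0 := by
  have h : ∀ t : Metric.sphere (0 : RVec m) 1,
      perpAvg (t : RVec m) (fixFst (toCVec (t : RVec m)) p) = 0 := by
    intro t
    rw [sphAvg_apply, integral_sphere_odd_eq_zero, mul_zero]
    intro s
    rw [eval_fixFst, eval_fixFst]
    exact hp t _ ⟨by simp, norm_eq_of_mem_sphere s, (Submodule.mem_orthogonal_singleton_iff_inner_right).1 s.1.2⟩
  simp only [pairAvg, h, integral_zero, mul_zero]

theorem pairFun_eq_zero_of_odd {Λ : R →ₗ[ℂ] ℂ} {W : PairPoly m R}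
    (h : ∀ t s : RVec m, Orthonormal2 t s → evalReal t (-s) W = -evalReal t s W) :
    pairFun Λ W = 0 :=
  pairAvg_eq_zero_of_odd fun t s hts => by
    rw [evalPair_mapCoeff, evalPair_mapCoeff, h t s hts, map_neg]

theorem tauVec_neg_right (t s : RVec m) (j : Fin m) :
    tauVec t (-s) j = -dagger (tauVec t s) j := by
  rw [dagger_tauVec]; simp [tauVec, toCVec]; ring

theorem dagger_tauVec_neg_right (t s : RVec m) (j : Fin m) :
    dagger (tauVec t (-s)) j = -tauVec t s j := by
  rw [dagger_tauVec]; simp [tauVec, toCVec, add_comm]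

/-- The Clifford coefficient of the product `τ† τ` times a polynomial. -/
def cliffordCoeff (W : PairPoly m R) (a b : Fin m) : PairPoly m R :=
  sigP m R a * tauP m R b * W

theorem evalReal_cliffordCoeff (W : PairPoly m R) (a b : Fin m) (t s : RVec m) :
    evalReal t s (cliffordCoeff W a b) =
      (dagger (tauVec t s) a * tauVec t s b) • evalReal t s W := by
  rw [cliffordCoeff, map_mul, map_mul, evalReal_sigP, evalReal_tauP, ← map_mul, Algebra.smul_def]

/-- Changing `s` to `-s` turns `τ†_a τ_b` into `τ_a τ†_b`, so the difference of the two coefficients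
is odd in `s` when `W` is even. -/
theorem pairFun_cliffordCoeff_comm (hm : 3 ≤ m) (Λ : R →ₗ[ℂ] ℂ) {W : PairPoly m R}
    (hW : ∀ t s : RVec m, Orthonormal2 t s → evalReal t (-s) W = evalReal t s W)
    (a b : Fin m) :
    pairFun Λ (cliffordCoeff W a b) = pairFun Λ (cliffordCoeff W b a) := by
  have h : pairFun Λ (cliffordCoeff W a b + (-1 : ℂ) • cliffordCoeff W b a) = 0 := by
    refine pairFun_eq_zero_of_odd fun t s hts => ?_
    rw [neg_one_smul, map_add, map_add, map_neg, map_neg, evalReal_cliffordCoeff,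
      evalReal_cliffordCoeff, evalReal_cliffordCoeff, evalReal_cliffordCoeff, hW t s hts,
      dagger_tauVec_neg_right, dagger_tauVec_neg_right, tauVec_neg_right, tauVec_neg_right,
      ← neg_smul, ← neg_smul, ← add_smul, ← add_smul, ← neg_smul]
    congr 1
    ring
  rw [pairFun_add hm, pairFun_smul hm] at h
  linear_combination h

/-- By symmetry only minus the trace of the coefficients remains, and `⟨τ†,τ⟩ = -2`: under the
average `τ†τ` may be replaced by 2. -/
theorem sum_pairFun_cliffordCoeff (hm : 3 ≤ m) (Λ : R →ₗ[ℂ] ℂ) {W : PairPoly m R}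
    (hW : ∀ t s : RVec m, Orthonormal2 t s → evalReal t (-s) W = evalReal t s W) :
    ∑ a, ∑ b, pairFun Λ (cliffordCoeff W a b) • (gen a * gen b : Cl m) =
      algebraMap ℂ (Cl m) (2 * pairFun Λ W) := by
  rw [sum_symm_smul_gen_mul_gen _ (pairFun_cliffordCoeff_comm hm Λ hW)]
  congr 1
  rw [← pairFun_sum hm, ← pairFun_smul hm, ← neg_one_mul, ← pairFun_smul hm]
  refine pairFun_congr fun t s hts => ?_
  congr 1
  rw [neg_one_smul, map_neg, map_sum]
  simp only [evalReal_cliffordCoeff]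
  have h := (bil_tauVec hts).2.2
  have h' : ∑ a, dagger (tauVec t s) a * tauVec t s a = -2 := by
    rw [← h]; exact Finset.sum_congr rfl fun j _ => mul_comm _ _
  rw [← Finset.sum_smul, h', two_smul, map_add, neg_smul, two_smul, neg_neg]

theorem evalReal_kernelPoly (z : CVec m) (t s : RVec m) (k l : ℕ) :
    evalReal t s (kernelPoly z k l) =
      C (bil z (tauVec t s) ^ k * bil z (dagger (tauVec t s)) ^ l) *
        (lin (dagger (tauVec t s)) ^ k * lin (tauVec t s) ^ l) :=
  evalReal_kernel z t s k l k l

theorem evalReal_kernelPoly_neg (z : CVec m) (t s : RVec m) (l : ℕ) :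
    evalReal t (-s) (kernelPoly z l l) = evalReal t s (kernelPoly z l l) := by
  have h1 : bil z (tauVec t (-s)) = -bil z (dagger (tauVec t s)) := by
    simp [bil, tauVec_neg_right]
  have h2 : bil z (dagger (tauVec t (-s))) = -bil z (tauVec t s) := by
    simp [bil, dagger_tauVec_neg_right]
  have h3 : (lin (tauVec t (-s)) : MvPolynomial (Fin m) ℂ) = -lin (dagger (tauVec t s)) := by
    simp [lin, tauVec_neg_right]
  have h4 : (lin (dagger (tauVec t (-s))) : MvPolynomial (Fin m) ℂ) = -lin (tauVec t s) := by
    simp [lin, dagger_tauVec_neg_right]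
  rw [evalReal_kernelPoly, evalReal_kernelPoly, h1, h2, h3, h4, ← mul_pow, ← mul_pow, ← mul_pow,
    ← mul_pow, neg_mul_neg, neg_mul_neg, mul_comm (bil z _), mul_comm (lin (tauVec t s))]

end SymmetrizedTerm

/-! ### Harmonicity of `z M` for monogenic `M` -/

section MonogenicCoordinates

open MvPolynomial

variable {m : ℕ}

/-- The coordinate polynomial with index `A` of a Clifford valued polynomial. -/
def coordPoly (A : Finset (Fin m)) : CliffordPoly m →ₗ[ℂ] MvPolynomial (Fin m) ℂ :=
  (TensorProduct.rid ℂ (MvPolynomial (Fin m) ℂ)).toLinearMap ∘ₗ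
    TensorProduct.map LinearMap.id ((cliffordBasis m).coord A)

theorem coordPoly_tmul (A : Finset (Fin m)) (P : MvPolynomial (Fin m) ℂ) (α : Cl m) :
    coordPoly A (P ⊗ₜ α) = (cliffordBasis m).repr α A • P := by
  simp [coordPoly]

theorem evalPoly_tmul (z : CVec m) (P : MvPolynomial (Fin m) ℂ) (α : Cl m) :
    evalPoly z (P ⊗ₜ α) = eval z P • α := by
  simp [evalPoly]

theorem eval_coordPoly (A : Finset (Fin m)) (z : CVec m) (N : CliffordPoly m) :
    eval z (coordPoly A N) = (cliffordBasis m).repr (evalPoly z N) A := by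
  induction N using TensorProduct.induction_on with
  | zero => simp
  | add x y hx hy => simp only [map_add, hx, hy, Finsupp.add_apply]
  | tmul P α =>
    rw [coordPoly_tmul, evalPoly_tmul, smul_eval, map_smul, Finsupp.smul_apply, smul_eq_mul,
      mul_comm]

/-- Left multiplication of a Clifford valued polynomial by the vector variable. -/
def mulVar (m : ℕ) : CliffordPoly m →ₗ[ℂ] CliffordPoly m :=
  ∑ j : Fin m, TensorProduct.map (LinearMap.mulLeft ℂ (X j)) (LinearMap.mulLeft ℂ (gen j))

theorem mulVar_tmul (P : MvPolynomial (Fin m) ℂ) (α : Cl m) :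
    mulVar m (P ⊗ₜ α) = ∑ j, (X j * P) ⊗ₜ (gen j * α) := by
  simp [mulVar, LinearMap.sum_apply]

theorem diracOp_tmul (P : MvPolynomial (Fin m) ℂ) (α : Cl m) :
    diracOp m (P ⊗ₜ α) = ∑ j, pderiv j P ⊗ₜ (gen j * α) := by
  simp [diracOp, LinearMap.sum_apply]

theorem evalPoly_mulVar (z : CVec m) (N : CliffordPoly m) :
    evalPoly z (mulVar m N) = vec z * evalPoly z N := by
  induction N using TensorProduct.induction_on with
  | zero => simp
  | add x y hx hy => simp only [map_add, hx, hy, mul_add]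
  | tmul P α =>
    rw [mulVar_tmul, map_sum, evalPoly_tmul, vec_eq_sum, Finset.sum_mul]
    refine Finset.sum_congr rfl fun j _ => ?_
    rw [evalPoly_tmul, map_mul, eval_X, smul_mul_smul_comm]

theorem isHomogeneous_coordPoly_mulVar {k : ℕ} {N : CliffordPoly m} (hN : N ∈ homogeneousPoly m k)
    (A : Finset (Fin m)) : (coordPoly A (mulVar m N)).IsHomogeneous (1 + k) := by
  obtain ⟨y, rfl⟩ := hN
  induction y using TensorProduct.induction_on with
  | zero => simpa using isHomogeneous_zero _ _ _
  | add x y hx hy => simp only [map_add]; exact hx.add hy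
  | tmul P α =>
    rw [TensorProduct.map_tmul, mulVar_tmul, map_sum]
    refine IsHomogeneous.sum _ _ _ fun j _ => ?_
    rw [coordPoly_tmul, smul_eq_C_mul]
    exact ((isHomogeneous_X ℂ j).mul P.2).C_mul _

/-- The Laplace operator as a linear map. -/
def lapLin (m : ℕ) : MvPolynomial (Fin m) ℂ →ₗ[ℂ] MvPolynomial (Fin m) ℂ :=
  ∑ j : Fin m, (pderiv j).toLinearMap ∘ₗ (pderiv j).toLinearMap

theorem lapLin_apply (p : MvPolynomial (Fin m) ℂ) : lapLin m p = lap p := by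
  simp [lapLin, lap, LinearMap.sum_apply]

/-- The Laplace operator on Clifford valued polynomials. -/
def cliffordLap (m : ℕ) : CliffordPoly m →ₗ[ℂ] CliffordPoly m :=
  TensorProduct.map (lapLin m) LinearMap.id

theorem cliffordLap_tmul (P : MvPolynomial (Fin m) ℂ) (α : Cl m) :
    cliffordLap m (P ⊗ₜ α) = lap P ⊗ₜ α := by
  rw [cliffordLap, TensorProduct.map_tmul, lapLin_apply, LinearMap.id_apply]

theorem coordPoly_cliffordLap (A : Finset (Fin m)) (N : CliffordPoly m) :
    coordPoly A (cliffordLap m N) = lap (coordPoly A N) := by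
  rw [← lapLin_apply]
  induction N using TensorProduct.induction_on with
  | zero => simp
  | add x y hx hy => simp only [map_add, hx, hy]
  | tmul P α => rw [cliffordLap_tmul, coordPoly_tmul, coordPoly_tmul, map_smul, lapLin_apply]

/-- Partial derivatives commute, so symmetrizing the double sum leaves the anticommutators `e_j e_k
+ e_k e_j`, which equal `-2` on the diagonal and 0 off it. -/
theorem diracOp_diracOp (N : CliffordPoly m) : diracOp m (diracOp m N) = -cliffordLap m N := by
  induction N using TensorProduct.induction_on with
  | zero => simp
  | add x y hx hy => simp only [map_add, hx, hy, neg_add]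
  | tmul P α =>
    have h1 : diracOp m (diracOp m (P ⊗ₜ α)) =
        ∑ j, ∑ k, pderiv j (pderiv k P) ⊗ₜ[ℂ] (gen j * gen k * α) := by
      rw [diracOp_tmul, map_sum]
      simp only [diracOp_tmul]
      rw [Finset.sum_comm]
      simp only [mul_assoc]
    have h2 : diracOp m (diracOp m (P ⊗ₜ α)) =
        ∑ j, ∑ k, pderiv j (pderiv k P) ⊗ₜ[ℂ] (gen k * gen j * α) := by
      rw [h1, Finset.sum_comm]
      simp only [pderiv_comm]
    have h3 : (2 : ℂ) • diracOp m (diracOp m (P ⊗ₜ α)) = (2 : ℂ) • -cliffordLap m (P ⊗ₜ α) := by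
      rw [two_smul]
      nth_rewrite 1 [h1]
      rw [h2]
      simp only [← Finset.sum_add_distrib, ← TensorProduct.tmul_add, ← add_mul,
        gen_mul_gen_add_swap, ← Algebra.smul_def, ite_smul, zero_smul, TensorProduct.tmul_ite,
        Finset.sum_ite_eq, Finset.mem_univ, if_true]
      rw [cliffordLap_tmul, lap, TensorProduct.sum_tmul, smul_neg, ← neg_smul, Finset.smul_sum]
      simp only [TensorProduct.tmul_smul]
    exact smul_right_injective _ (two_ne_zero' ℂ) h3

theorem lap_X_mul (j : Fin m) (P : MvPolynomial (Fin m) ℂ) :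
    lap (X j * P) = (2 : ℂ) • pderiv j P + X j * lap P := by
  simp only [lap, Derivation.leibniz, smul_eq_mul, map_add, pderiv_X, Pi.single_apply]
  rw [Finset.mul_sum, two_smul]
  have : ∀ i, X j * pderiv i (pderiv i P) + pderiv i P * (if j = i then 1 else 0) +
      (P * pderiv i (if j = i then (1 : MvPolynomial (Fin m) ℂ) else 0) +
        (if j = i then 1 else 0) * pderiv i P) =
      ((if j = i then pderiv i P else 0) + (if j = i then pderiv i P else 0)) +
        X j * pderiv i (pderiv i P) := by
    intro i
    split_ifs <;> simp
    ring
  simp only [this, Finset.sum_add_distrib, Finset.sum_ite_eq, Finset.mem_univ, if_true]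

theorem cliffordLap_mulVar (N : CliffordPoly m) :
    cliffordLap m (mulVar m N) = (2 : ℂ) • diracOp m N + mulVar m (cliffordLap m N) := by
  induction N using TensorProduct.induction_on with
  | zero => simp
  | add x y hx hy => simp only [map_add, hx, hy, smul_add]; abel
  | tmul P α =>
    rw [mulVar_tmul, map_sum, cliffordLap_tmul, mulVar_tmul, diracOp_tmul, Finset.smul_sum,
      ← Finset.sum_add_distrib]
    refine Finset.sum_congr rfl fun j _ => ?_
    rw [cliffordLap_tmul, lap_X_mul, TensorProduct.add_tmul, TensorProduct.smul_tmul']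

theorem lap_coordPoly_mulVar {N : CliffordPoly m} (hN : diracOp m N = 0) (A : Finset (Fin m)) :
    lap (coordPoly A (mulVar m N)) = 0 := by
  have h : cliffordLap m N = 0 := by rw [← neg_neg (cliffordLap m N), ← diracOp_diracOp, hN]; simp
  rw [← coordPoly_cliffordLap, cliffordLap_mulVar, hN, h]
  simp

/-- One factor of the odd power makes `M` harmonic; the other `2n` contribute the scalar
`(-⟨z,z⟩)^n`. -/
theorem vec_pow_mul_evalPoly (z : CVec m) (n : ℕ) (N : CliffordPoly m) :
    vec z ^ (2 * n + 1) * evalPoly z N =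
      (-bil z z) ^ n • ∑ A, eval z (coordPoly A (mulVar m N)) • cliffordBasis m A := by
  rw [pow_succ, pow_mul, pow_two, vec_mul_self, ← map_pow, mul_assoc, ← evalPoly_mulVar,
    ← Algebra.smul_def]
  congr 1
  simp only [eval_coordPoly]
  exact ((cliffordBasis m).sum_repr _).symm

end MonogenicCoordinates

/-! ### The Lie ball and the size of `⟨z,τ⟩` -/

section LieNorm

variable {m : ℕ}

theorem Orthonormal2.inner_sq_add_inner_sq_le {t s : RVec m} (h : Orthonormal2 t s) (x : RVec m) :
    inner ℝ x t ^ 2 + inner ℝ x s ^ 2 ≤ ‖x‖ ^ 2 := by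
  obtain ⟨ht, hs, hts⟩ := h
  have h0 := sq_nonneg ‖x - inner ℝ x t • t - inner ℝ x s • s‖
  have ht' : inner ℝ t t = (1 : ℝ) := by rw [real_inner_self_eq_norm_sq, ht, one_pow]
  have hs' : inner ℝ s s = (1 : ℝ) := by rw [real_inner_self_eq_norm_sq, hs, one_pow]
  rw [← real_inner_self_eq_norm_sq] at h0 ⊢
  simp only [inner_sub_left, inner_sub_right, inner_smul_left, inner_smul_right, ht', hs', hts,
    real_inner_comm x t, real_inner_comm x s, real_inner_comm t s, conj_trivial] at h0
  nlinarith

theorem bil_tauVec_re_im (z : CVec m) (t s : RVec m) :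
    bil z (tauVec t s) = ((inner ℝ (reVec z) t - inner ℝ (imVec z) s : ℝ) : ℂ) +
      ((inner ℝ (imVec z) t + inner ℝ (reVec z) s : ℝ) : ℂ) * Complex.I := by
  have h : ∀ j, z j * tauVec t s j =
      (((reVec z j * t j - imVec z j * s j : ℝ)) : ℂ) +
        ((imVec z j * t j + reVec z j * s j : ℝ) : ℂ) * Complex.I := by
    intro j
    have hz : z j = (z j).re + (z j).im * Complex.I := (Complex.re_add_im _).symm
    conv_lhs => rw [hz]
    simp only [tauVec, toCVec, Pi.add_apply, Pi.smul_apply, smul_eq_mul, reVec, imVec]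
    push_cast
    linear_combination ((z j).im * s j : ℂ) * Complex.I_mul_I
  have hi : ∀ u v : RVec m, inner ℝ u v = ∑ j, u j * v j := by
    intro u v
    rw [PiLp.inner_apply]
    exact Finset.sum_congr rfl fun j _ => by simp [mul_comm]
  simp only [bil, h, Finset.sum_add_distrib, ← Finset.sum_mul, hi, ← Complex.ofReal_sum,
    Finset.sum_sub_distrib]

theorem norm_sq_bil_tauVec (z : CVec m) (t s : RVec m) :
    ‖bil z (tauVec t s)‖ ^ 2 = (inner ℝ (reVec z) t - inner ℝ (imVec z) s) ^ 2 +
      (inner ℝ (imVec z) t + inner ℝ (reVec z) s) ^ 2 := by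
  rw [bil_tauVec_re_im, ← Complex.normSq_eq_norm_sq, Complex.normSq_add_mul_I]

theorem dagger_tauVec_eq (t s : RVec m) : dagger (tauVec t s) = tauVec (-t) s := by
  ext j
  rw [dagger_tauVec]
  simp [tauVec, toCVec]

theorem Orthonormal2.neg_left {t s : RVec m} (h : Orthonormal2 t s) : Orthonormal2 (-t) s :=
  ⟨by rw [norm_neg, h.1], h.2.1, by rw [inner_neg_left, h.2.2, neg_zero]⟩

theorem exists_orthogonal_unit (hm : 3 ≤ m) (y : RVec m) :
    ∃ e : RVec m, ‖e‖ = 1 ∧ inner ℝ e y = 0 := by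
  have h : 0 < Module.finrank ℝ (orthHyperplane y) := by
    have h1 := (Submodule.span ℝ {y}).finrank_add_finrank_orthogonal
    rw [finrank_euclideanSpace_fin] at h1
    have h2 : Module.finrank ℝ (Submodule.span ℝ {y}) ≤ 1 := by
      simpa using finrank_span_le_card (R := ℝ) ({y} : Set (RVec m))
    change 0 < Module.finrank ℝ ↥(Submodule.span ℝ {y})ᗮ
    omega
  have := Module.nontrivial_of_finrank_pos h
  obtain ⟨e, he⟩ := exists_norm_eq (orthHyperplane y) zero_le_one
  exact ⟨e, he, (Submodule.mem_orthogonal_singleton_iff_inner_left).1 e.2⟩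

/-- `d • e` is the component of `x` orthogonal to `y`; if it vanishes, any unit vector orthogonal to
`y` serves. For `y = 0` the quotient `c` is 0. -/
theorem exists_orthogonal_decomposition (hm : 3 ≤ m) (x y : RVec m) :
    ∃ (e : RVec m) (c d : ℝ), ‖e‖ = 1 ∧ inner ℝ e y = 0 ∧ 0 ≤ d ∧ x = c • y + d • e := by
  set c : ℝ := inner ℝ x y / inner ℝ y y with hc
  set p := x - c • y with hp
  have hpy : inner ℝ p y = 0 := by
    rw [hp, inner_sub_left, inner_smul_left, conj_trivial, hc]
    by_cases hy : inner ℝ y y = 0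
    · rw [inner_self_eq_zero.1 hy]; simp
    · field_simp; ring
  by_cases h0 : p = 0
  · obtain ⟨e, he, hey⟩ := exists_orthogonal_unit hm y
    refine ⟨e, c, 0, he, hey, le_rfl, ?_⟩
    rw [zero_smul, add_zero, ← sub_eq_zero, ← hp, h0]
  · have hn : ‖p‖ ≠ 0 := norm_ne_zero_iff.2 h0
    refine ⟨‖p‖⁻¹ • p, c, ‖p‖, ?_, ?_, norm_nonneg _, ?_⟩
    · rw [norm_smul, norm_inv, norm_norm, inv_mul_cancel₀ hn]
    · rw [inner_smul_left, hpy, mul_zero]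
    · rw [smul_smul, mul_inv_cancel₀ hn, one_smul, hp]; abel

/-- On the Lie ball the products `⟨z, τ⟩` are bounded by a constant smaller than one. -/
theorem exists_bound_of_mem_lieBall (hm : 3 ≤ m) {z : CVec m} (hz : z ∈ lieBall m) :
    ∃ r : ℝ, 0 ≤ r ∧ r < 1 ∧ ∀ t s : RVec m, Orthonormal2 t s → ‖bil z (tauVec t s)‖ ≤ r := by
  set x := reVec z with hx
  set y := imVec z with hy
  obtain ⟨e, c, d, he, hey, hd, hxe⟩ := exists_orthogonal_decomposition hm x y
  -- This is the farthest point from the origin on the sphere attached to `z`; its norm is the Lie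
  -- norm of `z` and becomes the bound `r`.
  have hu : x + ‖y‖ • e ∈ Metric.ball (0 : RVec m) 1 := by
    refine hz ⟨?_, ?_⟩
    · rw [← hx, add_sub_cancel_left, norm_smul, he, norm_norm, mul_one]
    · rw [← hx, ← hy, add_sub_cancel_left, inner_smul_left, hey, mul_zero]
  rw [mem_ball_zero_iff] at hu
  refine ⟨‖x + ‖y‖ • e‖, norm_nonneg _, hu, fun t s hts => ?_⟩
  refine le_of_sq_le_sq ?_ (norm_nonneg _)
  rw [norm_sq_bil_tauVec, ← hx, ← hy]
  have hxe' : inner ℝ x e = d := by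
    rw [hxe, inner_add_left, inner_smul_left, inner_smul_left, real_inner_comm, hey,
      real_inner_self_eq_norm_sq, he]
    simp
  have hn : ‖x + ‖y‖ • e‖ ^ 2 = ‖x‖ ^ 2 + 2 * (‖y‖ * d) + ‖y‖ ^ 2 := by
    rw [norm_add_sq_real, inner_smul_right, hxe', norm_smul, he, norm_norm, mul_one]
  rw [hn]
  have b1 := hts.inner_sq_add_inner_sq_le x
  have b2 := hts.inner_sq_add_inner_sq_le y
  have b3 := hts.inner_sq_add_inner_sq_le e
  rw [he, one_pow] at b3
  -- A two by two determinant is at most the product of the lengths of its rows, and the projections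
  -- of `y` and `e` to the plane of `t`, `s` have lengths at most `‖y‖` and 1.
  have hdet : inner ℝ y t * inner ℝ e s - inner ℝ e t * inner ℝ y s ≤ ‖y‖ := by
    refine le_of_sq_le_sq ?_ (norm_nonneg _)
    have k1 : (inner ℝ y t * inner ℝ e s - inner ℝ e t * inner ℝ y s) ^ 2 ≤
        (inner ℝ y t ^ 2 + inner ℝ y s ^ 2) * (inner ℝ e t ^ 2 + inner ℝ e s ^ 2) := by
      nlinarith [sq_nonneg (inner ℝ y t * inner ℝ e t + inner ℝ e s * inner ℝ y s)]
    refine k1.trans ?_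
    nlinarith [sq_nonneg (inner ℝ y t), sq_nonneg (inner ℝ y s)]
  -- The cross term of `‖⟨z,τ⟩‖²` is a determinant in `x` and `y`, to which the part of `x` along
  -- `y` does not contribute.
  have e1 : inner ℝ y t * inner ℝ x s - inner ℝ x t * inner ℝ y s =
      d * (inner ℝ y t * inner ℝ e s - inner ℝ e t * inner ℝ y s) := by
    rw [hxe]
    simp only [inner_add_left, inner_smul_left, conj_trivial]
    ring
  nlinarith [mul_le_mul_of_nonneg_left hdet hd]

theorem norm_bil_toCVec_le {t s : RVec m} (h : Orthonormal2 t s) {ω : RVec m} (hω : ‖ω‖ = 1) :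
    ‖bil (toCVec ω) (tauVec t s)‖ ≤ 1 := by
  refine le_of_sq_le_sq ?_ zero_le_one
  have h1 : reVec (toCVec ω) = ω := by ext j; simp [reVec, toCVec]
  have h2 : imVec (toCVec ω) = 0 := by ext j; simp [imVec, toCVec]
  rw [norm_sq_bil_tauVec, h1, h2, inner_zero_left, inner_zero_left, sub_zero, zero_add]
  have := h.inner_sq_add_inner_sq_le ω
  rwa [hω] at this

end LieNorm

/-! ### Polynomial growth of `ν` and a summable majorant -/

section KernelBound

variable {m : ℕ}

theorem abs_nu_le (hm : 3 ≤ m) (k s : ℕ) : |nu m k s| ≤ ((k : ℝ) + 2 * s + 1) ^ m := by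
  have hm0 : (0 : ℝ) < (m : ℝ) / 2 := by
    have : (0 : ℝ) < m := by exact_mod_cast (by omega : 0 < m)
    positivity
  have hG := Real.Gamma_pos_of_pos hm0
  have key : ∀ N : ℕ, Real.Gamma ((N : ℝ) + (m : ℝ) / 2) ≤
      ((N : ℝ) + 1) ^ m * (Real.Gamma ((N : ℝ) + 1) * Real.Gamma ((m : ℝ) / 2)) := by
    intro N
    induction N with
    | zero => simp
    | succ N ih =>
      have hN : (0 : ℝ) < (N : ℝ) + 1 := by positivity
      have e1 : Real.Gamma (((N + 1 : ℕ) : ℝ) + (m : ℝ) / 2) =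
          ((N : ℝ) + (m : ℝ) / 2) * Real.Gamma ((N : ℝ) + (m : ℝ) / 2) := by
        rw [← Real.Gamma_add_one (by positivity)]; congr 1; push_cast; ring
      have e2 : Real.Gamma (((N + 1 : ℕ) : ℝ) + 1) = ((N : ℝ) + 1) * Real.Gamma ((N : ℝ) + 1) := by
        rw [← Real.Gamma_add_one hN.ne']; congr 1; push_cast; ring
      rw [e1, e2]
      have hb : ((N : ℝ) + m / 2) * ((N : ℝ) + 1) ^ m ≤
          (((N + 1 : ℕ) : ℝ) + 1) ^ m * ((N : ℝ) + 1) := by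
        -- Bernoulli's inequality bounds the ratio `((N + 2)/(N + 1))^m` below by `1 + m/(N + 1)`,
        -- which exceeds the growth `(N + m/2)/(N + 1)` of the Gamma quotient.
        have hB := one_add_mul_le_pow (a := 1 / ((N : ℝ) + 1)) (by
          have : (0 : ℝ) < 1 / ((N : ℝ) + 1) := by positivity
          linarith) m
        have e3 : (1 + 1 / ((N : ℝ) + 1)) ^ m * ((N : ℝ) + 1) ^ m = (((N + 1 : ℕ) : ℝ) + 1) ^ m := by
          rw [← mul_pow]; congr 1; push_cast; field_simp
        rw [← e3]
        have e4 : (N : ℝ) + m / 2 ≤ (1 + m * (1 / ((N : ℝ) + 1))) * ((N : ℝ) + 1) := by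
          have : (1 + (m : ℝ) * (1 / ((N : ℝ) + 1))) * ((N : ℝ) + 1) = N + 1 + m := by field_simp
          rw [this]; linarith
        calc ((N : ℝ) + m / 2) * ((N : ℝ) + 1) ^ m
            ≤ ((1 + 1 / ((N : ℝ) + 1)) ^ m * ((N : ℝ) + 1)) * ((N : ℝ) + 1) ^ m := by
              gcongr
              exact e4.trans (by gcongr)
          _ = _ := by ring
      have hG1 := Real.Gamma_pos_of_pos hN
      calc ((N : ℝ) + m / 2) * Real.Gamma ((N : ℝ) + (m : ℝ) / 2)
          ≤ ((N : ℝ) + m / 2) * (((N : ℝ) + 1) ^ m *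
            (Real.Gamma ((N : ℝ) + 1) * Real.Gamma ((m : ℝ) / 2))) := by gcongr
        _ = (((N : ℝ) + m / 2) * ((N : ℝ) + 1) ^ m) *
            (Real.Gamma ((N : ℝ) + 1) * Real.Gamma ((m : ℝ) / 2)) := by ring
        _ ≤ ((((N + 1 : ℕ) : ℝ) + 1) ^ m * ((N : ℝ) + 1)) *
            (Real.Gamma ((N : ℝ) + 1) * Real.Gamma ((m : ℝ) / 2)) := by gcongr
        _ = _ := by ring
  have hk := key (k + 2 * s)
  push_cast at hk
  have p1 := Real.Gamma_pos_of_pos (show (0 : ℝ) < (k : ℝ) + 2 * s + (m : ℝ) / 2 by positivity)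
  have p2 := Real.Gamma_pos_of_pos (show (0 : ℝ) < (k : ℝ) + 2 * s + 1 by positivity)
  rw [nu, abs_div, abs_mul, abs_pow, abs_neg, abs_one, one_pow, one_mul, abs_of_pos p1,
    abs_of_pos (mul_pos p2 hG), div_le_iff₀ (mul_pos p2 hG)]
  exact hk

/-- A summable majorant of the terms of the kernel. -/
def kernelBound (m : ℕ) (r : ℝ) (p : ℕ × ℕ) : ℝ :=
  2 ^ m * ((((p.1 : ℝ) + 1) ^ m * (r ^ 2) ^ p.1) * (((p.2 : ℝ) + 1) ^ m * r ^ p.2))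

theorem summable_succ_pow_mul_geometric {r : ℝ} (h0 : 0 ≤ r) (h1 : r < 1) (m : ℕ) :
    Summable fun k : ℕ => ((k : ℝ) + 1) ^ m * r ^ k := by
  have hr : ‖r‖ < 1 := by rwa [Real.norm_of_nonneg h0]
  have h := ((summable_pow_mul_geometric_of_norm_lt_one m hr).mul_left (2 ^ m)).add
    (summable_geometric_of_lt_one h0 h1)
  refine Summable.of_nonneg_of_le (fun k => by positivity) (fun k => ?_) h
  rcases Nat.eq_zero_or_pos k with hk | hk
  · subst hk
    simp
  · have hk1 : (1 : ℝ) ≤ k := by exact_mod_cast hk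
    have e : ((k : ℝ) + 1) ^ m ≤ 2 ^ m * (k : ℝ) ^ m := by
      rw [← mul_pow]; gcongr; linarith
    have hp : 0 ≤ r ^ k := by positivity
    nlinarith

theorem summable_kernelBound {r : ℝ} (h0 : 0 ≤ r) (h1 : r < 1) (m : ℕ) :
    Summable (kernelBound m r) := by
  refine Summable.mul_left _ ?_
  have a := summable_succ_pow_mul_geometric (sq_nonneg r) (show r ^ 2 < 1 by nlinarith) m
  have b := summable_succ_pow_mul_geometric h0 h1 m
  exact a.mul_of_nonneg b (fun k => by positivity) (fun k => by positivity)

theorem norm_kernelTerm_le (hm : 3 ≤ m) {r : ℝ} {τ z w : CVec m}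
    (hA : ‖kernelA τ z w‖ ≤ r) (hB : ‖kernelB τ z w‖ ≤ r) (p : ℕ × ℕ) :
    ‖kernelTerm τ z w p‖ ≤ kernelBound m r p := by
  have h0 : 0 ≤ r := (norm_nonneg _).trans hA
  rw [kernelTerm, norm_mul, norm_mul, norm_pow, norm_pow, Complex.norm_real, Real.norm_eq_abs]
  have h1 := abs_nu_le hm p.2 p.1
  have h2 : ((p.2 : ℝ) + 2 * p.1 + 1) ^ m ≤ 2 ^ m * (((p.1 : ℝ) + 1) ^ m * ((p.2 : ℝ) + 1) ^ m) := by
    rw [← mul_pow, ← mul_pow]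
    have : (0 : ℝ) ≤ (p.1 : ℝ) * p.2 := by positivity
    gcongr
    have hp2 : (0 : ℝ) ≤ p.2 := by positivity
    nlinarith
  calc |nu m p.2 p.1| * ‖kernelA τ z w‖ ^ (p.2 + p.1) * ‖kernelB τ z w‖ ^ p.1
      ≤ (2 ^ m * (((p.1 : ℝ) + 1) ^ m * ((p.2 : ℝ) + 1) ^ m)) * r ^ (p.2 + p.1) * r ^ p.1 := by
        gcongr
        exact h1.trans h2
    _ = kernelBound m r p := by rw [kernelBound]; ring

end KernelBound

/-! ### The integral over the angle -/

section AngleIntegral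

/-- For even `j` the exponential has period `π`, so the half circle already separates these
frequencies. -/
theorem integral_exp_angle (j : ℤ) (hj : Even j) :
    ∫ θ, Complex.exp (Complex.I * θ * j) ∂angleMeasure = if j = 0 then (Real.pi : ℂ) else 0 := by
  rw [angleMeasure, integral_Icc_eq_integral_Ioc,
    ← intervalIntegral.integral_of_le Real.pi_pos.le]
  split_ifs with h
  · subst h; simp
  · have hc : Complex.I * j ≠ 0 := mul_ne_zero Complex.I_ne_zero (by exact_mod_cast h)
    have e : ∀ θ : ℝ, Complex.exp (Complex.I * θ * j) = Complex.exp (Complex.I * j * θ) := by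
      intro θ; congr 1; ring
    simp only [e]
    rw [integral_exp_mul_complex hc]
    obtain ⟨q, rfl⟩ := hj
    have : Complex.exp (Complex.I * ((q + q : ℤ) : ℂ) * (Real.pi : ℝ)) = 1 := by
      rw [Complex.exp_eq_one_iff]
      exact ⟨q, by push_cast; ring⟩
    rw [this]
    simp

instance : IsFiniteMeasure angleMeasure := by unfold angleMeasure; infer_instance

theorem norm_exp_angle (θ : ℝ) (j : ℤ) : ‖Complex.exp (Complex.I * θ * j)‖ = 1 := by
  have : Complex.I * θ * j = ((θ * j : ℝ) : ℂ) * Complex.I := by push_cast; ring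
  rw [this, Complex.norm_exp_ofReal_mul_I]

theorem norm_integral_exp_angle_le (j : ℤ) :
    ‖∫ θ, Complex.exp (Complex.I * θ * j) ∂angleMeasure‖ ≤ Real.pi := by
  refine (norm_integral_le_of_norm_le_const (.of_forall fun θ => (norm_exp_angle θ j).le)).trans ?_
  rw [one_mul, angleMeasure, measureReal_restrict_apply_univ, Real.volume_real_Icc]
  simp [Real.pi_pos.le]

theorem integrable_angle_of_continuous {g : ℝ → ℂ} (hg : Continuous g) :
    Integrable g angleMeasure :=
  hg.continuousOn.integrableOn_compact isCompact_Icc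

end AngleIntegral

/-! ### Termwise integration of kernel series -/

section KernelSeries

open MvPolynomial

variable {m : ℕ} {ι : Type*}

/-- A series of polynomials at `e^{-iθ} ω` times a polynomial at `e^{iθ} ω`. -/
def seriesIntegrand (c : ι → ℂ) (q : ι → MvPolynomial (Fin m) ℂ) (P : MvPolynomial (Fin m) ℂ)
    (ω : RVec m) (θ : ℝ) : ℂ :=
  (∑' i, c i * eval (liePoint (-θ) ω) (q i)) * eval (liePoint θ ω) P

/-- A series of homogeneous polynomials that converges absolutely and uniformly on the sphere. -/
structure IsSphereSeries (c : ι → ℂ) (q : ι → MvPolynomial (Fin m) ℂ) (N : ι → ℕ)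
    (u : ι → ℝ) : Prop where
  homog : ∀ i, (q i).IsHomogeneous (N i)
  summable : Summable u
  bound : ∀ i (ω : RVec m), ‖ω‖ = 1 → ‖c i * eval (toCVec ω) (q i)‖ ≤ u i

variable {c : ι → ℂ} {q : ι → MvPolynomial (Fin m) ℂ} {N : ι → ℕ} {u : ι → ℝ}
  {P : MvPolynomial (Fin m) ℂ} {D : ℕ}

theorem eval_liePoint {p : MvPolynomial (Fin m) ℂ} {d : ℕ} (hp : p.IsHomogeneous d) (θ : ℝ)
    (ω : RVec m) :
    eval (liePoint θ ω) p = Complex.exp (Complex.I * θ) ^ d * eval (toCVec ω) p :=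
  eval_smul_of_isHomogeneous hp _ _

theorem norm_exp_I_mul (θ : ℝ) : ‖Complex.exp (Complex.I * θ)‖ = 1 := by
  rw [mul_comm, Complex.norm_exp_ofReal_mul_I]

theorem IsSphereSeries.summable_eval (h : IsSphereSeries c q N u) {ω : RVec m} (hω : ‖ω‖ = 1)
    (θ : ℝ) : Summable fun i => c i * eval (liePoint θ ω) (q i) := by
  refine Summable.of_norm_bounded h.summable fun i => ?_
  rw [eval_liePoint (h.homog i), mul_left_comm, norm_mul, norm_pow, norm_exp_I_mul, one_pow,
    one_mul]
  exact h.bound i ω hω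

theorem exp_pow_mul_exp_pow (θ : ℝ) (a b : ℕ) :
    Complex.exp (Complex.I * (-θ : ℝ)) ^ a * Complex.exp (Complex.I * θ) ^ b =
      Complex.exp (Complex.I * θ * ((b - a : ℤ) : ℂ)) := by
  rw [← Complex.exp_nat_mul, ← Complex.exp_nat_mul, ← Complex.exp_add]
  congr 1
  push_cast
  ring

/-- Homogeneity gathers all dependence on `θ` in the phase `e^{iθ(D - N_i)}`, of modulus one, so the
bound on the sphere dominates uniformly in `θ`. -/
theorem seriesIntegrand_eq (h : IsSphereSeries c q N u) (hP : P.IsHomogeneous D) (ω : RVec m)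
    (θ : ℝ) : seriesIntegrand c q P ω θ = ∑' i, (c i * eval (toCVec ω) (q i)) *
      eval (toCVec ω) P * Complex.exp (Complex.I * θ * ((D - N i : ℤ) : ℂ)) := by
  rw [seriesIntegrand, ← tsum_mul_right]
  refine tsum_congr fun i => ?_
  rw [eval_liePoint (h.homog i), eval_liePoint hP, ← exp_pow_mul_exp_pow]
  ring

theorem continuous_seriesIntegrand (h : IsSphereSeries c q N u) (hP : P.IsHomogeneous D)
    {ω : RVec m} (hω : ‖ω‖ = 1) : Continuous (seriesIntegrand c q P ω) := by
  rw [funext (seriesIntegrand_eq h hP ω)]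
  refine continuous_tsum (u := fun i => u i * ‖eval (toCVec ω) P‖) (fun i => by fun_prop)
    (h.summable.mul_right _) fun i θ => ?_
  rw [norm_mul, norm_mul, norm_exp_angle, mul_one]
  gcongr
  exact h.bound i ω hω

/-- The integral of `seriesIntegrand` over the angle, as a function on the sphere. -/
theorem integral_seriesIntegrand [Countable ι] (h : IsSphereSeries c q N u)
    (hP : P.IsHomogeneous D) {ω : RVec m} (hω : ‖ω‖ = 1) :
    ∫ θ, seriesIntegrand c q P ω θ ∂angleMeasure = ∑' i, (c i * eval (toCVec ω) (q i)) *
      eval (toCVec ω) P * ∫ θ, Complex.exp (Complex.I * θ * ((D - N i : ℤ) : ℂ)) ∂angleMeasure := by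
  simp only [seriesIntegrand_eq h hP ω]
  rw [← integral_tsum_of_summable_integral_norm]
  · exact tsum_congr fun i => integral_const_mul _ _
  · exact fun i => integrable_angle_of_continuous (by fun_prop)
  · simp only [norm_mul, norm_exp_angle, mul_one]
    simp only [integral_const, smul_eq_mul, ← norm_mul]
    refine Summable.mul_left _ ?_
    refine Summable.of_nonneg_of_le (fun i => norm_nonneg _) (fun i => ?_)
      (h.summable.mul_right ‖eval (toCVec ω) P‖)
    rw [norm_mul]
    gcongr
    exact h.bound i ω hω

theorem exists_bound_eval_sphere (P : MvPolynomial (Fin m) ℂ) :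
    ∃ B : ℝ, ∀ ω : Metric.sphere (0 : RVec m) 1, ‖eval (toCVec (ω : RVec m)) P‖ ≤ B := by
  obtain ⟨B, hB⟩ := isCompact_univ.exists_bound_of_continuousOn
    (continuous_eval_sphere LinearIsometry.id P).continuousOn
  exact ⟨B, fun ω => hB ω (Set.mem_univ _)⟩

theorem integral_eval_sphere (hm : 3 ≤ m) (P : MvPolynomial (Fin m) ℂ) :
    ∫ ω : Metric.sphere (0 : RVec m) 1, eval (toCVec (ω : RVec m)) P ∂(sphereMeasure (RVec m)) =
      (sphereArea m : ℂ) * sphAvgFull m P := by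
  have hA : (sphereArea m : ℂ) ≠ 0 := by exact_mod_cast (sphereArea_pos (by omega)).ne'
  rw [sphAvg_apply, finrank_euclideanSpace_fin, mul_inv_cancel_left₀ hA]
  rfl

theorem integrable_integral_seriesIntegrand [Countable ι] (h : IsSphereSeries c q N u)
    (hP : P.IsHomogeneous D) :
    Integrable (fun ω : Metric.sphere (0 : RVec m) 1 =>
      ∫ θ, seriesIntegrand c q P (ω : RVec m) θ ∂angleMeasure) (sphereMeasure (RVec m)) := by
  refine integrable_sphere_of_continuous ?_
  have e : ∀ ω : Metric.sphere (0 : RVec m) 1, _ := fun ω =>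
    integral_seriesIntegrand h hP (norm_eq_of_mem_sphere ω)
  rw [funext e]
  obtain ⟨B, hB⟩ := exists_bound_eval_sphere P
  refine continuous_tsum (u := fun i => u i * B * Real.pi) (fun i => ?_)
    ((h.summable.mul_right _).mul_right _) fun i ω => ?_
  · exact ((continuous_const.mul (continuous_eval_sphere LinearIsometry.id (q i))).mul
      (continuous_eval_sphere LinearIsometry.id P)).mul continuous_const
  · have hu := h.bound i ω (norm_eq_of_mem_sphere ω)
    have hu0 := (norm_nonneg _).trans hu
    rw [norm_mul, norm_mul]
    gcongr
    · exact mul_nonneg hu0 ((norm_nonneg _).trans (hB ω))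
    · exact hB ω
    · exact norm_integral_exp_angle_le _

/-- Only the polynomials of the matching degree survive the integration. -/
theorem integral_integral_seriesIntegrand [Countable ι] (hm : 3 ≤ m) (h : IsSphereSeries c q N u)
    (hP : P.IsHomogeneous D) (S : Finset ι) (hS : ∀ i, i ∈ S ↔ N i = D) :
    ∫ ω : Metric.sphere (0 : RVec m) 1,
      (∫ θ, seriesIntegrand c q P (ω : RVec m) θ ∂angleMeasure) ∂(sphereMeasure (RVec m)) =
      (Real.pi * sphereArea m : ℝ) * ∑ i ∈ S, c i * sphAvgFull m (q i * P) := by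
  have e : ∀ ω : Metric.sphere (0 : RVec m) 1, _ := fun ω =>
    integral_seriesIntegrand h hP (norm_eq_of_mem_sphere ω)
  rw [integral_congr_ae (.of_forall e)]
  obtain ⟨B, hB⟩ := exists_bound_eval_sphere P
  set I : ι → ℂ := fun i =>
    ∫ θ, Complex.exp (Complex.I * θ * ((D - N i : ℤ) : ℂ)) ∂angleMeasure with hI
  have hcont : ∀ i, Continuous fun ω : Metric.sphere (0 : RVec m) 1 =>
      (c i * eval (toCVec (ω : RVec m)) (q i)) * eval (toCVec (ω : RVec m)) P * I i := fun i =>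
    ((continuous_const.mul (continuous_eval_sphere LinearIsometry.id (q i))).mul
      (continuous_eval_sphere LinearIsometry.id P)).mul continuous_const
  rw [← integral_tsum_of_summable_integral_norm
    (fun i => integrable_sphere_of_continuous (hcont i))]
  · have hterm : ∀ i, ∫ ω : Metric.sphere (0 : RVec m) 1,
        (c i * eval (toCVec (ω : RVec m)) (q i)) * eval (toCVec (ω : RVec m)) P * I i
          ∂(sphereMeasure (RVec m)) =
        I i * c i * ((sphereArea m : ℂ) * sphAvgFull m (q i * P)) := by
      intro i
      rw [← integral_eval_sphere hm, ← integral_const_mul]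
      refine integral_congr_ae (.of_forall fun ω => ?_)
      simp only [map_mul]
      ring
    simp only [hterm]
    rw [tsum_eq_sum (s := S), Finset.mul_sum]
    · refine Finset.sum_congr rfl fun i hi => ?_
      have : I i = Real.pi := by
        rw [hI]
        simp only
        rw [(hS i).1 hi, sub_self, integral_exp_angle 0 (by simp), if_pos rfl]
      rw [this]
      push_cast
      ring
    · intro i hi
      have hne : N i ≠ D := fun h' => hi ((hS i).2 h')
      rcases Int.even_or_odd (D - N i : ℤ) with hev | hodd
      · have : I i = 0 := by
          rw [hI]
          simp only
          rw [integral_exp_angle _ hev, if_neg (by omega)]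
        rw [this, zero_mul, zero_mul]
      -- An odd frequency need not integrate to zero over `[0, π]`; here the integrand on the sphere
      -- has odd degree and averages to zero.
      · have ho : Odd (N i + D) := by
          obtain ⟨k, hk⟩ := hodd
          exact ⟨(N i + k).toNat, by omega⟩
        rw [sphAvg_eq_zero_of_odd _ ho ((h.homog i).mul hP), mul_zero, mul_zero]
  · have hub : ∀ i (ω : Metric.sphere (0 : RVec m) 1),
        ‖(c i * eval (toCVec (ω : RVec m)) (q i)) * eval (toCVec (ω : RVec m)) P * I i‖ ≤
          u i * B * Real.pi := by
      intro i ω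
      have hu := h.bound i ω (norm_eq_of_mem_sphere ω)
      have hu0 := (norm_nonneg _).trans hu
      rw [norm_mul, norm_mul]
      gcongr
      · exact mul_nonneg hu0 ((norm_nonneg _).trans (hB ω))
      · exact hB ω
      · exact norm_integral_exp_angle_le _
    refine Summable.of_nonneg_of_le (fun i => integral_nonneg fun ω => norm_nonneg _) (fun i => ?_)
      (((h.summable.mul_right B).mul_right Real.pi).mul_right
        ((sphereMeasure (RVec m)).real Set.univ))
    have := norm_integral_le_of_norm_le_const (μ := sphereMeasure (RVec m))
      (f := fun ω : Metric.sphere (0 : RVec m) 1 =>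
        ‖(c i * eval (toCVec (ω : RVec m)) (q i)) * eval (toCVec (ω : RVec m)) P * I i‖)
      (.of_forall fun ω => by rw [norm_norm]; exact hub i ω)
    exact (le_abs_self _).trans this

end KernelSeries

/-! ### Integrals of finite Clifford combinations -/

section CliffordIntegral

variable {m : ℕ} {X : Type*} [MeasurableSpace X] {μ : Measure X} {κ : Type*} [Fintype κ]

theorem repr_sum_smul (φ : κ → ℂ) (c : κ → Cl m) (A : Finset (Fin m)) :
    (cliffordBasis m).repr (∑ i, φ i • c i) A = ∑ i, φ i * (cliffordBasis m).repr (c i) A := by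
  rw [map_sum, Finsupp.finsetSum_apply]
  exact Finset.sum_congr rfl fun i _ => by rw [map_smul, Finsupp.smul_apply, smul_eq_mul]

theorem cliffordIntegrable_sum_smul {φ : κ → X → ℂ} (c : κ → Cl m)
    (hφ : ∀ i, Integrable (φ i) μ) : CliffordIntegrable μ (fun x => ∑ i, φ i x • c i) := by
  intro A
  simp only [repr_sum_smul]
  exact integrable_finsetSum _ fun i _ => (hφ i).mul_const _

theorem cliffordIntegral_sum_smul {φ : κ → X → ℂ} (c : κ → Cl m)
    (hφ : ∀ i, Integrable (φ i) μ) :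
    cliffordIntegral μ (fun x => ∑ i, φ i x • c i) = ∑ i, (∫ x, φ i x ∂μ) • c i := by
  rw [cliffordIntegral, ← (cliffordBasis m).sum_repr (∑ i, (∫ x, φ i x ∂μ) • c i)]
  refine Finset.sum_congr rfl fun A _ => ?_
  congr 1
  simp only [repr_sum_smul]
  rw [integral_finsetSum _ fun i _ => (hφ i).mul_const _]
  exact Finset.sum_congr rfl fun i _ => integral_mul_const _ _

end CliffordIntegral

/-! ### The dual transform of functions polynomial in `t`, `s` -/

section DualRadon

open MvPolynomial

variable {m : ℕ} {κ : Type*} [Fintype κ]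

/-- The dual Radon transform of a function that is polynomial in `t` and `s`. -/
theorem dualRadon_of_polynomial (hm : 3 ≤ m) {F : CVec m → Cl m} (p : κ → PairPoly m ℂ)
    (c : κ → Cl m) (hF : ∀ t s : RVec m, Orthonormal2 t s →
      F (tauVec t s) = ∑ i, evalPair (toCVec t) (toCVec s) (p i) • c i) :
    DualRadonConverges F ∧ dualRadon F = ∑ i, pairAvg m (p i) • c i := by
  have hA : (sphereArea m : ℂ) ≠ 0 := by exact_mod_cast (sphereArea_pos (by omega)).ne'
  have hA' : (sphereArea (m - 1) : ℂ) ≠ 0 := by exact_mod_cast (sphereArea_pos (by omega)).ne'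
  have hfun : ∀ t : RVec m, ‖t‖ = 1 →
      (fun s : Metric.sphere (0 : orthHyperplane t) 1 =>
        F (tauVec t ((s : orthHyperplane t) : RVec m))) =
      fun s : Metric.sphere (0 : orthHyperplane t) 1 => ∑ i, eval (toCVec ((orthHyperplane t).subtypeₗᵢ s)) (fixFst (toCVec t) (p i)) •
        c i := by
    intro t ht
    funext s
    refine (hF t s.1.1 ⟨ht, norm_eq_of_mem_sphere s,
      (Submodule.mem_orthogonal_singleton_iff_inner_right).1 s.1.2⟩).trans ?_
    simp only [eval_fixFst]
    rfl
  have hinner : ∀ t : RVec m, ‖t‖ = 1 → dualRadonInner F t =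
      ∑ i, ((sphereArea (m - 1) : ℂ) * perpAvg t (fixFst (toCVec t) (p i))) • c i := by
    intro t ht
    rw [dualRadonInner, hfun t ht, cliffordIntegral_sum_smul c fun i => integrable_eval_sphere _ _]
    refine Finset.sum_congr rfl fun i _ => ?_
    rw [sphAvg_apply, finrank_orthHyperplane ht, mul_inv_cancel_left₀ hA']
  have hfun2 : (fun t : Metric.sphere (0 : RVec m) 1 => dualRadonInner F (t : RVec m)) =
      fun t : Metric.sphere (0 : RVec m) 1 => ∑ i, ((sphereArea (m - 1) : ℂ) *
        perpAvg (t : RVec m) (fixFst (toCVec (t : RVec m)) (p i))) • c i :=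
    funext fun t => hinner t (norm_eq_of_mem_sphere t)
  have hint : ∀ i, Integrable (fun t : Metric.sphere (0 : RVec m) 1 => (sphereArea (m - 1) : ℂ) *
      perpAvg (t : RVec m) (fixFst (toCVec (t : RVec m)) (p i))) (sphereMeasure (RVec m)) := by
    intro i
    -- The inner average is polynomial in `t` on the sphere, hence continuous and integrable there.
    obtain ⟨q, hq⟩ := exists_representsInner hm (p i)
    refine Integrable.const_mul ?_ _
    rw [funext fun t : Metric.sphere (0 : RVec m) 1 => (hq t (norm_eq_of_mem_sphere t)).1]
    exact integrable_eval_sphere LinearIsometry.id q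
  refine ⟨⟨fun t ht => ?_, ?_⟩, ?_⟩
  · rw [hfun t ht]
    exact cliffordIntegrable_sum_smul c fun i => integrable_eval_sphere _ _
  · rw [hfun2]
    exact cliffordIntegrable_sum_smul c hint
  · rw [dualRadon, hfun2, cliffordIntegral_sum_smul c hint, Finset.smul_sum]
    refine Finset.sum_congr rfl fun i _ => ?_
    rw [smul_smul, pairAvg, integral_const_mul]
    congr 1
    push_cast
    field_simp

end DualRadon

/-! ### The polarized transform of a homogeneous polynomial -/

section PolarizedTransform

open MvPolynomial

variable {m : ℕ}

/-- The coefficient of the term of the kernel with index `p`, as a polynomial in `w`. -/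
def kernelCoeff (τ z : CVec m) (p : ℕ × ℕ) : ℂ :=
  (nu m p.2 p.1 : ℂ) * (bil z τ ^ (p.2 + p.1) * bil z (dagger τ) ^ p.1)

/-- The dependence on `w` of the term of the kernel with index `p`. -/
def kernelFactor (τ : CVec m) (p : ℕ × ℕ) : MvPolynomial (Fin m) ℂ :=
  lin (dagger τ) ^ (p.2 + p.1) * lin τ ^ p.1

theorem kernelTerm_eq (τ z w : CVec m) (p : ℕ × ℕ) :
    kernelTerm τ z w p = kernelCoeff τ z p * eval w (kernelFactor τ p) := by
  have h : ∀ v : CVec m, eval w (lin v) = bil w v := fun v => by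
    rw [eval_lin]; exact Finset.sum_congr rfl fun j _ => mul_comm _ _
  rw [kernelTerm, kernelCoeff, kernelFactor, kernelA, kernelB, map_mul, map_pow, map_pow, h, h]
  ring

theorem isSphereSeries_kernel (hm : 3 ≤ m) {z : CVec m} {r : ℝ} (h0 : 0 ≤ r) (h1 : r < 1)
    (hr : ∀ t s : RVec m, Orthonormal2 t s → ‖bil z (tauVec t s)‖ ≤ r) {t s : RVec m}
    (hts : Orthonormal2 t s) :
    IsSphereSeries (kernelCoeff (tauVec t s) z) (kernelFactor (tauVec t s))
      (fun p => p.2 + 2 * p.1) (kernelBound m r) where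
  homog p := by
    have := ((isHomogeneous_lin (dagger (tauVec t s))).pow (p.2 + p.1)).mul
      ((isHomogeneous_lin (tauVec t s)).pow p.1)
    rwa [show 1 * (p.2 + p.1) + 1 * p.1 = p.2 + 2 * p.1 by ring] at this
  summable := summable_kernelBound h0 h1 m
  bound p ω hω := by
    rw [← kernelTerm_eq]
    have e := dagger_tauVec_eq t s
    refine norm_kernelTerm_le hm ?_ ?_ p
    · rw [kernelA, norm_mul, e, ← mul_one r]
      exact mul_le_mul (hr _ _ hts) (norm_bil_toCVec_le hts.neg_left hω) (norm_nonneg _) h0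
    · rw [kernelB, norm_mul, e, ← mul_one r]
      exact mul_le_mul (hr _ _ hts.neg_left) (norm_bil_toCVec_le hts hω) (norm_nonneg _) h0

theorem IsSphereSeries.comp {ι ι' : Type*} {c : ι → ℂ} {q : ι → MvPolynomial (Fin m) ℂ}
    {N : ι → ℕ} {u : ι → ℝ} (h : IsSphereSeries c q N u) {g : ι' → ι} (hg : g.Injective) :
    IsSphereSeries (c ∘ g) (q ∘ g) (N ∘ g) (u ∘ g) :=
  ⟨fun _ => h.homog _, h.summable.comp_injective hg, fun _ => h.bound _⟩

/-- The indices `(s, k)` with `k + 2 s = D`. -/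
def degreePairs (D : ℕ) : Finset (ℕ × ℕ) :=
  (Finset.range (D / 2 + 1)).image fun s => (s, D - 2 * s)

theorem mem_degreePairs {D : ℕ} (p : ℕ × ℕ) : p ∈ degreePairs D ↔ p.2 + 2 * p.1 = D := by
  simp only [degreePairs, Finset.mem_image, Finset.mem_range]
  constructor
  · rintro ⟨s, hs, rfl⟩
    simp only
    omega
  · intro h
    exact ⟨p.1, by omega, Prod.ext rfl (by simp only; omega)⟩

/-- The indices `s` with `2 s = D`. -/
def halfDegrees (D : ℕ) : Finset ℕ := (Finset.range (D / 2 + 1)).filter fun s => 2 * s = D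

theorem mem_halfDegrees {D : ℕ} (s : ℕ) : s ∈ halfDegrees D ↔ 2 * s = D := by
  simp only [halfDegrees, Finset.mem_filter, Finset.mem_range]
  omega

variable {κ : Type*} [Fintype κ]

/-- Only kernel terms of degree `D` in `w` survive both integrations, so the transform is a finite
sum, and the factor `π A_m` cancels the normalization of the kernel. -/
theorem polarizedHuaRadon_of_polynomial (hm : 3 ≤ m) {z : CVec m} (hz : z ∈ lieBall m)
    {t s : RVec m} (hts : Orthonormal2 t s) {D : ℕ} {P : κ → MvPolynomial (Fin m) ℂ}
    (hP : ∀ A, (P A).IsHomogeneous D) (e : κ → Cl m) {f : CVec m → Cl m}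
    (hf : ∀ w, f w = ∑ A, eval w (P A) • e A) :
    PolarizedHuaRadonConverges (tauVec t s) f z ∧
    polarizedHuaRadon (tauVec t s) f z =
      ∑ A, (∑ p ∈ degreePairs D, kernelCoeff (tauVec t s) z p *
        sphAvgFull m (kernelFactor (tauVec t s) p * P A)) • e A +
      ∑ A, (-(1 / 4) * ∑ l ∈ halfDegrees D, kernelCoeff (tauVec t s) z (l, 0) *
        sphAvgFull m (kernelFactor (tauVec t s) (l, 0) * P A)) •
          (vec (dagger (tauVec t s)) * vec (tauVec t s) * e A) := by
  obtain ⟨r, h0, h1, hr⟩ := exists_bound_of_mem_lieBall hm hz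
  set τ := tauVec t s with hτ
  have hS := isSphereSeries_kernel hm h0 h1 hr hts
  rw [← hτ] at hS
  have hg : Function.Injective fun l : ℕ => (l, 0) := Prod.mk_left_injective 0
  have hS' := hS.comp hg
  set x : ℂ := ((1 / (Real.pi * sphereArea m) : ℝ) : ℂ) with hx
  -- The two summands separate the scalar series from the series multiplied by `τ†τ`; the latter is
  -- the subseries of the indices `(l, 0)`.
  let φ : κ ⊕ κ → RVec m → ℝ → ℂ := Sum.elim
    (fun A ω θ => x * seriesIntegrand (kernelCoeff τ z) (kernelFactor τ) (P A) ω θ)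
    (fun A ω θ => -(x / 4) * seriesIntegrand (kernelCoeff τ z ∘ fun l : ℕ => (l, 0))
      (kernelFactor τ ∘ fun l : ℕ => (l, 0)) (P A) ω θ)
  let b : κ ⊕ κ → Cl m := Sum.elim e fun A => vec (dagger τ) * vec τ * e A
  have hI : ∀ ω : RVec m, polarizedIntegrand τ f z ω = fun θ => ∑ i, φ i ω θ • b i := by
    intro ω
    funext θ
    rw [Fintype.sum_sum_type, polarizedIntegrand, polarizedKernel, hf, ← hx, smul_mul_assoc,
      sub_mul, Finset.mul_sum, Finset.mul_sum, smul_sub, Finset.smul_sum, Finset.smul_sum,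
      sub_eq_add_neg, ← Finset.sum_neg_distrib]
    simp only [φ, b, Sum.elim_inl, Sum.elim_inr, seriesIntegrand, kernelTerm_eq,
      Function.comp_apply]
    congr 1
    · refine Finset.sum_congr rfl fun A _ => ?_
      rw [← Algebra.smul_def, smul_smul, smul_smul, mul_assoc]
    · refine Finset.sum_congr rfl fun A _ => ?_
      rw [smul_mul_smul_comm, smul_smul, ← neg_smul]
      congr 1
      ring
  have hθ : ∀ ω : RVec m, ‖ω‖ = 1 → ∀ i, Integrable (φ i ω) angleMeasure := by
    rintro ω hω (A | A)
    · exact (integrable_angle_of_continuous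
        (continuous_seriesIntegrand hS (hP A) hω)).const_mul _
    · exact (integrable_angle_of_continuous
        (continuous_seriesIntegrand hS' (hP A) hω)).const_mul _
  have hJ : (fun ω : Metric.sphere (0 : RVec m) 1 =>
      cliffordIntegral angleMeasure (polarizedIntegrand τ f z (ω : RVec m))) =
      fun ω : Metric.sphere (0 : RVec m) 1 => ∑ i, (∫ θ, φ i (ω : RVec m) θ ∂angleMeasure) • b i := by
    funext ω
    rw [hI, cliffordIntegral_sum_smul b (hθ ω (norm_eq_of_mem_sphere ω))]
  have hω : ∀ i, Integrable (fun ω : Metric.sphere (0 : RVec m) 1 =>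
      ∫ θ, φ i (ω : RVec m) θ ∂angleMeasure) (sphereMeasure (RVec m)) := by
    rintro (A | A)
    · simp only [φ, Sum.elim_inl, integral_const_mul]
      exact (integrable_integral_seriesIntegrand hS (hP A)).const_mul _
    · simp only [φ, Sum.elim_inr, integral_const_mul]
      exact (integrable_integral_seriesIntegrand hS' (hP A)).const_mul _
  refine ⟨⟨fun ω θ hω => ?_, fun ω hω => ?_, ?_⟩, ?_⟩
  · simp only [funext (kernelTerm_eq τ z _)]
    exact hS.summable_eval hω _
  · rw [hI]
    exact cliffordIntegrable_sum_smul b (hθ ω hω)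
  · rw [hJ]
    exact cliffordIntegrable_sum_smul b hω
  · have hx1 : x * ((Real.pi * sphereArea m : ℝ) : ℂ) = 1 := by
      rw [hx, ← Complex.ofReal_mul, one_div, inv_mul_cancel₀, Complex.ofReal_one]
      exact (mul_pos Real.pi_pos (sphereArea_pos (by omega))).ne'
    rw [polarizedHuaRadon, hJ, cliffordIntegral_sum_smul b hω, Fintype.sum_sum_type]
    simp only [φ, b, Sum.elim_inl, Sum.elim_inr, integral_const_mul]
    congr 1
    · refine Finset.sum_congr rfl fun A _ => ?_
      rw [integral_integral_seriesIntegrand hm hS (hP A) _ mem_degreePairs, ← mul_assoc, hx1,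
        one_mul]
    · refine Finset.sum_congr rfl fun A _ => ?_
      rw [integral_integral_seriesIntegrand hm hS' (hP A) (halfDegrees D) fun l => by
        rw [mem_halfDegrees]; simp]
      congr 1
      simp only [Function.comp_apply]
      linear_combination (-(1 / 4) * ∑ l ∈ halfDegrees D, kernelCoeff τ z (l, 0) *
        sphAvgFull m (kernelFactor τ (l, 0) * P A)) * hx1

end PolarizedTransform

/-! ### Assembly of the coefficient `ρ` -/

section MainResult

open MvPolynomial

variable {m : ℕ}

theorem evalReal_smul {R : Type*} [CommRing R] [Algebra ℂ R] (t s : RVec m) (x : ℂ)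
    (W : PairPoly m R) : evalReal t s (x • W) = x • evalReal t s W := by
  rw [← algebraMap_smul R x, smul_eq_C_mul, map_mul, eval_C, Algebra.smul_def]

/-- The polynomial `(-⟨z, z⟩)^n H`. -/
def normMul (n : ℕ) (H : MvPolynomial (Fin m) ℂ) : MvPolynomial (Fin m) ℂ :=
  C ((-1) ^ n) * ((∑ i, X i * X i) ^ n * H)

theorem isHomogeneous_normMul (n : ℕ) {d : ℕ} {H : MvPolynomial (Fin m) ℂ}
    (hH : H.IsHomogeneous d) : (normMul n H).IsHomogeneous (2 * n + d) := by
  have h : (∑ i : Fin m, X i * X i : MvPolynomial (Fin m) ℂ).IsHomogeneous 2 :=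
    IsHomogeneous.sum _ _ _ fun i _ => (isHomogeneous_X ℂ i).mul (isHomogeneous_X ℂ i)
  exact ((h.pow n).mul hH).C_mul _

theorem eval_normMul (n : ℕ) (H : MvPolynomial (Fin m) ℂ) (w : CVec m) :
    eval w (normMul n H) = (-bil w w) ^ n * eval w H := by
  simp only [normMul, map_mul, map_pow, map_sum, eval_X, eval_C, ← mul_assoc]
  rw [← mul_pow, neg_one_mul]
  rfl

/-- On the unit sphere `(-⟨ω,ω⟩)^n` is just `(-1)^n`. The power of `⟨z,z⟩` lost here is restored by
`pairFun_kernelPoly`. -/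
theorem sphAvgFull_mul_normMul (n : ℕ) (q H : MvPolynomial (Fin m) ℂ) :
    sphAvgFull m (q * normMul n H) = (-1) ^ n * sphereFun H q := by
  have h : ∀ k p, sphAvgFull m ((∑ i, X i * X i) ^ k * p) = sphAvgFull m p := by
    intro k p
    induction k with
    | zero => rw [pow_zero, one_mul]
    | succ k ih => rw [pow_succ', mul_assoc, sphAvgFull_norm_mul, ih]
  rw [normMul, show q * (C ((-1) ^ n) * ((∑ i, X i * X i) ^ n * H)) =
    C ((-1) ^ n) * ((∑ i, X i * X i) ^ n * (q * H)) by ring, ← smul_eq_C_mul, map_smul, h,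
    smul_eq_mul, sphereFun_apply]

/-- The first sum of the kernel restricted to degree `D`, as a polynomial in `t` and `s`. -/
def kernelSumPoly (z : CVec m) (n D : ℕ) : PairPoly m (MvPolynomial (Fin m) ℂ) :=
  ∑ p ∈ degreePairs D, ((-1) ^ n * (nu m p.2 p.1 : ℂ)) • kernelPoly z (p.2 + p.1) p.1

/-- The second sum of the kernel restricted to degree `D`, as a polynomial in `t` and `s`. -/
def kernelDiagPoly (z : CVec m) (n D : ℕ) : PairPoly m (MvPolynomial (Fin m) ℂ) :=
  ∑ l ∈ halfDegrees D, (-(1 / 4) * ((-1) ^ n * (nu m 0 l : ℂ))) • kernelPoly z l l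

theorem sphereFun_evalReal_kernelPoly (H : MvPolynomial (Fin m) ℂ) (z : CVec m) (n : ℕ)
    (t s : RVec m) (p : ℕ × ℕ) :
    kernelCoeff (tauVec t s) z p * sphAvgFull m (kernelFactor (tauVec t s) p * normMul n H) =
      ((-1) ^ n * (nu m p.2 p.1 : ℂ)) *
        sphereFun H (evalReal t s (kernelPoly z (p.2 + p.1) p.1)) := by
  rw [sphAvgFull_mul_normMul, evalReal_kernelPoly, ← smul_eq_C_mul, map_smul, smul_eq_mul,
    kernelCoeff, kernelFactor]
  ring

theorem sum_kernelCoeff_degreePairs (H : MvPolynomial (Fin m) ℂ) (z : CVec m) (n D : ℕ)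
    (t s : RVec m) :
    ∑ p ∈ degreePairs D, kernelCoeff (tauVec t s) z p *
        sphAvgFull m (kernelFactor (tauVec t s) p * normMul n H) =
      evalPair (toCVec t) (toCVec s) (mapCoeff (sphereFun H) (kernelSumPoly z n D)) := by
  rw [evalPair_mapCoeff, kernelSumPoly, map_sum, map_sum]
  refine Finset.sum_congr rfl fun p _ => ?_
  rw [sphereFun_evalReal_kernelPoly, evalReal_smul, map_smul, smul_eq_mul]

theorem sum_kernelCoeff_halfDegrees (H : MvPolynomial (Fin m) ℂ) (z : CVec m) (n D : ℕ)
    (t s : RVec m) :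
    -(1 / 4) * ∑ l ∈ halfDegrees D, kernelCoeff (tauVec t s) z (l, 0) *
        sphAvgFull m (kernelFactor (tauVec t s) (l, 0) * normMul n H) =
      sphereFun H (evalReal t s (kernelDiagPoly z n D)) := by
  rw [kernelDiagPoly, map_sum, map_sum, Finset.mul_sum]
  refine Finset.sum_congr rfl fun l _ => ?_
  rw [sphereFun_evalReal_kernelPoly, evalReal_smul, map_smul, smul_eq_mul]
  simp only [zero_add]
  ring

theorem evalReal_kernelDiagPoly_neg (z : CVec m) (n D : ℕ) (t s : RVec m) :
    evalReal t (-s) (kernelDiagPoly z n D) = evalReal t s (kernelDiagPoly z n D) := by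
  simp only [kernelDiagPoly, map_sum, evalReal_smul, evalReal_kernelPoly_neg]

/-- The coefficient `ρ_{t,2n+1}` as a sum over the indices of the kernel. -/
theorem rhoOdd_eq (m t n : ℕ) :
    rhoOdd m t n = ∑ p ∈ degreePairs t, nu m p.2 p.1 * theta m n (p.2 + p.1) p.1 -
      1 / 4 * ∑ l ∈ halfDegrees t, nu m 0 l * (2 * theta m n l l) := by
  have h1 : ∑ p ∈ degreePairs t, nu m p.2 p.1 * theta m n (p.2 + p.1) p.1 =
      ∑ s ∈ Finset.range (t / 2 + 1), nu m (t - 2 * s) s * theta m n (t - s) s := by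
    rw [degreePairs, Finset.sum_image fun a _ b _ h => (Prod.ext_iff.1 h).1]
    refine Finset.sum_congr rfl fun s hs => ?_
    rw [Finset.mem_range] at hs
    simp only
    rw [show t - 2 * s + s = t - s by omega]
  rw [h1, rhoOdd]
  rcases Nat.even_or_odd' t with ⟨l, rfl | rfl⟩
  · have h2 : halfDegrees (2 * l) = {l} := by
      ext s
      rw [mem_halfDegrees, Finset.mem_singleton]
      omega
    rw [if_pos (even_two_mul l), h2, Finset.sum_singleton, vartheta, if_pos (even_two_mul n),
      Nat.mul_div_cancel_left _ two_pos, Nat.mul_div_cancel_left _ two_pos]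
    ring
  · have h2 : halfDegrees (2 * l + 1) = ∅ := by
      ext s
      rw [mem_halfDegrees]
      simp only [Finset.notMem_empty, iff_false]
      omega
    rw [if_neg (by simp), h2, Finset.sum_empty, show (2 * l + 1) / 2 = l by omega]
    ring

/-- Each kernel term contributes `ν θ` times the same `(-⟨z,z⟩)^n H(z)`, and the factor 2 from `τ†τ`
turns `θ_{n,l,l}` into `ϑ_{2n,l}`. -/
theorem dualRadon_kernel_average (hm : 3 ≤ m) {d n : ℕ} {H : MvPolynomial (Fin m) ℂ}
    (hH : H.IsHomogeneous d) (hL : lap H = 0) (z : CVec m) :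
    algebraMap ℂ (Cl m) (pairFun (sphereFun H) (kernelSumPoly z n (2 * n + d))) +
      ∑ a, ∑ b, pairFun (sphereFun H) (cliffordCoeff (kernelDiagPoly z n (2 * n + d)) a b) •
        (gen a * gen b : Cl m) =
      algebraMap ℂ (Cl m) ((rhoOdd m (2 * n + d) n : ℂ) * eval z (normMul n H)) := by
  rw [sum_pairFun_cliffordCoeff hm _ fun t s _ => evalReal_kernelDiagPoly_neg z n _ t s, ← map_add]
  congr 1
  rw [kernelSumPoly, kernelDiagPoly, pairFun_sum hm, pairFun_sum hm, rhoOdd_eq, eval_normMul]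
  have h1 : ∀ p ∈ degreePairs (2 * n + d), pairFun (sphereFun H)
      (((-1) ^ n * (nu m p.2 p.1 : ℂ)) • kernelPoly z (p.2 + p.1) p.1) =
      (nu m p.2 p.1 * theta m n (p.2 + p.1) p.1 : ℂ) * ((-bil z z) ^ n * eval z H) := by
    intro p hp
    rw [mem_degreePairs] at hp
    rw [pairFun_smul hm, pairFun_kernelPoly hm hH hL (n := n) z (by omega), neg_pow (bil z z)]
    ring
  have h2 : ∀ l ∈ halfDegrees (2 * n + d), pairFun (sphereFun H)
      ((-(1 / 4) * ((-1) ^ n * (nu m 0 l : ℂ))) • kernelPoly z l l) =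
      -(1 / 4) * (nu m 0 l * theta m n l l : ℂ) * ((-bil z z) ^ n * eval z H) := by
    intro l hl
    rw [mem_halfDegrees] at hl
    rw [pairFun_smul hm, pairFun_kernelPoly hm hH hL (n := n) z (by omega), neg_pow (bil z z)]
    ring
  rw [Finset.sum_congr rfl h1, Finset.sum_congr rfl h2, ← Finset.sum_mul, ← Finset.sum_mul,
    ← Finset.mul_sum]
  push_cast
  simp only [mul_left_comm _ (2 : ℂ), ← Finset.mul_sum]
  ring

end MainResult

end HuaRadon

end

open HuaRadon in
theorem mainTheorem8 (m t n : ℕ) (hm : 3 ≤ m) (hn : 2 * n + 1 ≤ t)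
    (M : HuaRadon.CliffordPoly m) (hM : M ∈ HuaRadon.monogenicPoly m (t - 2 * n - 1))
    (f : HuaRadon.CVec m → HuaRadon.Cl m)
    (hf : ∀ z, f z = HuaRadon.vec z ^ (2 * n + 1) * HuaRadon.evalPoly z M)
    (z : HuaRadon.CVec m) (hz : z ∈ HuaRadon.lieBall m) :
    (∀ t₀ s₀ : HuaRadon.RVec m, ‖t₀‖ = 1 → ‖s₀‖ = 1 → inner ℝ t₀ s₀ = 0 →
      HuaRadon.PolarizedHuaRadonConverges (HuaRadon.tauVec t₀ s₀) f z) ∧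
    HuaRadon.DualRadonConverges (fun τ => HuaRadon.polarizedHuaRadon τ f z) ∧
    HuaRadon.dualRadon (fun τ => HuaRadon.polarizedHuaRadon τ f z) =
      ((HuaRadon.rhoOdd m t n : ℝ) : ℂ) • f z := by
  obtain ⟨hM1, hM2⟩ := hM
  obtain ⟨d, rfl⟩ : ∃ d, t = 2 * n + d := ⟨t - 2 * n, by omega⟩
  set H : Finset (Fin m) → MvPolynomial (Fin m) ℂ := fun A => coordPoly A (mulVar m M)
  have hH : ∀ A, (H A).IsHomogeneous d := fun A => by
    have := isHomogeneous_coordPoly_mulVar hM1 A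
    rwa [show 1 + (2 * n + d - 2 * n - 1) = d by omega] at this
  have hL : ∀ A, lap (H A) = 0 := fun A => lap_coordPoly_mulVar hM2 A
  have hf' : ∀ w, f w = ∑ A, MvPolynomial.eval w (normMul n (H A)) • cliffordBasis m A := by
    intro w
    rw [hf, vec_pow_mul_evalPoly, Finset.smul_sum]
    simp only [eval_normMul, smul_smul, H]
  have hR := fun t₀ s₀ (h : Orthonormal2 t₀ s₀) => polarizedHuaRadon_of_polynomial hm hz h
    (fun A => isHomogeneous_normMul n (hH A)) (cliffordBasis m) hf'
  refine ⟨fun t₀ s₀ h1 h2 h3 => (hR t₀ s₀ ⟨h1, h2, h3⟩).1, ?_⟩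
  -- Expanding `τ†τ` as `∑ τ†_a τ_b e_a e_b` makes every Clifford factor constant and every
  -- coefficient a scalar polynomial in `t`, `s`, the form needed by `dualRadon_of_polynomial`.
  let p : Finset (Fin m) ⊕ (Finset (Fin m) × Fin m × Fin m) → PairPoly m ℂ := Sum.elim
    (fun A => mapCoeff (sphereFun (H A)) (kernelSumPoly z n (2 * n + d)))
    (fun i => mapCoeff (sphereFun (H i.1))
      (cliffordCoeff (kernelDiagPoly z n (2 * n + d)) i.2.1 i.2.2))
  let c : Finset (Fin m) ⊕ (Finset (Fin m) × Fin m × Fin m) → Cl m := Sum.elim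
    (cliffordBasis m) (fun i => gen i.2.1 * gen i.2.2 * cliffordBasis m i.1)
  have hF : ∀ t₀ s₀ : RVec m, Orthonormal2 t₀ s₀ → polarizedHuaRadon (tauVec t₀ s₀) f z =
      ∑ i, evalPair (toCVec t₀) (toCVec s₀) (p i) • c i := by
    intro t₀ s₀ h
    rw [(hR t₀ s₀ h).2, Fintype.sum_sum_type, Fintype.sum_prod_type]
    simp only [p, c, Sum.elim_inl, Sum.elim_inr, Fintype.sum_prod_type,
      sum_kernelCoeff_degreePairs, sum_kernelCoeff_halfDegrees, evalPair_mapCoeff]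
    congr 1
    refine Finset.sum_congr rfl fun A _ => ?_
    simp only [evalReal_cliffordCoeff, map_smul, smul_eq_mul]
    rw [vec_mul_vec, Finset.sum_mul, Finset.smul_sum]
    refine Finset.sum_congr rfl fun a _ => ?_
    rw [Finset.sum_mul, Finset.smul_sum]
    refine Finset.sum_congr rfl fun b _ => ?_
    rw [smul_mul_assoc, smul_smul, mul_comm]
  obtain ⟨hC, hE⟩ := dualRadon_of_polynomial hm (F := fun τ => polarizedHuaRadon τ f z) p c hF
  refine ⟨hC, hE.trans ?_⟩
  rw [Fintype.sum_sum_type, Fintype.sum_prod_type, hf', Finset.smul_sum]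
  simp only [p, c, Sum.elim_inl, Sum.elim_inr, Fintype.sum_prod_type]
  rw [← Finset.sum_add_distrib]
  refine Finset.sum_congr rfl fun A _ => ?_
  have h := congrArg (· * cliffordBasis m A) (dualRadon_kernel_average hm (n := n) (hH A) (hL A) z)
  simp only [add_mul, Finset.sum_mul, smul_mul_assoc, ← Algebra.smul_def] at h
  rw [smul_smul]
  exact h
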